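/- **Objects.** For $k\ge2$ and $m_1,\dots,m_k\ge1$ put $\ell=m_1+\dots+m_k+k-2$ and let $H_{m_1,\dots,m_k}$ be the cubic caterpillar-Halin graph $T\cup C$ obtained as follows. The tree $T$ is the caterpillar with horizontal path $v_0v_1\cdots v_{\ell+1}$ and pendant edges $v_iu_i$ ($1\le i\le\ell$), drawn alternately up and down so that from left to right the maximal runs of consecutive pendant edges on the same side have lengths $m_1,m_2+1,\dots,m_{k-1}+1,m_k$ (first run up). $C$ is the outer cycle through the leaves $v_0,u_1,\dots,u_\ell,v_{\ell+1}$ of this plane tree. A $T$-rotation system consists of a cyclic permutation of the edges at every vertex and of a set of twisted edges containing no edge of $T$; its Euler genus is $2-(|V|-|E|+|F|)$, where the set $F$ of faces is given by face tracing. The Euler-genus polynomial is $\mathcal E_{m_1,\dots,m_k}(z)=\sum_{j\ge0}\varepsilon(j)z^j$, where $\varepsilon(j)$ is the number of $T$-rotation systems of $H_{m_1,\dots,m_k}$ of Euler genus $j$. Let $\Delta_{m_1,\dots,m_k}$ be the set of symmetric matrices over $\mathbb Z_2$, with rows and columns indexed by $e_i$ ($1\le i\le k$) and $e_{i,j}$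 ($1\le i\le k$, $1\le j\le m_i$), whose entries are arbitrary on the diagonal and at the pairs $(e_i,e_{i+1})$, $(e_{i,j},e_{i,j+1})$, $(e_i,e_{i,j})$, $(e_i,e_{i-1,m_{i-1}})$, $(e_i,e_{i+1,1})$ and their transposes, and zero elsewhere. Let $\lambda_{m_1,\dots,m_k}(z)=\sum_j\lambda_{m_1,\dots,m_k}[j]z^j$, where $\lambda_{m_1,\dots,m_k}[j]$ is the number of matrices of rank $j$ in $\Delta_{m_1,\dots,m_k}$ whose row and column $e_k$ are zero. Let $L_n(z)$ be the rank-counting polynomial of all symmetric tridiagonal $n\times n$ matrices over $\mathbb Z_2$, and $\phi_n(z)$ the one of all symmetric $n\times n$ matrices over $\mathbb Z_2$ that are tridiagonal after deletion of the first row and the first column. For $i=1,2$ define the formal power series over $\mathbb Z[z]$ $$\lambda^i(t_1,\dots,t_k,z)=\sum_{m_1,\dots,m_{k-1}\ge1,\ m_k\ge i}2^{m_k}\lambda_{m_1,\dots,m_k}(z)\,t_1^{m_1}\cdots t_k^{m_k},\qquad \mathcal E^i(t_1,\dots,t_k,z)=\sum_{m_1,\dots,m_{k-1}\ge1,\ m_k\ge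 i}\mathcal E_{m_1,\dots,m_k}(z)\,t_1^{m_1}\cdots t_k^{m_k},$$ $$\phi(t,z)=\sum_{m\ge2}\phi_m(z)t^m,\qquad L^*(t,z)=\sum_{m\ge1}2^mL_m(z)t^m,$$ and let $\mathbf v_k$ be the column vector $(\lambda^1,\lambda^2,\mathcal E^1,\mathcal E^2)^{\mathsf T}$ in the variables $t_1,\dots,t_k,z$. For variables $s,t$ put $D=1-2t-4zt-16z^2t^2$, $D'=1-t-4zt-16z^2t^2$, $$A_{11}=\tfrac{16z^2t}{D},\quad A_{13}=\tfrac{t(1+2z)+8z^2t^2}{D},\quad A_{31}=\tfrac{16z^2tA_{11}}{D'},\quad A_{32}=\tfrac{16z^2s^{-1}t}{D'},\quad A_{33}=\tfrac{16z^2t+16z^2tA_{13}}{D'},\quad A_{34}=\tfrac{(1+4z)s^{-1}t+16z^2s^{-1}t^2}{D'},$$ $$A(s,t,z)=\begin{bmatrix}A_{11}&0&A_{13}&0\\ A_{11}-16z^2t&0&A_{13}-t(1+2z)&0\\ A_{31}&A_{32}&A_{33}&A_{34}\\ A_{31}&A_{32}-16z^2s^{-1}t&A_{33}-16z^2t&A_{34}-(1+4z)s^{-1}t\end{bmatrix}.$$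 **Theorem.** In the field of fractions of the ring of formal power series over $\mathbb Z[z]$ in the variables $t_1,t_2,\dots$ the following hold. 1. For all $k\ge3$: $\mathbf v_k=A(t_{k-1},t_k,z)\,\mathbf v_{k-1}$. 2. For all $k\ge2$: $\mathbf v_k=A(t_{k-1},t_k,z)\cdots A(t_2,t_3,z)\,\mathbf v_2$ (empty product for $k=2$). 3. The entries of $\mathbf v_2$ are given by $$\lambda^1(t_1,t_2,z)=\frac{(2t_2+4zt_2+16z^2t_2^2)t_1^{-1}\phi(t_1,z)+4z^2t_2L^*(t_1,z)}{1-2t_2-4zt_2-16z^2t_2^2},$$ $$\lambda^2(t_1,t_2,z)=\lambda^1(t_1,t_2,z)-2t_2t_1^{-1}(2z+1)\phi(t_1,z)-4z^2t_2L^*(t_1,z),$$ $$\mathcal E^1(t_1,t_2,z)=\frac{(32z^2t_1^{-2}t_2^2+2t_1^{-3}t_2)\phi(t_1,z)+16z^2t_2\lambda^1(t_1,t_2,z)}{1-t_2-4zt_2-16z^2t_2^2}-\frac{(8z^2+6z+2)t_1^{-1}t_2+(56z^3+56z^2+14z+2)t_2+32z^2t_2^2(4z^2+3z+1)}{1-t_2-4zt_2-16z^2t_2^2},$$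 $$\mathcal E^2(t_1,t_2,z)=\mathcal E^1(t_1,t_2,z)-2t_1^{-3}t_2\phi(t_1,z)+(8z^2+6z+2)t_1^{-1}t_2+(56z^3+56z^2+14z+2)t_2,$$ where $$\phi(t,z)=\frac{t^2\big(1+3z+4z^2-2(1+5z+4z^2+2z^3)t-16z^2(2+6z+5z^2)t^2-128z^4(1+z)t^3\big)}{(1-2t-4tz-16z^2t^2)(1-t-4tz-16z^2t^2)},\qquad L^*(t,z)=\frac{8z^2t^2+2t(1+z)}{1-(4z+2)t-16z^2t^2}.$$ -/

import Mathlib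

open Matrix

noncomputable section

namespace CaterpillarHalin

/-! ### Rotation systems, faces and Euler genus -/

section Embeddings

variable {V : Type*}

/-- A general rotation system on a graph: a cyclic permutation of the edge-ends (darts) at every
vertex, and for every edge the information whether it is twisted (`true`) or not (`false`). -/
structure RotationSystem (G : SimpleGraph V) where
  rot : Equiv.Perm G.Dart
  isCycleOn_rot : ∀ v : V, rot.IsCycleOn {d : G.Dart | d.fst = v}
  twist : G.edgeSet → Bool

namespace RotationSystem

variable {G : SimpleGraph V} (R : RotationSystem G)

/-- Face tracing. The pair `(d, true)` is the side of the dart `d` that looks towards its successor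
`rot d` at the initial vertex of `d`, and `(d, false)` is the other side. Two sides are consecutive
on a facial walk if they bound a common corner at a vertex, or if they are the two ends of one
side of an edge; that side joins opposite signs if the edge is untwisted (the local orientations
agree along it) and equal signs if it is twisted. -/
inductive Consecutive : G.Dart × Bool → G.Dart × Bool → Prop
  | corner (d : G.Dart) : Consecutive (d, true) (R.rot d, false)
  | side (d : G.Dart) (s : Bool) :
      Consecutive (d, s) (d.symm, xor (!s) (R.twist ⟨d.edge, d.edge_mem⟩))

/-- The faces: the classes of the equivalence relation generated by `Consecutive`. -/
def Face : Type _ := Quot R.Consecutive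

/-- The Euler genus `2 - (|V| - |E| + |F|)` of the embedding of a connected graph with at least
one edge (`2j` for the orientable surface `O_j`, and `k` for the nonorientable surface `N_k`). -/
def eulerGenus : ℤ :=
  2 - ((Nat.card V : ℤ) - (Nat.card G.edgeSet : ℤ) + (Nat.card R.Face : ℤ))

/-- `R` is a `T`-rotation system: no edge of `T` is twisted. -/
def IsTRotation (T : SimpleGraph V) : Prop :=
  ∀ e : G.edgeSet, (e : Sym2 V) ∈ T.edgeSet → R.twist e = false

end RotationSystem

/-- The number of embeddings (`T`-rotation systems, `T` a spanning tree) of Euler genus `j`. -/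
def embeddingCount (G T : SimpleGraph V) (j : ℕ) : ℕ :=
  Nat.card {R : RotationSystem G // R.IsTRotation T ∧ R.eulerGenus = (j : ℤ)}

/-- The Euler-genus polynomial of a connected graph `G` with spanning tree `T`. As there is at
least one vertex and at least one face, the Euler genus is at most the number of edges. -/
def eulerGenusPoly (G T : SimpleGraph V) : Polynomial ℤ :=
  ∑ j ∈ Finset.range (Nat.card G.edgeSet + 1),
    Polynomial.C (embeddingCount G T j : ℤ) * Polynomial.X ^ j

end Embeddings

/-! ### The cubic caterpillar-Halin graphs `H_{m_1,…,m_k}`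

The indices are the entries `m 1, …, m k` of a function `m : ℕ → ℕ`; its other values are not
used. -/

/-- The number of pendant edges in the `i`-th maximal run of consecutive pendant edges on the same
side of the spine: `m_1, m_2 + 1, …, m_{k-1} + 1, m_k`. -/
def runLength (k : ℕ) (m : ℕ → ℕ) (i : ℕ) : ℕ :=
  if i = 1 ∨ i = k then m i else m i + 1

/-- The position on the spine of the last pendant edge of the `i`-th run. -/
def runEnd (k : ℕ) (m : ℕ → ℕ) (i : ℕ) : ℕ :=
  ∑ j ∈ Finset.Icc 1 i, runLength k m j

/-- The number `ℓ` of spine vertices. -/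
def spineLength (k : ℕ) (m : ℕ → ℕ) : ℕ := runEnd k m k

/-- The vertices for a spine with `ℓ` vertices: `inl i` is `v_i` for `0 ≤ i ≤ ℓ + 1` (the spine
`v_1, …, v_ℓ` together with the end leaves `v_0`, `v_{ℓ+1}`), and `inr i` is the leaf `u_{i+1}`
pending from `v_{i+1}`, for `1 ≤ i + 1 ≤ ℓ`. -/
abbrev Vertex (l : ℕ) : Type := Fin (l + 2) ⊕ Fin l

/-- The horizontal position of a vertex (`i` for `v_i` and `u_i`). -/
def position {l : ℕ} : Vertex l → ℕ
  | Sum.inl i => (i : ℕ)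
  | Sum.inr i => (i : ℕ) + 1

/-- The leaves of the caterpillar: `v_0`, `v_{ℓ+1}` and all `u_i`. -/
def IsLeaf {l : ℕ} : Vertex l → Prop
  | Sum.inl i => (i : ℕ) = 0 ∨ (i : ℕ) = l + 1
  | Sum.inr _ => True

/-- The caterpillar (characteristic tree), with edges `v_i v_{i+1}` for `0 ≤ i ≤ ℓ`, and `v_i u_i`
for `1 ≤ i ≤ ℓ`. -/
def caterpillar (l : ℕ) : SimpleGraph (Vertex l) :=
  SimpleGraph.fromRel fun a b =>
    match a, b with
    | Sum.inl i, Sum.inl j => (j : ℕ) = (i : ℕ) + 1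
    | Sum.inl i, Sum.inr j => (i : ℕ) = (j : ℕ) + 1
    | _, _ => False

/-- The pendant edge at position `p` points up (`true`) in the first, third, … run and down
(`false`) in the second, fourth, … run. -/
def direction (k : ℕ) (m : ℕ → ℕ) (p : ℕ) : Bool :=
  decide (Even ((Finset.Icc 1 k).filter fun i => runEnd k m i < p).card)

/-- The leaf at position `p` is on the side `s` of the spine; both end leaves are on both sides. -/
def OnSide (k : ℕ) (m : ℕ → ℕ) (s : Bool) (p : ℕ) : Prop :=
  p = 0 ∨ p = spineLength k m + 1 ∨ direction k m p = s

/-- The outer cycle through the leaves: from `v_0` along the upper leaves to `v_{ℓ+1}`, and back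
along the lower leaves. Two leaves are joined if they are next to each other on a side. -/
def outerCycle (k : ℕ) (m : ℕ → ℕ) : SimpleGraph (Vertex (spineLength k m)) :=
  SimpleGraph.fromRel fun a b =>
    IsLeaf a ∧ IsLeaf b ∧ position a < position b ∧
      ∃ s : Bool, OnSide k m s (position a) ∧ OnSide k m s (position b) ∧
        ∀ p : ℕ, position a < p → p < position b → ¬ OnSide k m s p

/-- The cubic caterpillar-Halin graph `H_{m_1,…,m_k}`. -/
def halinGraph (k : ℕ) (m : ℕ → ℕ) : SimpleGraph (Vertex (spineLength k m)) :=
  caterpillar (spineLength k m) ⊔ outerCycle k m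

/-- The Euler-genus polynomial of `H_{m_1,…,m_k}`, with the caterpillar as spanning tree (the
co-tree edges are the edges of the outer cycle). -/
def eulerPoly (k : ℕ) (m : ℕ → ℕ) : Polynomial ℤ :=
  eulerGenusPoly (halinGraph k m) (caterpillar (spineLength k m))

/-! ### Rank polynomials of families of binary matrices -/

/-- The polynomial whose coefficient at `z^j` is the number of matrices of rank `j` in `S`. -/
def rankPoly {ι : Type*} [Fintype ι] (S : Set (Matrix ι ι (ZMod 2))) : Polynomial ℤ :=
  ∑ j ∈ Finset.range (Fintype.card ι + 1),
    Polynomial.C ((S ∩ {M | M.rank = j}).ncard : ℤ) * Polynomial.X ^ j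

/-- The symmetric tridiagonal matrix with diagonal `x_1, …, x_n` and off-diagonal entries
`y_1, …, y_{n-1}`. -/
def tridiagonal (n : ℕ) (x y : ℕ → ZMod 2) : Matrix (Fin n) (Fin n) (ZMod 2) :=
  Matrix.of fun a b =>
    if (a : ℕ) = b then x (a + 1)
    else if (a : ℕ) + 1 = b then y (a + 1)
    else if (b : ℕ) + 1 = a then y (b + 1)
    else 0

/-- The polynomial `L_n(z)`. -/
def tridiagonalPoly (n : ℕ) : Polynomial ℤ :=
  rankPoly {M | ∃ x y : ℕ → ZMod 2, M = tridiagonal n x y}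

/-- The overlap matrix `Φ_n` of a Ringel ladder: rows and columns `0, …, n - 1`, diagonal
`x_0, …, x_{n-1}`, entries `z_1, …, z_{n-1}` in the row and the column `0`, and the entry `y_i` at
`(i, i+1)` and `(i+1, i)` for `1 ≤ i`. -/
def ladderMatrix (n : ℕ) (x y z : ℕ → ZMod 2) : Matrix (Fin n) (Fin n) (ZMod 2) :=
  Matrix.of fun a b =>
    if (a : ℕ) = b then x a
    else if (a : ℕ) = 0 then z b
    else if (b : ℕ) = 0 then z a
    else if (a : ℕ) + 1 = b then y a
    else if (b : ℕ) + 1 = a then y b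
    else 0

/-- The polynomial `φ_n(z)`. -/
def ladderPoly (n : ℕ) : Polynomial ℤ :=
  rankPoly {M | ∃ x y z : ℕ → ZMod 2, M = ladderMatrix n x y z}

/-- The index set of the overlap matrices of `H_{m_1,…,m_k}`: `inl i` stands for the co-tree edge
`e_{i+1}`, and `inr ⟨i, j⟩` for the co-tree edge `e_{i+1,j+1}`. -/
abbrev OverlapIndex (k : ℕ) (m : ℕ → ℕ) : Type :=
  Fin k ⊕ (Σ i : Fin k, Fin (m ((i : ℕ) + 1)))

/-- The entry of the block `M_i` in the row `j` (`1 ≤ j ≤ m_i`) and the column `c`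
(`1 ≤ c ≤ k`). -/
def sideEntry (m : ℕ → ℕ) (z : ℕ → ℕ → ZMod 2) (i j c : ℕ) : ZMod 2 :=
  if c = i then z i j
  else if c + 1 = i ∧ j = 1 then z c (m c + 1)
  else if c = i + 1 ∧ j = m i then z c 0
  else 0

/-- The matrix `Δ_{m_1,…,m_k}^{X,Y,Z}`, with `x_0 = (x_1, …, x_k)`, `y_0 = (y_1, …, y_{k-1})`,
`x_i = (x_{i,1}, …, x_{i,m_i})`, `y_i = (y_{i,1}, …, y_{i,m_i-1})`, and
`z_i = (z_{i,0}, …, z_{i,m_i+1})` (without `z_{1,0}` and `z_{k,m_k+1}`). -/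
def overlapMatrix (k : ℕ) (m : ℕ → ℕ) (x₀ y₀ : ℕ → ZMod 2) (x y z : ℕ → ℕ → ZMod 2) :
    Matrix (OverlapIndex k m) (OverlapIndex k m) (ZMod 2) :=
  Matrix.of fun a b =>
    match a, b with
    | Sum.inl c, Sum.inl d => tridiagonal k x₀ y₀ c d
    | Sum.inl c, Sum.inr ⟨i, j⟩ => sideEntry m z (i + 1) (j + 1) (c + 1)
    | Sum.inr ⟨i, j⟩, Sum.inl c => sideEntry m z (i + 1) (j + 1) (c + 1)
    | Sum.inr ⟨i, j⟩, Sum.inr ⟨i', j'⟩ =>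
        if i = i' then
          if (j : ℕ) = j' then x (i + 1) (j + 1)
          else if (j : ℕ) + 1 = j' then y (i + 1) (j + 1)
          else if (j' : ℕ) + 1 = j then y (i + 1) (j' + 1)
          else 0
        else 0

/-- The polynomial `λ_{m_1,…,m_k}(z)`: the rank polynomial of the set of matrices `Λ`, that is, of
those matrices of the form `Δ_{m_1,…,m_k}` in which the `k`-th row and the `k`-th column are
zero. -/
def lambdaPoly (k : ℕ) (m : ℕ → ℕ) : Polynomial ℤ :=
  rankPoly {M : Matrix (OverlapIndex k m) (OverlapIndex k m) (ZMod 2) |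
    (∃ (x₀ y₀ : ℕ → ZMod 2) (x y z : ℕ → ℕ → ZMod 2), M = overlapMatrix k m x₀ y₀ x y z) ∧
    ∀ c : Fin k, (c : ℕ) + 1 = k → ∀ a, M (Sum.inl c) a = 0 ∧ M a (Sum.inl c) = 0}

/-! ### Generating functions

They are formal power series over `ℤ[z]` in variables `t_1, t_2, …`, and identities with
denominators live in the field of fractions of the ring of these series. -/

/-- Formal power series over `ℤ[z]` in the variables `t_i` (`t_0` is never used). -/
abbrev Series : Type := MvPowerSeries ℕ (Polynomial ℤ)

/-- The field of fractions of the ring of power series. -/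
abbrev Frac : Type := FractionRing Series

open Classical in
/-- The series `∑ f(m_1,…,m_k) t_1^{m_1} ⋯ t_k^{m_k}` over `m_1, …, m_{k-1} ≥ 1`, `m_k ≥ i`. -/
def genSeries (k i : ℕ) (f : (ℕ → ℕ) → Polynomial ℤ) : Series := fun n =>
  if n.support ⊆ Finset.Icc 1 k ∧ (∀ j ∈ Finset.Icc 1 (k - 1), 1 ≤ n j) ∧ i ≤ n k
  then f n else 0

/-- `λ^i(t_1,…,t_k,z)`. -/
def lambdaGF (k i : ℕ) : Frac :=
  algebraMap Series Frac (genSeries k i fun m => 2 ^ m k * lambdaPoly k m)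

/-- `E^i(t_1,…,t_k,z)`. -/
def eulerGF (k i : ℕ) : Frac :=
  algebraMap Series Frac (genSeries k i fun m => eulerPoly k m)

/-- The series `∑_{m ≥ r} f(m) t_1^m`. -/
def genSeriesOne (r : ℕ) (f : ℕ → Polynomial ℤ) : Series := fun n =>
  if n.support ⊆ {1} ∧ r ≤ n 1 then f (n 1) else 0

/-- `φ(t_1,z) = ∑_{m ≥ 2} φ_m(z) t_1^m`. -/
def ladderGF : Frac := algebraMap Series Frac (genSeriesOne 2 ladderPoly)

/-- `L^*(t_1,z) = ∑_{m ≥ 1} 2^m L_m(z) t_1^m`. -/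
def tridiagonalGF : Frac :=
  algebraMap Series Frac (genSeriesOne 1 fun m => 2 ^ m * tridiagonalPoly m)

/-- The variable `t_i`. -/
def tVar (i : ℕ) : Frac := algebraMap Series Frac (MvPowerSeries.X i)

/-- The variable `z`. -/
def zVar : Frac := algebraMap Series Frac (MvPowerSeries.C Polynomial.X)

/-- The vector `(λ^1, λ^2, E^1, E^2)` in the variables `t_1, …, t_k, z`. -/
def genVec (k : ℕ) : Fin 4 → Frac := ![lambdaGF k 1, lambdaGF k 2, eulerGF k 1, eulerGF k 2]

/-- The transfer matrix `A(s, t, z)`. -/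
def transferMatrix {K : Type*} [Field K] (s t z : K) : Matrix (Fin 4) (Fin 4) K :=
  let D := 1 - 2 * t - 4 * z * t - 16 * z ^ 2 * t ^ 2
  let D' := 1 - t - 4 * z * t - 16 * z ^ 2 * t ^ 2
  let A₁₁ := 16 * z ^ 2 * t / D
  let A₁₃ := (t * (1 + 2 * z) + 8 * z ^ 2 * t ^ 2) / D
  let A₃₁ := 16 * z ^ 2 * t * A₁₁ / D'
  let A₃₂ := 16 * z ^ 2 * s⁻¹ * t / D'
  let A₃₃ := (16 * z ^ 2 * t + 16 * z ^ 2 * t * A₁₃) / D'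
  let A₃₄ := ((1 + 4 * z) * s⁻¹ * t + 16 * z ^ 2 * s⁻¹ * t ^ 2) / D'
  !![A₁₁, 0, A₁₃, 0;
     A₁₁ - 16 * z ^ 2 * t, 0, A₁₃ - t * (1 + 2 * z), 0;
     A₃₁, A₃₂, A₃₃, A₃₄;
     A₃₁, A₃₂ - 16 * z ^ 2 * s⁻¹ * t, A₃₃ - 16 * z ^ 2 * t, A₃₄ - (1 + 4 * z) * s⁻¹ * t]

/-- The ordered product `A(t_{k-1}, t_k, z) ⋯ A(t_2, t_3, z)`, empty for `k ≤ 2`. -/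
def transferProduct : ℕ → Matrix (Fin 4) (Fin 4) Frac
  | 0 => 1
  | 1 => 1
  | 2 => 1
  | k + 3 => transferMatrix (tVar (k + 2)) (tVar (k + 3)) zVar * transferProduct (k + 2)

end CaterpillarHalin

end

open CaterpillarHalin

noncomputable section

open Matrix Polynomial

set_option linter.unusedSectionVars false

namespace CaterpillarHalin

/-! ### Rank-generating sums of supported symmetric matrices -/

section Elimination

variable {ι κ : Type*} [Fintype ι] [DecidableEq ι] [Fintype κ] [DecidableEq κ]

/-! Everything is reduced to counting symmetric matrices over `ZMod 2` by rank.

Topology. The `ZMod 2`-valued functions on the corners that are constant along faces number 2^|F|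
(`CubicPorts.card_face`). Compare a rotation system with the plane embedding of the Halin graph:
every such function has the form g(plane face) + a(vertex), with g normalised to 0 on the outer
face. The equations along the edges of the caterpillar determine a from g and one free bit. After
that, the equations along the leaf cycle form a homogeneous linear system for g, whose matrix is the
overlap matrix. Hence |F| = 1 + (l + 2) - rank, and counting vertices and edges of the cubic graph
turns this into "Euler genus = rank" (`eulerGenus_system`). The off-diagonal entries of the overlap
matrix are differences of rotation-reversal bits along tree edges, the diagonal entries are the
twists. So every symmetric matrix supported on a fixed graph occurs, and occurs exactly twice,
because reversing all rotations simultaneously changes nothing. This is the factor 2 in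
`eulerPoly_eq`. The supporting graph is `strip`: the fans of the successive runs, each overlapping
the next.

Algebra. Remove the last vertex x of the supporting graph. If x is pendant, or has two adjacent
neighbours of the right kind, then pivoting on an entry at x adds to the rest of the matrix a
correction that the graph still allows. Translation by a fixed allowed matrix permutes the allowed
matrices, so the correction disappears on summation. This gives `rankSum_pendant` and
`rankSum_simplicial`. Peeling off the last fan, with or without its centre, yields `fanSum_add_two`
and `cutSum_add_two`. A last fan with at most one rim vertex is merely a prolongation of the
preceding fan (`fanSum_succ_zero`, `fanSum_succ_one`, `cutSum_succ_zero`, `cutSum_succ_one`), which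
is how k passes to k - 1.

Generating functions. The centre of the last fan has a degree growing with the number of rim
vertices, so the recurrence for the Euler polynomials contains a power of two; the weight 2^(m_k) in
the λ series absorbs it and leaves constant coefficients. The recurrences become linear equations
between power series, free of division (`layer` and the functional equations). In the field of
fractions they are solved for the new vector, which gives the transfer matrix
(`eq_transferMatrix_mulVec`); the single-fan polynomials φ and L supply the case k = 2. -/

open Classical in
/-- The symmetric binary matrices supported on `S`, whose off-diagonal support is in `Γ`. -/
def supported (Γ : SimpleGraph ι) (S : Finset ι) : Finset (Matrix ι ι (ZMod 2)) :=
  Finset.univ.filter fun M =>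
    (∀ i j, M i j = M j i) ∧ ∀ i j, M i j ≠ 0 → i ∈ S ∧ j ∈ S ∧ (i = j ∨ Γ.Adj i j)

lemma mem_supported {Γ : SimpleGraph ι} {S : Finset ι} {M : Matrix ι ι (ZMod 2)} :
    M ∈ supported Γ S ↔
      (∀ i j, M i j = M j i) ∧ ∀ i j, M i j ≠ 0 → i ∈ S ∧ j ∈ S ∧ (i = j ∨ Γ.Adj i j) := by
  simp [supported]

/-- The rank polynomial of `supported Γ S`. -/
def rankSum (Γ : SimpleGraph ι) (S : Finset ι) : ℤ[X] :=
  ∑ M ∈ supported Γ S, X ^ M.rank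

lemma rankPoly_coe (s : Finset (Matrix ι ι (ZMod 2))) :
    rankPoly (s : Set (Matrix ι ι (ZMod 2))) = ∑ M ∈ s, (X : ℤ[X]) ^ M.rank := by
  classical
  have h : ∀ M ∈ s, M.rank ∈ Finset.range (Fintype.card ι + 1) := fun M _ =>
    Finset.mem_range.2 (Nat.lt_succ_of_le (by simpa using M.rank_le_card_width))
  rw [← Finset.sum_fiberwise_of_maps_to h, rankPoly]
  refine Finset.sum_congr rfl fun j _ => ?_
  rw [Finset.sum_congr rfl (g := fun _ => (X : ℤ[X]) ^ j)
    (fun M hM => by rw [(Finset.mem_filter.1 hM).2]), Finset.sum_const]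
  have : (s : Set (Matrix ι ι (ZMod 2))) ∩ {M | M.rank = j}
      = ((s.filter fun M => M.rank = j : Finset _) : Set (Matrix ι ι (ZMod 2))) := by
    ext; simp
  rw [this, Set.ncard_coe_finset]
  simp

lemma rankPoly_eq_rankSum {s : Set (Matrix ι ι (ZMod 2))} {Γ : SimpleGraph ι} {S : Finset ι}
    (h : ∀ M, M ∈ s ↔ M ∈ supported Γ S) : rankPoly s = rankSum Γ S := by
  have : s = (supported Γ S : Set (Matrix ι ι (ZMod 2))) := by ext M; simp [h]
  rw [this, rankPoly_coe, rankSum]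

/-- With P the 0/1 matrix of the embedding, the small matrix is PᵀMP, and the support condition
makes M equal to P times the small matrix times Pᵀ. Each rank is therefore bounded by the other. -/
lemma rank_submatrix_of_support (e : ι ↪ κ) (M : Matrix κ κ (ZMod 2))
    (h : ∀ i j, M i j ≠ 0 → i ∈ Set.range e ∧ j ∈ Set.range e) :
    (M.submatrix e e).rank = M.rank := by
  let P : Matrix κ ι (ZMod 2) := Matrix.of fun k i => if k = e i then 1 else 0
  have h1 : M.submatrix e e = Pᵀ * M * P := by
    ext i j
    simp [Matrix.mul_apply, P]
  have h2 : M = P * M.submatrix e e * Pᵀ := by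
    ext a b
    simp only [Matrix.mul_apply, P, Matrix.of_apply, Matrix.submatrix_apply, Matrix.transpose_apply,
      ite_mul, one_mul, zero_mul, mul_ite, mul_one, mul_zero]
    by_cases hab : M a b = 0
    · rw [hab]
      refine (Finset.sum_eq_zero fun j _ => ?_).symm
      split_ifs with hb
      · refine Finset.sum_eq_zero fun i _ => ?_
        split_ifs with ha
        · rw [← ha, ← hb, hab]
        · rfl
      · rfl
    · obtain ⟨⟨i, rfl⟩, ⟨j, rfl⟩⟩ := h a b hab
      simp [e.injective.eq_iff]
  apply le_antisymm
  · rw [h1]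
    exact (rank_mul_le_left _ _).trans (rank_mul_le_right _ _)
  · conv_lhs => rw [h2]
    exact (rank_mul_le_left _ _).trans (rank_mul_le_right _ _)

/-- Restricting to the image of `e` and extending by zero are inverse to each other and preserve
rank. This makes the sum depend only on the graph and the support, not on the index type. -/
lemma rankSum_comap (e : ι ↪ κ) (Γ : SimpleGraph κ) (S : Finset ι) :
    rankSum (Γ.comap e) S = rankSum Γ (S.map e) := by
  classical
  symm
  have hrange : ∀ M ∈ supported Γ (S.map e), ∀ i j, M i j ≠ 0 →
      i ∈ Set.range e ∧ j ∈ Set.range e := by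
    intro M hM i j hij
    obtain ⟨hi, hj, -⟩ := (mem_supported.1 hM).2 i j hij
    obtain ⟨i, -, rfl⟩ := Finset.mem_map.1 hi
    obtain ⟨j, -, rfl⟩ := Finset.mem_map.1 hj
    exact ⟨⟨i, rfl⟩, ⟨j, rfl⟩⟩
  have hinj : ∀ (N : Matrix ι ι (ZMod 2)) (i j : ι), (∑ a, ∑ b,
      if e i = e a ∧ e j = e b then N a b else 0) = N i j := by
    intro N i j
    simp only [e.injective.eq_iff, ite_and]
    simp
  refine Finset.sum_bij' (fun M _ => M.submatrix e e)
    (fun N _ => Matrix.of fun i j => ∑ a, ∑ b, if i = e a ∧ j = e b then N a b else 0)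
    ?_ ?_ ?_ ?_ ?_
  · intro M hM
    rw [mem_supported] at hM ⊢
    refine ⟨fun i j => hM.1 _ _, fun i j hij => ?_⟩
    obtain ⟨hi, hj, h⟩ := hM.2 _ _ hij
    simpa using And.intro hi (And.intro hj h)
  · intro N hN
    rw [mem_supported] at hN ⊢
    constructor
    · intro i j
      simp only [Matrix.of_apply]
      rw [Finset.sum_comm]
      refine Finset.sum_congr rfl fun a _ => Finset.sum_congr rfl fun b _ => ?_
      rw [hN.1 b a]
      simp only [and_comm]
    · intro i j hij
      obtain ⟨a, -, ha⟩ := Finset.exists_ne_zero_of_sum_ne_zero hij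
      obtain ⟨b, -, hb⟩ := Finset.exists_ne_zero_of_sum_ne_zero ha
      split_ifs at hb with hc
      · obtain ⟨rfl, rfl⟩ := hc
        simpa using hN.2 a b hb
      · exact absurd rfl hb
  · intro M hM
    ext i j
    simp only [Matrix.of_apply]
    by_cases h0 : M i j = 0
    · rw [h0]
      refine Finset.sum_eq_zero fun a _ => Finset.sum_eq_zero fun b _ => ?_
      split_ifs with hc
      · obtain ⟨rfl, rfl⟩ := hc
        exact h0
      · rfl
    · obtain ⟨⟨i, rfl⟩, ⟨j, rfl⟩⟩ := hrange M hM i j h0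
      exact hinj (M.submatrix e e) i j
  · intro N hN
    ext i j
    exact hinj N i j
  · intro M hM
    rw [rank_submatrix_of_support e M (hrange M hM)]

/-- Elimination of a pivot entry. -/
lemma rank_eq_succ_of_pivot (N : Matrix ι ι (ZMod 2)) (x y : ι) (h : N x y = 1) :
    N.rank = 1 + (Matrix.of fun i j => N i j - N i y * N x j).rank := by
  set C : Matrix ι ι (ZMod 2) := Matrix.of fun i j => N i j - N i y * N x j with hC
  have hspan : Submodule.span (ZMod 2) (Set.range N.col)
      = Submodule.span (ZMod 2) {N.col y} ⊔ Submodule.span (ZMod 2) (Set.range C.col) := by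
    apply le_antisymm
    · rw [Submodule.span_le]
      rintro _ ⟨j, rfl⟩
      have : N.col j = N x j • N.col y + C.col j := by
        ext i
        simp [hC, Matrix.col]
        ring
      rw [this]
      exact Submodule.add_mem_sup (Submodule.smul_mem _ _ (Submodule.mem_span_singleton_self _))
        (Submodule.subset_span ⟨j, rfl⟩)
    · refine sup_le ?_ ?_
      · rw [Submodule.span_singleton_le_iff_mem]
        exact Submodule.subset_span ⟨y, rfl⟩
      · rw [Submodule.span_le]
        rintro _ ⟨j, rfl⟩
        have : C.col j = N.col j - N x j • N.col y := by
          ext i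
          simp [hC, Matrix.col]
          ring
        rw [this]
        exact Submodule.sub_mem _ (Submodule.subset_span ⟨j, rfl⟩)
          (Submodule.smul_mem _ _ (Submodule.subset_span ⟨y, rfl⟩))
  -- All columns of `C` vanish in coordinate `x`, while column `y` of `N` has entry 1 there.
  have hdisj : Submodule.span (ZMod 2) {N.col y} ⊓ Submodule.span (ZMod 2) (Set.range C.col) = ⊥ := by
    rw [eq_bot_iff]
    rintro v ⟨hv1, hv2⟩
    obtain ⟨c, rfl⟩ := Submodule.mem_span_singleton.1 hv1
    have hx : Submodule.span (ZMod 2) (Set.range C.col)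
        ≤ LinearMap.ker (LinearMap.proj (R := ZMod 2) (φ := fun _ : ι => ZMod 2) x) := by
      rw [Submodule.span_le]
      rintro _ ⟨j, rfl⟩
      simp [hC, Matrix.col, h]
    have := hx hv2
    simp [Matrix.col, h] at this
    simp [this]
  have hne : N.col y ≠ 0 := by
    intro h0
    have := congrFun h0 x
    simp [Matrix.col, h] at this
  have := Submodule.finrank_sup_add_finrank_inf_eq (Submodule.span (ZMod 2) {N.col y})
    (Submodule.span (ZMod 2) (Set.range C.col))
  rw [hdisj, finrank_bot, add_zero, finrank_span_singleton hne] at this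
  rw [rank_eq_finrank_span_cols, rank_eq_finrank_span_cols, hspan, this]

/-- The binary vectors supported on `T`. -/
def vecs (T : Finset ι) : Finset (ι → ZMod 2) :=
  Finset.univ.filter fun r => ∀ i, r i ≠ 0 → i ∈ T

lemma mem_vecs {T : Finset ι} {r : ι → ZMod 2} : r ∈ vecs T ↔ ∀ i, r i ≠ 0 → i ∈ T := by
  simp [vecs]

lemma sum_vecs_insert {T : Finset ι} {a : ι} (ha : a ∉ T) {A : Type*} [AddCommMonoid A]
    (f : (ι → ZMod 2) → A) :
    ∑ r ∈ vecs (insert a T), f r = ∑ r ∈ vecs T, (f r + f (Function.update r a 1)) := by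
  classical
  rw [← Finset.sum_filter_add_sum_filter_not (vecs (insert a T)) (fun r => r a = 0),
    Finset.sum_add_distrib]
  congr 1
  · refine Finset.sum_congr ?_ fun _ _ => rfl
    ext r
    simp only [Finset.mem_filter, mem_vecs, Finset.mem_insert]
    constructor
    · rintro ⟨h, h0⟩ i hi
      rcases h i hi with rfl | h
      · exact absurd h0 hi
      · exact h
    · refine fun h => ⟨fun i hi => Or.inr (h i hi), ?_⟩
      by_contra h0
      exact ha (h a h0)
  · symm
    refine Finset.sum_bij' (fun r _ => Function.update r a 1) (fun r _ => Function.update r a 0)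
      ?_ ?_ ?_ ?_ ?_
    · intro r hr
      rw [mem_vecs] at hr
      simp only [Finset.mem_filter, mem_vecs, Finset.mem_insert]
      refine ⟨fun i hi => ?_, by simp⟩
      by_cases hia : i = a
      · exact Or.inl hia
      · rw [Function.update_of_ne hia] at hi
        exact Or.inr (hr i hi)
    · intro r hr
      simp only [Finset.mem_filter, mem_vecs, Finset.mem_insert] at hr
      rw [mem_vecs]
      intro i hi
      by_cases hia : i = a
      · subst hia; simp at hi
      · rw [Function.update_of_ne hia] at hi
        exact (hr.1 i hi).resolve_left hia
    · intro r hr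
      rw [mem_vecs] at hr
      have : r a = 0 := by
        by_contra h0
        exact ha (hr a h0)
      rw [Function.update_idem, ← this, Function.update_eq_self]
    · intro r hr
      simp only [Finset.mem_filter] at hr
      have : r a = 1 := Fin.eq_one_of_ne_zero (r a) hr.2
      rw [Function.update_idem, ← this, Function.update_eq_self]
    · intros; rfl

lemma vecs_empty : vecs (∅ : Finset ι) = {0} := by
  ext r
  simp only [mem_vecs, Finset.notMem_empty, Finset.mem_singleton]
  constructor
  · intro h
    ext i
    by_contra h0
    exact h i h0
  · rintro rfl i hi
    exact hi rfl

lemma card_vecs (T : Finset ι) : (vecs T).card = 2 ^ T.card := by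
  classical
  induction T using Finset.induction_on with
  | empty => simp [vecs_empty]
  | insert a T ha ih =>
    rw [Finset.card_eq_sum_ones, sum_vecs_insert ha, Finset.sum_const, ih,
      Finset.card_insert_of_notMem ha]
    simp [pow_succ]

/-- The symmetric matrix with diagonal entry `d` and row `r` at `x`, and entries `B` elsewhere. -/
def border (x : ι) (d : ZMod 2) (r : ι → ZMod 2) (B : Matrix ι ι (ZMod 2)) :
    Matrix ι ι (ZMod 2) :=
  Matrix.of fun i j => if i = x then (if j = x then d else r j) else if j = x then r i else B i j

open Classical in
/-- The neighbours of `x` in `S`. -/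
def nbrs {ι : Type*} (Γ : SimpleGraph ι) (S : Finset ι) (x : ι) : Finset ι := S.filter (Γ.Adj x)

lemma mem_nbrs {ι : Type*} {Γ : SimpleGraph ι} {S : Finset ι} {x y : ι} :
    y ∈ nbrs Γ S x ↔ y ∈ S ∧ Γ.Adj x y := by simp [nbrs]

/-- A matrix on the enlarged support consists of free data at `x`, namely a diagonal bit and a row
on the neighbours of `x`, together with an arbitrary matrix on `S`. -/
lemma sum_supported_insert (Γ : SimpleGraph ι) {S : Finset ι} {x : ι} (hx : x ∉ S)
    {A : Type*} [AddCommMonoid A] (f : Matrix ι ι (ZMod 2) → A) :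
    ∑ M ∈ supported Γ (insert x S), f M
      = ∑ d : ZMod 2, ∑ r ∈ vecs (nbrs Γ S x), ∑ B ∈ supported Γ S, f (border x d r B) := by
  classical
  rw [← Finset.sum_product', ← Finset.sum_product']
  symm
  refine Finset.sum_bij' (fun p _ => border x p.1.1 p.1.2 p.2)
    (fun M _ => ((M x x, fun j => if j = x then 0 else M x j),
      Matrix.of fun i j => if i = x ∨ j = x then 0 else M i j)) ?_ ?_ ?_ ?_ ?_
  · rintro ⟨⟨d, r⟩, B⟩ h
    simp only [Finset.mem_product, Finset.mem_univ, true_and, mem_vecs, mem_nbrs] at h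
    obtain ⟨hr, hB⟩ := h
    rw [mem_supported] at hB ⊢
    constructor
    · intro i j
      simp only [border, Matrix.of_apply]
      split_ifs <;> simp_all
    · intro i j hij
      simp only [border, Matrix.of_apply] at hij
      split_ifs at hij with h1 h2 h2
      · simp [h1, h2]
      · have := hr j hij
        simp [h1, this.1, this.2]
      · have := hr i hij
        simp [h2, this.1, this.2.symm]
      · have := hB.2 i j hij
        simp [this.1, this.2.1, this.2.2]
  · intro M hM
    rw [mem_supported] at hM
    simp only [Finset.mem_product, Finset.mem_univ, true_and, mem_vecs, mem_nbrs, mem_supported,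
      Matrix.of_apply]
    refine ⟨fun i hi => ?_, fun i j => ?_, fun i j hij => ?_⟩
    · split_ifs at hi with h
      · exact absurd rfl hi
      · obtain ⟨-, h1, h2⟩ := hM.2 x i hi
        exact ⟨(Finset.mem_insert.1 h1).resolve_left h, h2.resolve_left (Ne.symm h)⟩
    · rw [hM.1 i j]
      simp only [or_comm]
    · split_ifs at hij with h
      · exact absurd rfl hij
      · push Not at h
        obtain ⟨h0, h1, h2⟩ := hM.2 i j hij
        exact ⟨(Finset.mem_insert.1 h0).resolve_left h.1,
          (Finset.mem_insert.1 h1).resolve_left h.2, h2⟩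
  · rintro ⟨⟨d, r⟩, B⟩ h
    simp only [Finset.mem_product, Finset.mem_univ, true_and, mem_vecs, mem_nbrs] at h
    obtain ⟨hr, hB⟩ := h
    rw [mem_supported] at hB
    have h1 : r x = 0 := by
      by_contra h0
      exact hx (hr x h0).1
    have h2 : ∀ i, B x i = 0 := fun i => by
      by_contra h0
      exact hx (hB.2 x i h0).1
    have h3 : ∀ i, B i x = 0 := fun i => by rw [hB.1, h2]
    simp only [border, Matrix.of_apply, if_true, Prod.mk.injEq, true_and]
    constructor
    · ext j
      split_ifs with h
      · rw [h, h1]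
      · rfl
    · ext i j
      simp only [Matrix.of_apply]
      by_cases h4 : i = x
      · subst h4; simp [h2]
      · by_cases h5 : j = x
        · subst h5; simp [h3]
        · simp [h4, h5]
  · intro M hM
    rw [mem_supported] at hM
    ext i j
    simp only [border, Matrix.of_apply]
    split_ifs with h1 h2 h3 h3
    · rw [h1, h2]
    · rw [h1]
    · rw [h3, hM.1]
    · simp_all
    · simp_all
  · intros; rfl

lemma add_mem_supported {Γ : SimpleGraph ι} {S : Finset ι} {B C : Matrix ι ι (ZMod 2)}
    (hB : B ∈ supported Γ S) (hC : C ∈ supported Γ S) : B + C ∈ supported Γ S := by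
  rw [mem_supported] at *
  refine ⟨fun i j => by rw [Matrix.add_apply, Matrix.add_apply, hB.1, hC.1], fun i j hij => ?_⟩
  by_cases h : B i j = 0
  · exact hC.2 i j fun h' => hij (by rw [Matrix.add_apply, h, h', add_zero])
  · exact hB.2 i j h

/-- Translation by an allowed matrix is an involution in characteristic 2. This is what lets the
corrections produced by pivoting be ignored. -/
lemma sum_supported_add {Γ : SimpleGraph ι} {S : Finset ι} {C : Matrix ι ι (ZMod 2)}
    (hC : C ∈ supported Γ S) {A : Type*} [AddCommMonoid A] (f : Matrix ι ι (ZMod 2) → A) :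
    ∑ B ∈ supported Γ S, f (B + C) = ∑ B ∈ supported Γ S, f B := by
  have hCC : C + C = 0 := by
    ext i j
    exact CharTwo.add_self_eq_zero _
  refine Finset.sum_bij' (fun B _ => B + C) (fun B _ => B + C) ?_ ?_ ?_ ?_ ?_
  · exact fun B hB => add_mem_supported hB hC
  · exact fun B hB => add_mem_supported hB hC
  · intro B _; simp only [add_assoc, hCC, add_zero]
  · intro B _; simp only [add_assoc, hCC, add_zero]
  · intros; rfl

lemma vanish_of_mem {Γ : SimpleGraph ι} {S : Finset ι} {B : Matrix ι ι (ZMod 2)}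
    (hB : B ∈ supported Γ S) {x : ι} (hx : x ∉ S) (i : ι) : B x i = 0 ∧ B i x = 0 := by
  rw [mem_supported] at hB
  have h2 : ∀ i, B x i = 0 := fun i => by
    by_contra h0
    exact hx (hB.2 x i h0).1
  exact ⟨h2 i, by rw [hB.1, h2]⟩

/-- Schur complement of the pivot at the diagonal entry of `x`. -/
lemma rank_border_one {Γ : SimpleGraph ι} {S : Finset ι} {x : ι} (hx : x ∉ S) {r : ι → ZMod 2}
    (hr : r x = 0) {B : Matrix ι ι (ZMod 2)} (hB : B ∈ supported Γ S) :
    (border x 1 r B).rank = 1 + (B + vecMulVec r r).rank := by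
  rw [rank_eq_succ_of_pivot (border x 1 r B) x x (by simp [border])]
  congr 2
  ext i j
  simp only [border, Matrix.of_apply, Matrix.add_apply, vecMulVec_apply, if_true]
  have h1 := vanish_of_mem hB hx
  split_ifs with h2 h3 h3
  · subst h2 h3; simp [h1, hr]
  · subst h2; simp [h1, hr]
  · subst h3; simp [h1, hr]
  · rw [CharTwo.sub_eq_add]

/-- Schur complement of the 2 × 2 block on `x` and `a`, which is invertible because its off-diagonal
entry is 1 and its entry at `(x, x)` is 0. The two pivots are `(x, a)` and then `(a, x)`. -/
lemma rank_border_border {Γ : SimpleGraph ι} {S : Finset ι} {x a : ι} (hx : x ∉ S) (ha : a ∉ S)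
    (hxa : x ≠ a) {r ρ : ι → ZMod 2} (δ : ZMod 2) (hrx : r x = 0) (hra : r a = 0)
    (hρx : ρ x = 0) (hρa : ρ a = 0) {B : Matrix ι ι (ZMod 2)} (hB : B ∈ supported Γ S) :
    (border x 0 (Function.update r a 1) (border a δ ρ B)).rank = 2 +
      (B + (vecMulVec r ρ + vecMulVec ρ r + δ • vecMulVec r r)).rank := by
  have h1 := vanish_of_mem hB hx
  have h2 := vanish_of_mem hB ha
  have hax := hxa.symm
  rw [rank_eq_succ_of_pivot _ x a (by simp [border, hax]),
    rank_eq_succ_of_pivot _ a x (by simp [border, hax])]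
  rw [← add_assoc]
  congr 2
  ext i j
  simp only [border, Matrix.of_apply, Matrix.add_apply, vecMulVec_apply, if_true, Matrix.smul_apply, smul_eq_mul,
    Function.update_self, hax, hxa, if_false]
  have h4 : (2 : ZMod 2) = 0 := rfl
  by_cases hix : i = x
  · subst hix
    by_cases hja : j = a
    · subst hja; simp [*]
    · by_cases hji : j = i
      · subst hji; simp [*]
      · simp [*]
  · by_cases hia : i = a
    · subst hia
      by_cases hji : j = i
      · subst hji; simp [*]
      · by_cases hjx : j = x
        · subst hjx; simp [*]
        · simp [*]
    · by_cases hja : j = a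
      · subst hja; simp [*]
      · by_cases hjx : j = x
        · subst hjx; simp [*]
        · simp [*]
          linear_combination (-(ρ i * r j) - r i * ρ j) * h4

lemma self_notMem_nbrs {ι : Type*} (Γ : SimpleGraph ι) (S : Finset ι) (x : ι) : x ∉ nbrs Γ S x :=
  fun h => (mem_nbrs.1 h).2.ne rfl

lemma apply_eq_zero_of_mem_vecs {T : Finset ι} {r : ι → ZMod 2} (hr : r ∈ vecs T) {i : ι}
    (hi : i ∉ T) : r i = 0 := by
  by_contra h
  exact hi (mem_vecs.1 hr i h)

/-- Summation over the matrices with a nonzero diagonal entry at a vertex whose relevant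
neighbours form a clique. -/
lemma sum_border_one {Γ : SimpleGraph ι} {S : Finset ι} {x : ι} (hx : x ∉ S) {r : ι → ZMod 2}
    (hr : r ∈ vecs (nbrs Γ S x))
    (hclique : ∀ i ∈ nbrs Γ S x, ∀ j ∈ nbrs Γ S x, i = j ∨ Γ.Adj i j) :
    ∑ B ∈ supported Γ S, (X : ℤ[X]) ^ (border x 1 r B).rank = X * rankSum Γ S := by
  have hrx : r x = 0 := apply_eq_zero_of_mem_vecs hr (self_notMem_nbrs Γ S x)
  rw [Finset.sum_congr rfl fun B hB => by rw [rank_border_one hx hrx hB, pow_add, pow_one],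
    ← Finset.mul_sum, rankSum]
  congr 1
  refine sum_supported_add (C := vecMulVec r r) ?_ (fun M => (X : ℤ[X]) ^ M.rank)
  rw [mem_supported]
  refine ⟨fun i j => by simp only [vecMulVec_apply, mul_comm], fun i j hij => ?_⟩
  rw [vecMulVec_apply] at hij
  have hi := mem_vecs.1 hr i (left_ne_zero_of_mul hij)
  have hj := mem_vecs.1 hr j (right_ne_zero_of_mul hij)
  exact ⟨(mem_nbrs.1 hi).1, (mem_nbrs.1 hj).1, hclique i hi j hj⟩

lemma border_zero {Γ : SimpleGraph ι} {S : Finset ι} {x : ι} (hx : x ∉ S)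
    {B : Matrix ι ι (ZMod 2)} (hB : B ∈ supported Γ S) : border x 0 0 B = B := by
  have h := vanish_of_mem hB hx
  ext i j
  simp only [border, Matrix.of_apply]
  split_ifs with h1 h2 h2
  · subst h1 h2; simp [h]
  · subst h1; simp [h]
  · subst h2; simp [h]
  · rfl

/-- Summation over the matrices with diagonal entry zero at `x` and a nonzero entry at `(x, a)`. -/
lemma sum_border_zero {Γ : SimpleGraph ι} {S : Finset ι} {x a : ι} (hx : x ∉ insert a S)
    (ha : a ∉ S) {r : ι → ZMod 2} (hrx : r x = 0) (hra : r a = 0)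
    (hclosed : ∀ i j, r i ≠ 0 → (r j ≠ 0 ∨ j ∈ nbrs Γ S a) → i ∈ S ∧ j ∈ S ∧ (i = j ∨ Γ.Adj i j)) :
    ∑ B ∈ supported Γ (insert a S), (X : ℤ[X]) ^ (border x 0 (Function.update r a 1) B).rank
      = X ^ 2 * 2 ^ ((nbrs Γ S a).card + 1) * rankSum Γ S := by
  have hxa : x ≠ a := fun h => hx (h ▸ Finset.mem_insert_self _ _)
  have hxS : x ∉ S := fun h => hx (Finset.mem_insert_of_mem h)
  have key : ∀ δ : ZMod 2, ∀ ρ ∈ vecs (nbrs Γ S a), ∑ B ∈ supported Γ S,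
      (X : ℤ[X]) ^ (border x 0 (Function.update r a 1) (border a δ ρ B)).rank
        = X ^ 2 * rankSum Γ S := by
    intro δ ρ hρ
    have hρx : ρ x = 0 := apply_eq_zero_of_mem_vecs hρ fun h => hxS (mem_nbrs.1 h).1
    have hρa : ρ a = 0 := apply_eq_zero_of_mem_vecs hρ (self_notMem_nbrs Γ S a)
    rw [Finset.sum_congr rfl fun B hB => by
        rw [rank_border_border hxS ha hxa δ hrx hra hρx hρa hB, pow_add],
      ← Finset.mul_sum, rankSum]
    congr 1
    -- The correction is rρᵀ + ρrᵀ + δrrᵀ; `hclosed` says precisely that all its possible nonzero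
    -- positions are allowed on `S`.
    refine sum_supported_add (C := _) ?_ (fun M => (X : ℤ[X]) ^ M.rank)
    rw [mem_supported]
    constructor
    · intro i j
      simp only [Matrix.add_apply, Matrix.smul_apply, vecMulVec_apply, smul_eq_mul]
      ring
    · intro i j hij
      by_cases hi : r i = 0
      · by_cases hj : r j = 0
        · simp [vecMulVec_apply, hi, hj] at hij
        · have hρi : ρ i ≠ 0 := fun h => by simp [vecMulVec_apply, hi, h] at hij
          obtain ⟨h1, h2, h3⟩ := hclosed j i hj (Or.inr (mem_vecs.1 hρ i hρi))
          exact ⟨h2, h1, h3.imp Eq.symm fun h => h.symm⟩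
      · by_cases hj : r j = 0
        · have hρj : ρ j ≠ 0 := fun h => by simp [vecMulVec_apply, hj, h] at hij
          exact hclosed i j hi (Or.inr (mem_vecs.1 hρ j hρj))
        · exact hclosed i j hi (Or.inl hj)
  -- The diagonal bit δ of `a` and its row ρ are free and all contribute equally: this is the factor
  -- 2 · 2^(degree of a).
  rw [sum_supported_insert Γ ha, Finset.sum_congr rfl fun δ _ => Finset.sum_congr rfl (key δ)]
  simp only [Finset.sum_const, card_vecs, Finset.card_univ, ZMod.card]
  simp only [nsmul_eq_mul]
  push_cast
  ring

/-- Elimination of a pendant vertex. -/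
theorem rankSum_pendant {Γ : SimpleGraph ι} {S : Finset ι} {x a : ι} (hx : x ∉ insert a S)
    (ha : a ∉ S) (hxa : nbrs Γ (insert a S) x = {a}) :
    rankSum Γ (insert x (insert a S)) = (1 + 2 * X) * rankSum Γ (insert a S)
      + X ^ 2 * 2 ^ ((nbrs Γ S a).card + 1) * rankSum Γ S := by
  have hu : (Finset.univ : Finset (ZMod 2)) = {0, 1} := rfl
  have hne : x ≠ a := fun h => hx (h ▸ Finset.mem_insert_self _ _)
  -- Four cases for the data at `x`. Diagonal bit 1 with either row gives 2X, the zero data give 1,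
  -- and diagonal bit 0 with entry 1 at `a` uses up `a` as well and gives the X² term.
  rw [rankSum, sum_supported_insert Γ hx, hu, Finset.sum_pair zero_ne_one,
    Finset.sum_congr rfl fun r hr => sum_border_one hx hr (by simp [hxa]), Finset.sum_const,
    card_vecs, hxa, ← Finset.insert_empty, sum_vecs_insert (by simp), vecs_empty,
    Finset.sum_singleton, sum_border_zero hx ha (by simp) (by simp) (by simp)]
  rw [Finset.sum_congr rfl fun B hB => by rw [border_zero hx hB], ← rankSum]
  simp
  ring

/-- Elimination of a vertex with two adjacent neighbours `a` and `b`, where the other neighbours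
of `a` are neighbours of `b`. -/
theorem rankSum_simplicial {Γ : SimpleGraph ι} {S : Finset ι} {x a b : ι}
    (hx : x ∉ insert a (insert b S)) (ha : a ∉ insert b S) (hb : b ∉ S)
    (hxab : nbrs Γ (insert a (insert b S)) x = {a, b}) (hab : Γ.Adj a b)
    (hsub : ∀ i ∈ nbrs Γ S a, Γ.Adj b i) :
    rankSum Γ (insert x (insert a (insert b S))) =
      (1 + 4 * X) * rankSum Γ (insert a (insert b S))
      + X ^ 2 * 2 ^ ((nbrs Γ (insert b S) a).card + 2) * rankSum Γ (insert b S)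
      + X ^ 2 * 2 ^ ((nbrs Γ (insert a S) b).card + 1) * rankSum Γ (insert a S) := by
  have hu : (Finset.univ : Finset (ZMod 2)) = {0, 1} := rfl
  have hne : x ≠ a := fun h => hx (h ▸ Finset.mem_insert_self _ _)
  have hxb : x ≠ b := fun h => hx (by simp [h])
  have hne' : a ≠ b := hab.ne
  have haS : a ∉ S := fun h => ha (Finset.mem_insert_of_mem h)
  have hbaS : b ∉ insert a S := by simp [hb, hne'.symm]
  have hx' : x ∉ insert b (insert a S) := by rwa [Finset.insert_comm]
  -- Diagonal bit 1 gives 4X, since there are four rows on {a, b}, and the zero data give 1. With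
  -- diagonal bit 0, the two rows that are nonzero at `a` pivot on `a`, whence the exponent degree +
  -- 2, and the remaining row pivots on `b`. `hsub` enters only for the row nonzero at both, whose
  -- correction joins `b` to the neighbours of `a`.
  rw [rankSum, sum_supported_insert Γ hx, hu, Finset.sum_pair zero_ne_one,
    Finset.sum_congr rfl fun r hr => sum_border_one hx hr (by
      rw [hxab]; simp [hab, hab.symm]), Finset.sum_const,
    card_vecs, hxab, sum_vecs_insert (by simp [hne']), ← Finset.insert_empty,
    sum_vecs_insert (by simp), vecs_empty,
    Finset.sum_singleton, sum_border_zero hx ha (by simp) (by simp) (by simp),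
    sum_border_zero hx ha (by simp [hxb]) (by simp [hne'])]
  · rw [Finset.sum_congr rfl fun B hB => by rw [border_zero hx hB], ← rankSum,
      Finset.insert_comm a b S, sum_border_zero hx' hbaS (by simp) (by simp) (by simp),
      Finset.card_insert_of_notMem (by simp [hne'])]
    simp
    ring
  · intro i j hi hj
    have hib : i = b := by
      by_contra h
      simp [h] at hi
    subst hib
    refine ⟨Finset.mem_insert_self _ _, ?_⟩
    rcases hj with hj | hj
    · have hjb : j = i := by
        by_contra h
        simp [h] at hj
      simp [hjb]
    · obtain ⟨h1, h2⟩ := mem_nbrs.1 hj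
      refine ⟨h1, ?_⟩
      rcases Finset.mem_insert.1 h1 with h | h
      · exact Or.inl h.symm
      · exact Or.inr (hsub j (mem_nbrs.2 ⟨h, h2⟩))

lemma rankSum_empty (Γ : SimpleGraph ι) : rankSum Γ ∅ = 1 := by
  have : supported Γ (∅ : Finset ι) = {0} := by
    ext M
    rw [mem_supported, Finset.mem_singleton]
    constructor
    · rintro ⟨-, h⟩
      ext i j
      by_contra h0
      exact absurd (h i j h0).1 (Finset.notMem_empty _)
    · rintro rfl
      simp
  rw [rankSum, this]
  simp

/-- Elimination of an isolated vertex. -/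
theorem rankSum_isolated {Γ : SimpleGraph ι} {S : Finset ι} {x : ι} (hx : x ∉ S)
    (h : nbrs Γ S x = ∅) : rankSum Γ (insert x S) = (1 + X) * rankSum Γ S := by
  have hu : (Finset.univ : Finset (ZMod 2)) = {0, 1} := rfl
  rw [rankSum, sum_supported_insert Γ hx, hu, Finset.sum_pair zero_ne_one,
    Finset.sum_congr rfl fun r hr => sum_border_one hx hr (by simp [h]), h, vecs_empty,
    Finset.sum_singleton, Finset.sum_singleton,
    Finset.sum_congr rfl fun B hB => by rw [border_zero hx hB], ← rankSum]
  ring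

end Elimination

/-! ### Graphs on the natural numbers -/

/-- The rank polynomial of the symmetric matrices supported on a finite set `S` of natural numbers,
whose off-diagonal support is in `Γ`. -/
def rankSumNat (Γ : SimpleGraph ℕ) (S : Finset ℕ) : ℤ[X] :=
  rankSum (Γ.comap ((↑) : S → ℕ)) Finset.univ

/-- Brings all index types to ℕ, so that fans, ladders and overlap matrices become supports in one
graph. -/
lemma rankSum_comap_nat {ι : Type*} [Fintype ι] [DecidableEq ι] (e : ι ↪ ℕ) (Γ : SimpleGraph ℕ)
    (S : Finset ι) : rankSum (Γ.comap e) S = rankSumNat Γ (S.map e) := by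
  have h1 : (Finset.univ : Finset S).map (Function.Embedding.subtype _) = S := by
    ext; simp
  let g : S ↪ S.map e := ⟨fun s => ⟨e s, Finset.mem_map_of_mem e s.2⟩, fun s t h =>
    Subtype.ext (e.injective (congrArg Subtype.val h))⟩
  have h2 : (Finset.univ : Finset S).map g = Finset.univ := by
    ext ⟨y, hy⟩
    obtain ⟨i, hi, rfl⟩ := Finset.mem_map.1 hy
    simp only [Finset.mem_map, Finset.mem_univ, true_and, iff_true]
    exact ⟨⟨i, hi⟩, rfl⟩
  rw [rankSumNat, ← h2, ← rankSum_comap]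
  conv_lhs => rw [← h1]
  rw [← rankSum_comap]
  rfl

lemma supported_congr {ι : Type*} [Fintype ι] [DecidableEq ι] {Γ Γ' : SimpleGraph ι} {S : Finset ι}
    (h : ∀ i ∈ S, ∀ j ∈ S, (Γ.Adj i j ↔ Γ'.Adj i j)) : supported Γ S = supported Γ' S := by
  ext M
  simp only [mem_supported]
  refine and_congr_right fun _ => forall_congr' fun i => forall_congr' fun j => ?_
  refine imp_congr_right fun _ => and_congr_right fun hi => and_congr_right fun hj => ?_
  rw [h i hi j hj]

lemma rankSumNat_congr {Γ Γ' : SimpleGraph ℕ} {S : Finset ℕ}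
    (h : ∀ i ∈ S, ∀ j ∈ S, (Γ.Adj i j ↔ Γ'.Adj i j)) : rankSumNat Γ S = rankSumNat Γ' S := by
  rw [rankSumNat, rankSumNat, rankSum, rankSum, supported_congr]
  intro i _ j _
  exact h i i.2 j j.2

/-- Restriction of a finite set of natural numbers to an initial segment. -/
def toFin (N : ℕ) (S : Finset ℕ) : Finset (Fin N) := Finset.univ.filter fun i => (i : ℕ) ∈ S

lemma mem_toFin {N : ℕ} {S : Finset ℕ} {i : Fin N} : i ∈ toFin N S ↔ (i : ℕ) ∈ S := by
  simp [toFin]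

lemma toFin_insert {N : ℕ} {S : Finset ℕ} {x : ℕ} (hx : x < N) :
    toFin N (insert x S) = insert ⟨x, hx⟩ (toFin N S) := by
  ext i
  simp [mem_toFin, Fin.ext_iff]

lemma map_toFin {N : ℕ} {S : Finset ℕ} (h : ∀ i ∈ S, i < N) :
    (toFin N S).map Fin.valEmbedding = S := by
  ext i
  simp only [Finset.mem_map, mem_toFin, Fin.valEmbedding_apply]
  exact ⟨fun ⟨j, hj, hji⟩ => hji ▸ hj, fun hi => ⟨⟨i, h i hi⟩, hi, rfl⟩⟩

lemma rankSum_toFin {N : ℕ} (Γ : SimpleGraph ℕ) {S : Finset ℕ} (h : ∀ i ∈ S, i < N) :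
    rankSum (Γ.comap (Fin.valEmbedding : Fin N ↪ ℕ)) (toFin N S) = rankSumNat Γ S := by
  rw [rankSum_comap_nat, map_toFin h]

lemma nbrs_toFin {N : ℕ} (Γ : SimpleGraph ℕ) (S : Finset ℕ) (x : Fin N) :
    nbrs (Γ.comap (Fin.valEmbedding : Fin N ↪ ℕ)) (toFin N S) x = toFin N (nbrs Γ S x) := by
  ext i
  simp [mem_nbrs, mem_toFin]

lemma card_toFin {N : ℕ} {S : Finset ℕ} (h : ∀ i ∈ S, i < N) : (toFin N S).card = S.card := by
  rw [← Finset.card_map Fin.valEmbedding, map_toFin h]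

lemma toFin_empty (N : ℕ) : toFin N ∅ = ∅ := by simp [toFin]

lemma exists_bound (S : Finset ℕ) : ∃ N, ∀ i ∈ S, i < N :=
  ⟨S.sup id + 1, fun _ hi => Nat.lt_succ_of_le (Finset.le_sup (f := id) hi)⟩

/-- The elimination theorem needs a finite index type; all positions lie below some N, and `Fin N`
serves. -/
theorem rankSumNat_pendant {Γ : SimpleGraph ℕ} {S : Finset ℕ} {x a : ℕ} (hx : x ∉ insert a S)
    (ha : a ∉ S) (hxa : nbrs Γ (insert a S) x = {a}) {d : ℕ} (hd : (nbrs Γ S a).card = d) :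
    rankSumNat Γ (insert x (insert a S)) = (1 + 2 * X) * rankSumNat Γ (insert a S)
      + X ^ 2 * 2 ^ (d + 1) * rankSumNat Γ S := by
  subst hd
  obtain ⟨N, hN⟩ := exists_bound (insert x (insert a S))
  have h1 : ∀ i ∈ insert a S, i < N := fun i hi => hN i (Finset.mem_insert_of_mem hi)
  have h2 : ∀ i ∈ S, i < N := fun i hi => h1 i (Finset.mem_insert_of_mem hi)
  have hxN : x < N := hN x (by simp)
  have haN : a < N := hN a (by simp)
  have hc : (nbrs Γ S a).card = (toFin N (nbrs Γ S a)).card :=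
    (card_toFin fun i hi => h2 i (mem_nbrs.1 hi).1).symm
  rw [← rankSum_toFin Γ hN, ← rankSum_toFin Γ h1, ← rankSum_toFin Γ h2, hc,
    ← nbrs_toFin Γ S ⟨a, haN⟩, toFin_insert hxN, toFin_insert haN]
  apply rankSum_pendant
  · rwa [← toFin_insert haN, mem_toFin]
  · rwa [mem_toFin]
  · rw [← toFin_insert haN, nbrs_toFin, hxa, ← Finset.insert_empty, toFin_insert haN, toFin_empty,
      Finset.insert_empty]

theorem rankSumNat_simplicial {Γ : SimpleGraph ℕ} {S : Finset ℕ} {x a b : ℕ}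
    (hx : x ∉ insert a (insert b S)) (ha : a ∉ insert b S) (hb : b ∉ S)
    (hxab : nbrs Γ (insert a (insert b S)) x = {a, b}) (hab : Γ.Adj a b)
    (hsub : ∀ i ∈ nbrs Γ S a, Γ.Adj b i) {d e : ℕ} (hd : (nbrs Γ (insert b S) a).card = d)
    (he : (nbrs Γ (insert a S) b).card = e) :
    rankSumNat Γ (insert x (insert a (insert b S))) =
      (1 + 4 * X) * rankSumNat Γ (insert a (insert b S))
      + X ^ 2 * 2 ^ (d + 2) * rankSumNat Γ (insert b S)
      + X ^ 2 * 2 ^ (e + 1) * rankSumNat Γ (insert a S) := by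
  subst hd he
  obtain ⟨N, hN⟩ := exists_bound (insert x (insert a (insert b S)))
  have h1 : ∀ i ∈ insert a (insert b S), i < N := fun i hi => hN i (Finset.mem_insert_of_mem hi)
  have h2 : ∀ i ∈ insert b S, i < N := fun i hi => h1 i (Finset.mem_insert_of_mem hi)
  have h3 : ∀ i ∈ insert a S, i < N := fun i hi => by
    rcases Finset.mem_insert.1 hi with rfl | hi
    · exact h1 _ (by simp)
    · exact h1 _ (by simp [hi])
  have hxN : x < N := hN x (by simp)
  have haN : a < N := hN a (by simp)
  have hbN : b < N := hN b (by simp)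
  have hc : (nbrs Γ (insert b S) a).card = (toFin N (nbrs Γ (insert b S) a)).card :=
    (card_toFin fun i hi => h2 i (mem_nbrs.1 hi).1).symm
  have hc' : (nbrs Γ (insert a S) b).card = (toFin N (nbrs Γ (insert a S) b)).card :=
    (card_toFin fun i hi => h3 i (mem_nbrs.1 hi).1).symm
  rw [← rankSum_toFin Γ hN, ← rankSum_toFin Γ h1, ← rankSum_toFin Γ h2, ← rankSum_toFin Γ h3,
    hc, hc', ← nbrs_toFin Γ _ ⟨a, haN⟩, ← nbrs_toFin Γ _ ⟨b, hbN⟩, toFin_insert hxN,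
    toFin_insert haN, toFin_insert haN, toFin_insert hbN]
  apply rankSum_simplicial
  · rwa [← toFin_insert hbN, ← toFin_insert haN, mem_toFin]
  · rwa [← toFin_insert hbN, mem_toFin]
  · rwa [mem_toFin]
  · rw [← toFin_insert hbN, ← toFin_insert haN, nbrs_toFin, hxab, toFin_insert haN,
      ← Finset.insert_empty, toFin_insert hbN, toFin_empty, Finset.insert_empty]
  · exact hab
  · intro i hi
    rw [nbrs_toFin, mem_toFin] at hi
    exact hsub i hi

lemma rankSumNat_empty (Γ : SimpleGraph ℕ) : rankSumNat Γ ∅ = 1 := by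
  rw [← rankSum_toFin (N := 0) Γ (by simp), toFin_empty, rankSum_empty]

lemma rankSumNat_singleton (Γ : SimpleGraph ℕ) (x : ℕ) : rankSumNat Γ {x} = 1 + X := by
  have h : x < x + 1 := Nat.lt_succ_self x
  rw [← rankSum_toFin (N := x + 1) Γ (S := {x}) (by simp), ← Finset.insert_empty, toFin_insert h,
    toFin_empty, rankSum_isolated (by simp) (by simp [nbrs]), rankSum_empty, mul_one]

/-! ### Strips of fans -/

/-- The position of `e_{i+1}` in the lexicographic list `e_1, e_{1,1}, …, e_{1,m_1}, e_2, …`. -/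
def start (m : ℕ → ℕ) (i : ℕ) : ℕ := ∑ j ∈ Finset.Icc 1 i, (m j + 1)

lemma start_zero (m : ℕ → ℕ) : start m 0 = 0 := by simp [start]

lemma start_succ (m : ℕ → ℕ) (i : ℕ) : start m (i + 1) = start m i + m (i + 1) + 1 := by
  rw [start, Finset.sum_Icc_succ_top (by omega), start, add_assoc]

lemma start_congr {m m' : ℕ → ℕ} {i : ℕ} (h : ∀ j, 1 ≤ j → j ≤ i → m j = m' j) :
    start m i = start m' i :=
  Finset.sum_congr rfl fun j hj => by
    rw [h j (Finset.mem_Icc.1 hj).1 (Finset.mem_Icc.1 hj).2]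

lemma start_mono (m : ℕ → ℕ) : StrictMono (start m) :=
  strictMono_nat_of_lt_succ fun i => by rw [start_succ]; omega

lemma start_add_two_le {m : ℕ → ℕ} {i j K : ℕ} (hm : ∀ j, 1 ≤ j → j ≤ K → 1 ≤ m j) (hij : i < j)
    (hj : j ≤ K) : start m i + 2 ≤ start m j := by
  have h1 := start_succ m i
  have h2 := hm (i + 1) (by omega) (by omega)
  have h3 := (start_mono m).monotone (show i + 1 ≤ j from hij)
  omega

/-- The overlap graph with `K + 1` fans, on lexicographic positions: the centre `start m i` of a
fan is joined to the later positions up to `start m (i + 1) + 1`, and consecutive positions are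
adjacent. -/
def strip (K : ℕ) (m : ℕ → ℕ) : SimpleGraph ℕ :=
  SimpleGraph.fromRel fun a b =>
    -- The rim is bounded only for i < K. The last fan is unbounded in the graph, and the finite
    -- support set decides how long it is.
    b = a + 1 ∨ ∃ i ≤ K, a = start m i ∧ a + 2 ≤ b ∧ (i < K → b ≤ start m (i + 1) + 1)

lemma strip_adj_of_lt {K : ℕ} {m : ℕ → ℕ} {a b : ℕ} (h : a < b) : (strip K m).Adj a b ↔
    b = a + 1 ∨ ∃ i ≤ K, a = start m i ∧ a + 2 ≤ b ∧ (i < K → b ≤ start m (i + 1) + 1) := by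
  rw [strip, SimpleGraph.fromRel_adj]
  constructor
  · rintro ⟨-, h1 | h1 | ⟨i, -, h1, h2, -⟩⟩
    · exact h1
    · omega
    · omega
  · exact fun h1 => ⟨h.ne, Or.inl h1⟩

lemma strip_adj_succ (K : ℕ) (m : ℕ → ℕ) (a : ℕ) : (strip K m).Adj a (a + 1) :=
  (strip_adj_of_lt (Nat.lt_succ_self a)).2 (Or.inl rfl)

/-- The next fan only adds edges from its centre `start m (K + 1)` to positions at distance at least
2. Up to its first rim vertex it is therefore invisible, and that vertex is still on the rim of fan
K. -/
lemma strip_succ_adj (K : ℕ) (m : ℕ → ℕ) {a b : ℕ} (ha : a < start m (K + 1) + 2)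
    (hb : b < start m (K + 1) + 2) : (strip (K + 1) m).Adj a b ↔ (strip K m).Adj a b := by
  wlog hab : a < b generalizing a b
  · rcases (not_lt.1 hab).eq_or_lt with rfl | h
    · simp
    · rw [(strip (K + 1) m).adj_comm, (strip K m).adj_comm, this hb ha h]
  rw [strip_adj_of_lt hab, strip_adj_of_lt hab]
  refine or_congr_right ⟨?_, ?_⟩
  · rintro ⟨i, hi, rfl, h2, h3⟩
    have : i ≠ K + 1 := by rintro rfl; omega
    exact ⟨i, by omega, rfl, h2, fun _ => h3 (by omega)⟩
  · rintro ⟨i, hi, rfl, h2, h3⟩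
    refine ⟨i, by omega, rfl, h2, fun _ => ?_⟩
    rcases hi.eq_or_lt with rfl | hi
    · omega
    · exact h3 hi

lemma strip_congr {K : ℕ} {m m' : ℕ → ℕ} (h : ∀ j, 1 ≤ j → j ≤ K → m j = m' j) :
    strip K m = strip K m' := by
  rw [strip, strip]
  congr 1
  ext a b
  refine or_congr_right (exists_congr fun i => and_congr_right fun hi => ?_)
  rw [start_congr fun j h1 h2 => h j h1 (h2.trans hi)]
  refine and_congr_right fun _ => and_congr_right fun _ => imp_congr_right fun hi => ?_
  rw [start_congr fun j h1 h2 => h j h1 (h2.trans hi)]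

/-- The rank polynomial of the overlap matrices with `r` edges in the last fan `K + 1`. -/
def fanSum (K : ℕ) (m : ℕ → ℕ) (r : ℕ) : ℤ[X] :=
  rankSumNat (strip K m) (Finset.range (start m K + 1 + r))

/-- The rank polynomial of the overlap matrices with `r` edges in the last fan `K + 1`, whose centre
is deleted. -/
def cutSum (K : ℕ) (m : ℕ → ℕ) (r : ℕ) : ℤ[X] :=
  rankSumNat (strip K m) ((Finset.range (start m K + 1 + r)).erase (start m K))

lemma fanSum_congr {K : ℕ} {m m' : ℕ → ℕ} (h : ∀ j, 1 ≤ j → j ≤ K → m j = m' j) (r : ℕ) :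
    fanSum K m r = fanSum K m' r := by
  rw [fanSum, fanSum, strip_congr h, start_congr h]

lemma cutSum_congr {K : ℕ} {m m' : ℕ → ℕ} (h : ∀ j, 1 ≤ j → j ≤ K → m j = m' j) (r : ℕ) :
    cutSum K m r = cutSum K m' r := by
  rw [cutSum, cutSum, strip_congr h, start_congr h]

/-- A fan reduced to its centre only lengthens the previous rim by one. Likewise a fan with one rim
vertex lengthens it by two, and an empty fan without centre not at all; this is the content of the
two lemmas that follow. -/
lemma fanSum_succ_zero (K : ℕ) (m : ℕ → ℕ) : fanSum (K + 1) m 0 = fanSum K m (m (K + 1) + 1) := by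
  rw [fanSum, fanSum, start_succ, show start m K + m (K + 1) + 1 + 1 + 0
    = start m K + 1 + (m (K + 1) + 1) by ring]
  refine rankSumNat_congr fun i hi j hj => strip_succ_adj K m ?_ ?_ <;>
  · rw [Finset.mem_range] at hi hj
    rw [start_succ]
    omega

lemma fanSum_succ_one (K : ℕ) (m : ℕ → ℕ) : fanSum (K + 1) m 1 = fanSum K m (m (K + 1) + 2) := by
  rw [fanSum, fanSum, start_succ, show start m K + m (K + 1) + 1 + 1 + 1
    = start m K + 1 + (m (K + 1) + 2) by ring]
  refine rankSumNat_congr fun i hi j hj => strip_succ_adj K m ?_ ?_ <;>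
  · rw [Finset.mem_range] at hi hj
    rw [start_succ]
    omega

lemma cutSum_succ_zero (K : ℕ) (m : ℕ → ℕ) : cutSum (K + 1) m 0 = fanSum K m (m (K + 1)) := by
  have : (Finset.range (start m (K + 1) + 1 + 0)).erase (start m (K + 1))
      = Finset.range (start m K + 1 + m (K + 1)) := by
    rw [start_succ]
    ext i
    simp only [Finset.mem_erase, Finset.mem_range]
    omega
  rw [cutSum, fanSum, this]
  refine rankSumNat_congr fun i hi j hj => strip_succ_adj K m ?_ ?_ <;>
  · rw [Finset.mem_range] at hi hj
    rw [start_succ]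
    omega

/-- Bounded fans stop at or before `start m K + 1`, so beyond it only the path edge and the last
centre reach back. -/
lemma nbrs_last {K : ℕ} {m : ℕ → ℕ} (hm : ∀ j, 1 ≤ j → j ≤ K → 1 ≤ m j) {y z : ℕ}
    (hy : start m K + 2 ≤ y) (hz : z < y) :
    (strip K m).Adj z y ↔ z + 1 = y ∨ z = start m K := by
  rw [strip_adj_of_lt hz]
  refine or_congr eq_comm ⟨?_, ?_⟩
  · rintro ⟨i, hi, rfl, h2, h3⟩
    rcases hi.eq_or_lt with rfl | hi
    · rfl
    · have := h3 hi
      have := (start_mono m).monotone (show i + 1 ≤ K from hi)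
      omega
  · rintro rfl
    exact ⟨K, le_rfl, rfl, hy, fun h => absurd h (lt_irrefl K)⟩

/-- The new centre and its first rim vertex are the positions where two consecutive fans overlap:
both are still on the rim around `start m K`. -/
lemma nbrs_centre {K : ℕ} {m : ℕ → ℕ} (hm : ∀ j, 1 ≤ j → j ≤ K + 1 → 1 ≤ m j) {y z : ℕ}
    (hy : y = start m (K + 1) ∨ y = start m (K + 1) + 1) (hz : z < y) :
    (strip (K + 1) m).Adj z y ↔ z + 1 = y ∨ z = start m K := by
  rw [strip_adj_of_lt hz]
  have h0 := start_add_two_le hm (show K < K + 1 by omega) le_rfl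
  refine or_congr eq_comm ⟨?_, ?_⟩
  · rintro ⟨i, hi, rfl, h2, h3⟩
    rcases hi.eq_or_lt with rfl | hi
    · omega
    · rcases (Nat.lt_succ_iff.1 hi).eq_or_lt with rfl | hi'
      · rfl
      · have := h3 hi
        have := start_add_two_le hm (show i + 1 < K + 1 by omega) le_rfl
        omega
  · rintro rfl
    exact ⟨K, by omega, rfl, by omega, fun _ => by omega⟩

/-- Its own r rim vertices, its predecessor on the path, and the previous centre. The last two are
distinct because the previous fan is nonempty; for the first fan both are missing. -/
lemma card_nbrs_centre {K : ℕ} {m : ℕ → ℕ} (hm : ∀ j, 1 ≤ j → j ≤ K + 1 → 1 ≤ m j) (r : ℕ) :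
    (nbrs (strip (K + 1) m) ((Finset.range (start m (K + 1) + 1 + r)).erase (start m (K + 1)))
      (start m (K + 1))).card = r + 2 := by
  have h0 := start_add_two_le hm (show K < K + 1 by omega) le_rfl
  set b := start m (K + 1) with hb
  have : nbrs (strip (K + 1) m) ((Finset.range (b + 1 + r)).erase b) b
      = insert (b - 1) (insert (start m K) (Finset.Ioc b (b + r))) := by
    ext i
    simp only [mem_nbrs, Finset.mem_erase, Finset.mem_range, Finset.mem_insert, Finset.mem_Ioc]
    rcases lt_trichotomy i b with h | h | h
    · rw [(strip (K + 1) m).adj_comm, nbrs_centre hm (Or.inl hb) h]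
      omega
    · omega
    · have : (strip (K + 1) m).Adj b i := by
        by_cases h2 : i = b + 1
        · rw [h2]; exact strip_adj_succ _ _ _
        · rw [nbrs_last hm (by omega) h]
          exact Or.inr hb
      simp only [this, and_true]
      omega
  rw [this, Finset.card_insert_of_notMem, Finset.card_insert_of_notMem, Nat.card_Ioc]
  · omega
  · simp only [Finset.mem_Ioc]
    omega
  · simp only [Finset.mem_insert, Finset.mem_Ioc]
    omega

lemma card_nbrs_centre_zero (m : ℕ → ℕ) (r : ℕ) :
    (nbrs (strip 0 m) ((Finset.range (start m 0 + 1 + r)).erase (start m 0)) (start m 0)).card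
      = r := by
  have : nbrs (strip 0 m) ((Finset.range (0 + 1 + r)).erase 0) 0 = Finset.Ioc 0 r := by
    ext i
    simp only [mem_nbrs, Finset.mem_erase, Finset.mem_range, Finset.mem_Ioc]
    refine ⟨fun h => by omega, fun h => ⟨by omega, ?_⟩⟩
    by_cases h2 : i = 1
    · rw [h2]; exact strip_adj_succ _ _ _
    · rw [nbrs_last (by intros; omega) (by rw [start_zero]; omega) (by omega)]
      exact Or.inr (start_zero m).symm
  rw [start_zero, this, Nat.card_Ioc]
  omega

/-- Elimination of the last vertex of the last fan. -/
lemma fanSum_add_two_aux {K : ℕ} {m : ℕ → ℕ} (hm : ∀ j, 1 ≤ j → j ≤ K → 1 ≤ m j) (r : ℕ)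
    {d e : ℕ}
    (hd : (nbrs (strip K m) (Finset.range (start m K + 1 + r)) (start m K + 1 + r)).card = d)
    (hsub : ∀ i ∈ nbrs (strip K m) ((Finset.range (start m K + 1 + r)).erase (start m K))
      (start m K + 1 + r), (strip K m).Adj (start m K) i)
    (he : (nbrs (strip K m) ((Finset.range (start m K + 1 + (r + 1))).erase (start m K))
      (start m K)).card = e) :
    fanSum K m (r + 2) = (1 + 4 * X) * fanSum K m (r + 1) + X ^ 2 * 2 ^ (d + 2) * fanSum K m r
      + X ^ 2 * 2 ^ (e + 1) * cutSum K m (r + 1) := by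
  set b := start m K with hb
  have h1 : insert b ((Finset.range (b + 1 + r)).erase b) = Finset.range (b + 1 + r) :=
    Finset.insert_erase (by rw [Finset.mem_range]; omega)
  have h2 : insert (b + 1 + r) (Finset.range (b + 1 + r)) = Finset.range (b + 1 + (r + 1)) := by
    rw [← add_assoc, Finset.range_add_one]
  have h3 : insert (b + 1 + (r + 1)) (Finset.range (b + 1 + (r + 1)))
      = Finset.range (b + 1 + (r + 2)) := by
    rw [show b + 1 + (r + 2) = b + 1 + (r + 1) + 1 by ring, Finset.range_add_one]
  have h4 : insert (b + 1 + r) ((Finset.range (b + 1 + r)).erase b)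
      = (Finset.range (b + 1 + (r + 1))).erase b := by
    rw [← h2, Finset.erase_insert_of_ne (by omega)]
  -- The last rim vertex is eliminated; its two neighbours are its predecessor on the rim, in the
  -- role of `a`, and the centre, in the role of `b`.
  have key := rankSumNat_simplicial (Γ := strip K m) (S := (Finset.range (b + 1 + r)).erase b)
    (x := b + 1 + (r + 1)) (a := b + 1 + r) (b := b) (d := d) (e := e)
    (by rw [h1, h2, Finset.mem_range]; omega) (by rw [h1, Finset.mem_range]; omega)
    (Finset.notMem_erase _ _)
    (by
      rw [h1, h2]
      ext i
      simp only [mem_nbrs, Finset.mem_range, Finset.mem_insert, Finset.mem_singleton]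
      constructor
      · rintro ⟨h5, h6⟩
        rw [(strip K m).adj_comm, nbrs_last hm (by omega) h5] at h6
        omega
      · rintro h5
        refine ⟨by omega, ?_⟩
        rw [(strip K m).adj_comm, nbrs_last hm (by omega) (by omega)]
        omega)
    (by
      rw [(strip K m).adj_comm]
      by_cases h5 : r = 0
      · rw [h5]; exact strip_adj_succ _ _ _
      · rw [nbrs_last hm (by omega) (by omega)]
        exact Or.inr hb)
    hsub (by rw [h1, hd]) (by rw [h4, he])
  rw [h4, h1, h2, h3] at key
  exact key

/-- The predecessor has two earlier neighbours, whence 2^4 = 16, and the centre has degree r + 3,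
whence 2^(r + 4). This already holds for r = 0, because the previous centre then replaces the
missing rim neighbour. -/
theorem fanSum_add_two {K : ℕ} {m : ℕ → ℕ} (hm : ∀ j, 1 ≤ j → j ≤ K + 1 → 1 ≤ m j) (r : ℕ) :
    fanSum (K + 1) m (r + 2) = (1 + 4 * X) * fanSum (K + 1) m (r + 1)
      + 16 * X ^ 2 * fanSum (K + 1) m r + X ^ 2 * 2 ^ (r + 4) * cutSum (K + 1) m (r + 1) := by
  have h0 := start_add_two_le hm (show K < K + 1 by omega) le_rfl
  set b := start m (K + 1) with hb
  have hn : nbrs (strip (K + 1) m) (Finset.range (b + 1 + r)) (b + 1 + r)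
      = {b + r, if r = 0 then start m K else b} := by
    ext i
    simp only [mem_nbrs, Finset.mem_range, Finset.mem_insert, Finset.mem_singleton]
    rw [(strip (K + 1) m).adj_comm]
    split_ifs with hr
    · subst hr
      constructor
      · rintro ⟨h1, h2⟩
        rw [nbrs_centre hm (Or.inr (by omega)) h1] at h2
        omega
      · intro h1
        refine ⟨by omega, ?_⟩
        rw [nbrs_centre hm (Or.inr (by omega)) (by omega)]
        omega
    · constructor
      · rintro ⟨h1, h2⟩
        rw [nbrs_last hm (by omega) h1] at h2
        omega
      · intro h1
        refine ⟨by omega, ?_⟩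
        rw [nbrs_last hm (by omega) (by omega)]
        omega
  rw [fanSum_add_two_aux hm r (d := 2) (e := r + 1 + 2) ?_ ?_ (card_nbrs_centre hm (r + 1))]
  · ring
  · rw [← hb, hn, Finset.card_pair]
    split_ifs <;> omega
  · intro i hi
    have h1 : i ∈ nbrs (strip (K + 1) m) (Finset.range (b + 1 + r)) (b + 1 + r) :=
      mem_nbrs.2 ⟨Finset.mem_of_mem_erase (mem_nbrs.1 hi).1, (mem_nbrs.1 hi).2⟩
    have h2 : i ≠ b := Finset.ne_of_mem_erase (mem_nbrs.1 hi).1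
    rw [hn] at h1
    simp only [Finset.mem_insert, Finset.mem_singleton] at h1
    split_ifs at h1 with hr
    · have h3 : i = start m K := by omega
      rw [(strip (K + 1) m).adj_comm, nbrs_centre hm (Or.inl hb.symm) (by omega)]
      exact Or.inr h3
    · have h3 : i = b + r := by omega
      by_cases h4 : r = 1
      · rw [h3, h4]; exact strip_adj_succ _ _ _
      · rw [nbrs_last hm (by omega) (by omega)]
        exact Or.inr hb

/-- In the first fan there is no previous centre, so the centre has two neighbours fewer and the
uniform recurrence starts one step later. -/
theorem fanSum_zero_add_three (m : ℕ → ℕ) (r : ℕ) :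
    fanSum 0 m (r + 3) = (1 + 4 * X) * fanSum 0 m (r + 2)
      + 16 * X ^ 2 * fanSum 0 m (r + 1) + X ^ 2 * 2 ^ (r + 3) * cutSum 0 m (r + 2) := by
  have hm : ∀ j, 1 ≤ j → j ≤ 0 → 1 ≤ m j := by intros; omega
  have hn : nbrs (strip 0 m) (Finset.range (0 + 1 + (r + 1))) (0 + 1 + (r + 1)) = {r + 1, 0} := by
    ext i
    simp only [mem_nbrs, Finset.mem_range, Finset.mem_insert, Finset.mem_singleton]
    rw [(strip 0 m).adj_comm]
    constructor
    · rintro ⟨h1, h2⟩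
      rw [nbrs_last hm (by rw [start_zero]; omega) h1, start_zero] at h2
      omega
    · intro h1
      refine ⟨by omega, ?_⟩
      rw [nbrs_last hm (by rw [start_zero]; omega) (by omega), start_zero]
      omega
  rw [fanSum_add_two_aux hm (r + 1) (d := 2) (e := r + 2) ?_ ?_
    (card_nbrs_centre_zero m (r + 2))]
  · ring
  · rw [start_zero, hn, Finset.card_pair (by omega)]
  · rw [start_zero]
    intro i hi
    have h1 : i ∈ nbrs (strip 0 m) (Finset.range (0 + 1 + (r + 1))) (0 + 1 + (r + 1)) :=
      mem_nbrs.2 ⟨Finset.mem_of_mem_erase (mem_nbrs.1 hi).1, (mem_nbrs.1 hi).2⟩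
    have h2 : i ≠ 0 := Finset.ne_of_mem_erase (mem_nbrs.1 hi).1
    rw [hn] at h1
    simp only [Finset.mem_insert, Finset.mem_singleton] at h1
    have h3 : i = r + 1 := by omega
    by_cases h4 : r = 0
    · rw [h3, h4]; exact strip_adj_succ _ _ _
    · rw [nbrs_last hm (by rw [start_zero]; omega) (by omega)]
      exact Or.inr (start_zero m).symm

/-- Exceptional start: the first rim vertex has only the centre as an earlier neighbour, whence 8
instead of 16. -/
theorem fanSum_zero_two (m : ℕ → ℕ) :
    fanSum 0 m 2 = (1 + 4 * X) * fanSum 0 m 1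
      + 8 * X ^ 2 * fanSum 0 m 0 + 4 * X ^ 2 * cutSum 0 m 1 := by
  have hm : ∀ j, 1 ≤ j → j ≤ 0 → 1 ≤ m j := by intros; omega
  refine (fanSum_add_two_aux hm 0 (d := 1) (e := 1) ?_ ?_ (card_nbrs_centre_zero m 1)).trans
    (by ring)
  · have : nbrs (strip 0 m) (Finset.range 1) 1 = {0} := by
      ext i
      simp only [mem_nbrs, Finset.mem_range, Nat.lt_one_iff, Finset.mem_singleton]
      refine ⟨fun h => h.1, fun h => ⟨h, ?_⟩⟩
      rw [h, (strip 0 m).adj_comm]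
      exact strip_adj_succ _ _ _
    rw [start_zero, add_zero, zero_add, this, Finset.card_singleton]
  · intro i hi
    have := (mem_nbrs.1 hi).1
    rw [start_zero, Finset.mem_erase, Finset.mem_range] at this
    omega

/-- Elimination of the last vertex of the last fan, without centre. -/
lemma cutSum_add_two_aux {K : ℕ} {m : ℕ → ℕ} (hm : ∀ j, 1 ≤ j → j ≤ K → 1 ≤ m j) (r : ℕ)
    {d : ℕ} (hd : (nbrs (strip K m) ((Finset.range (start m K + 1 + r)).erase (start m K))
      (start m K + 1 + r)).card = d) :
    cutSum K m (r + 2) = (1 + 2 * X) * cutSum K m (r + 1)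
      + X ^ 2 * 2 ^ (d + 1) * cutSum K m r := by
  set b := start m K with hb
  have h2 : insert (b + 1 + r) ((Finset.range (b + 1 + r)).erase b)
      = (Finset.range (b + 1 + (r + 1))).erase b := by
    rw [← Finset.erase_insert_of_ne (by omega), ← add_assoc, Finset.range_add_one]
  have h3 : insert (b + 1 + (r + 1)) ((Finset.range (b + 1 + (r + 1))).erase b)
      = (Finset.range (b + 1 + (r + 2))).erase b := by
    rw [← Finset.erase_insert_of_ne (by omega),
      show b + 1 + (r + 2) = b + 1 + (r + 1) + 1 by ring, Finset.range_add_one]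
  have key := rankSumNat_pendant (Γ := strip K m) (S := (Finset.range (b + 1 + r)).erase b)
    (x := b + 1 + (r + 1)) (a := b + 1 + r) (d := d)
    (by rw [h2, Finset.mem_erase, Finset.mem_range]; omega)
    (by rw [Finset.mem_erase, Finset.mem_range]; omega)
    (by
      rw [h2]
      ext i
      simp only [mem_nbrs, Finset.mem_range, Finset.mem_singleton, Finset.mem_erase]
      constructor
      · rintro ⟨⟨h4, h5⟩, h6⟩
        rw [(strip K m).adj_comm, nbrs_last hm (by omega) h5] at h6
        omega
      · rintro h5
        refine ⟨by omega, ?_⟩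
        rw [(strip K m).adj_comm, nbrs_last hm (by omega) (by omega)]
        omega)
    hd
  rw [h2, h3] at key
  exact key

/-- Without the centre the last rim vertex is pendant. Its neighbour has exactly one earlier
neighbour: the preceding rim vertex or, for r = 0, the previous centre. -/
theorem cutSum_add_two {K : ℕ} {m : ℕ → ℕ} (hm : ∀ j, 1 ≤ j → j ≤ K + 1 → 1 ≤ m j) (r : ℕ) :
    cutSum (K + 1) m (r + 2)
      = (1 + 2 * X) * cutSum (K + 1) m (r + 1) + 4 * X ^ 2 * cutSum (K + 1) m r := by
  have h0 := start_add_two_le hm (show K < K + 1 by omega) le_rfl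
  rw [cutSum_add_two_aux hm r (d := 1)]
  · ring
  · set b := start m (K + 1) with hb
    have hn : nbrs (strip (K + 1) m) ((Finset.range (b + 1 + r)).erase b) (b + 1 + r)
        = {if r = 0 then start m K else b + r} := by
      ext i
      simp only [mem_nbrs, Finset.mem_range, Finset.mem_singleton, Finset.mem_erase]
      rw [(strip (K + 1) m).adj_comm]
      split_ifs with hr
      · subst hr
        constructor
        · rintro ⟨⟨h4, h1⟩, h2⟩
          rw [nbrs_centre hm (Or.inr (by omega)) h1] at h2
          omega
        · intro h1
          refine ⟨by omega, ?_⟩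
          rw [nbrs_centre hm (Or.inr (by omega)) (by omega)]
          omega
      · constructor
        · rintro ⟨⟨h4, h1⟩, h2⟩
          rw [nbrs_last hm (by omega) h1] at h2
          omega
        · intro h1
          refine ⟨by omega, ?_⟩
          rw [nbrs_last hm (by omega) (by omega)]
          omega
    rw [hn, Finset.card_singleton]

theorem cutSum_zero_add_three (m : ℕ → ℕ) (r : ℕ) :
    cutSum 0 m (r + 3) = (1 + 2 * X) * cutSum 0 m (r + 2) + 4 * X ^ 2 * cutSum 0 m (r + 1) := by
  have hm : ∀ j, 1 ≤ j → j ≤ 0 → 1 ≤ m j := by intros; omega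
  rw [cutSum_add_two_aux hm (r + 1) (d := 1)]
  · ring
  · have : nbrs (strip 0 m) ((Finset.range (0 + 1 + (r + 1))).erase 0) (0 + 1 + (r + 1))
        = {r + 1} := by
      ext i
      simp only [mem_nbrs, Finset.mem_range, Finset.mem_singleton, Finset.mem_erase]
      rw [(strip 0 m).adj_comm]
      constructor
      · rintro ⟨⟨h1, h2⟩, h3⟩
        rw [nbrs_last hm (by rw [start_zero]; omega) h2, start_zero] at h3
        omega
      · intro h1
        refine ⟨by omega, ?_⟩
        rw [nbrs_last hm (by rw [start_zero]; omega) (by omega)]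
        omega
    rw [start_zero, this, Finset.card_singleton]

theorem cutSum_zero_zero (m : ℕ → ℕ) : cutSum 0 m 0 = 1 := by
  rw [cutSum, start_zero, ← rankSumNat_empty (strip 0 m)]
  rfl

theorem cutSum_zero_one (m : ℕ → ℕ) : cutSum 0 m 1 = 1 + X := by
  rw [cutSum, start_zero, ← rankSumNat_singleton (strip 0 m) 1]
  rfl

theorem cutSum_zero_two (m : ℕ → ℕ) : cutSum 0 m 2 = 1 + 3 * X + 4 * X ^ 2 := by
  have hm : ∀ j, 1 ≤ j → j ≤ 0 → 1 ≤ m j := by intros; omega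
  refine (cutSum_add_two_aux hm 0 (d := 0) ?_).trans ?_
  · rw [start_zero]
    rfl
  · rw [cutSum_zero_zero, cutSum_zero_one]
    ring

theorem fanSum_zero_zero (m : ℕ → ℕ) : fanSum 0 m 0 = 1 + X := by
  rw [fanSum, start_zero, ← rankSumNat_singleton (strip 0 m) 0]
  rfl

theorem fanSum_zero_one (m : ℕ → ℕ) : fanSum 0 m 1 = 1 + 3 * X + 4 * X ^ 2 := by
  have key := rankSumNat_pendant (Γ := strip 0 m) (S := ∅) (x := 1) (a := 0) (d := 0)
    (by simp) (by simp) (by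
      ext i
      simp only [mem_nbrs, Finset.insert_empty, Finset.mem_singleton]
      refine ⟨fun h => h.1, fun h => ⟨h, ?_⟩⟩
      rw [h, (strip 0 m).adj_comm]
      exact strip_adj_succ _ _ _) rfl
  have h : Finset.range (0 + 1 + 1) = insert 1 (insert 0 ∅) := by decide
  rw [fanSum, start_zero, h, key, rankSumNat_empty, Finset.insert_empty, rankSumNat_singleton]
  ring

/-- Once the centre `start m (K + 1)` is deleted, the single rim vertex after it is pendant at the
previous centre `start m K`. Eliminating both leaves fan K without its centre. -/
theorem cutSum_succ_one_aux {K : ℕ} {m : ℕ → ℕ} (hm : ∀ j, 1 ≤ j → j ≤ K → 1 ≤ m j) {d : ℕ}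
    (hd : (nbrs (strip K m) ((Finset.range (start m K + 1 + m (K + 1))).erase (start m K))
      (start m K)).card = d) :
    cutSum (K + 1) m 1 = (1 + 2 * X) * fanSum K m (m (K + 1))
      + X ^ 2 * 2 ^ (d + 1) * cutSum K m (m (K + 1)) := by
  set b := start m K with hb
  set u := m (K + 1) with hu
  have h1 : insert b ((Finset.range (b + 1 + u)).erase b) = Finset.range (b + 1 + u) :=
    Finset.insert_erase (by rw [Finset.mem_range]; omega)
  have h2 : (Finset.range (start m (K + 1) + 1 + 1)).erase (start m (K + 1))
      = insert (b + u + 2) (Finset.range (b + 1 + u)) := by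
    rw [start_succ]
    ext i
    simp only [Finset.mem_erase, Finset.mem_range, Finset.mem_insert]
    omega
  have key := rankSumNat_pendant (Γ := strip K m) (S := (Finset.range (b + 1 + u)).erase b)
    (x := b + u + 2) (a := b) (d := d)
    (by rw [h1, Finset.mem_range]; omega)
    (Finset.notMem_erase _ _)
    (by
      rw [h1]
      ext i
      simp only [mem_nbrs, Finset.mem_range, Finset.mem_singleton]
      constructor
      · rintro ⟨h5, h6⟩
        rw [(strip K m).adj_comm, nbrs_last hm (by omega) (by omega)] at h6
        omega
      · rintro h5
        refine ⟨by omega, ?_⟩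
        rw [(strip K m).adj_comm, nbrs_last hm (by omega) (by omega)]
        omega)
    hd
  rw [h1] at key
  rw [fanSum, ← hb, cutSum, cutSum, ← hb, ← key, h2]
  refine rankSumNat_congr fun i hi j hj => strip_succ_adj K m ?_ ?_ <;>
  · rw [Finset.mem_insert, Finset.mem_range] at hi hj
    rw [start_succ]
    omega

theorem cutSum_succ_one {K : ℕ} {m : ℕ → ℕ} (hm : ∀ j, 1 ≤ j → j ≤ K + 1 → 1 ≤ m j) :
    cutSum (K + 2) m 1 = (1 + 2 * X) * fanSum (K + 1) m (m (K + 2))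
      + X ^ 2 * 2 ^ (m (K + 2) + 3) * cutSum (K + 1) m (m (K + 2)) :=
  cutSum_succ_one_aux hm (card_nbrs_centre hm _)

theorem cutSum_one_one (m : ℕ → ℕ) :
    cutSum 1 m 1 = (1 + 2 * X) * fanSum 0 m (m 1) + X ^ 2 * 2 ^ (m 1 + 1) * cutSum 0 m (m 1) :=
  cutSum_succ_one_aux (by intros; omega) (card_nbrs_centre_zero m _)

/-! ### The rank polynomials `L_n`, `φ_n` and `λ_{m_1,…,m_k}` -/

/-- The entries of a matrix as a function of the codes of the row and the column. -/
def codeEntry {ι : Type*} (e : ι ↪ ℕ) (M : Matrix ι ι (ZMod 2)) (p : ℕ × ℕ) : ZMod 2 :=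
  Function.extend (Prod.map e e) (fun q : ι × ι => M q.1 q.2) 0 p

lemma codeEntry_apply {ι : Type*} (e : ι ↪ ℕ) (M : Matrix ι ι (ZMod 2)) {p q : ℕ} (a b : ι)
    (ha : e a = p) (hb : e b = q) : codeEntry e M (p, q) = M a b := by
  subst ha hb
  exact (e.injective.prodMap e.injective).extend_apply (fun q : ι × ι => M q.1 q.2) 0 (a, b)

lemma strip_zero_adj {m : ℕ → ℕ} {a b : ℕ} (h : a < b) :
    (strip 0 m).Adj a b ↔ b = a + 1 ∨ a = 0 := by
  rw [strip_adj_of_lt h]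
  constructor
  · rintro (h1 | ⟨i, hi, h1, -⟩)
    · exact Or.inl h1
    · rw [Nat.le_zero.1 hi, start_zero] at h1
      exact Or.inr h1
  · rintro (h1 | rfl)
    · exact Or.inl h1
    · by_cases h2 : b = 1
      · exact Or.inl h2
      · exact Or.inr ⟨0, le_rfl, (start_zero m).symm, by omega, fun h => absurd h (lt_irrefl 0)⟩

/-- A single fan without its centre 0 is a path on the positions 1, …, n; `m` is irrelevant because
`start m 0 = 0`. -/
lemma tridiagonalPoly_eq (m : ℕ → ℕ) (n : ℕ) : tridiagonalPoly n = cutSum 0 m n := by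
  let e : Fin n ↪ ℕ := ⟨fun i => (i : ℕ) + 1, fun i j h => Fin.ext (by simpa using h)⟩
  have he : ∀ i, e i = (i : ℕ) + 1 := fun i => rfl
  have hmap : (Finset.univ : Finset (Fin n)).map e
      = (Finset.range (start m 0 + 1 + n)).erase (start m 0) := by
    rw [start_zero]
    ext i
    simp only [Finset.mem_map, Finset.mem_univ, true_and, Finset.mem_erase, Finset.mem_range, he]
    constructor
    · rintro ⟨j, rfl⟩
      have := j.2
      omega
    · intro h
      exact ⟨⟨i - 1, by omega⟩, by simp only; omega⟩
  have hadj : ∀ i j : Fin n, ((strip 0 m).comap e).Adj i j ↔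
      (i : ℕ) + 1 = j ∨ (j : ℕ) + 1 = i := by
    intro i j
    rw [SimpleGraph.comap_adj, he, he]
    rcases lt_trichotomy (i : ℕ) j with h | h | h
    · rw [strip_zero_adj (by omega)]; omega
    · rw [h]; exact iff_of_false (strip 0 m).irrefl (by omega)
    · rw [(strip 0 m).adj_comm, strip_zero_adj (by omega)]; omega
  rw [tridiagonalPoly, cutSum, ← hmap, ← rankSum_comap_nat]
  refine rankPoly_eq_rankSum fun M => ?_
  rw [mem_supported, Set.mem_ofPred_eq]
  constructor
  · rintro ⟨x, y, rfl⟩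
    refine ⟨fun i j => ?_, fun i j h => ⟨Finset.mem_univ _, Finset.mem_univ _, ?_⟩⟩
    · simp only [tridiagonal, Matrix.of_apply]
      split_ifs <;> first | omega | simp_all
    · rw [hadj, Fin.ext_iff]
      simp only [tridiagonal, Matrix.of_apply] at h
      split_ifs at h <;> first | omega | exact absurd rfl h
  · rintro ⟨hsymm, hsupp⟩
    refine ⟨fun i => codeEntry e M (i, i), fun i => codeEntry e M (i, i + 1), ?_⟩
    ext i j
    simp only [tridiagonal, Matrix.of_apply]
    split_ifs with h1 h2 h3
    · rw [codeEntry_apply e M i j (he i) (by rw [he]; omega)]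
    · rw [codeEntry_apply e M i j (he i) (by rw [he]; omega)]
    · rw [codeEntry_apply e M j i (he j) (by rw [he]; omega), hsymm]
    · by_contra h0
      have := (hsupp i j h0).2.2
      rw [hadj, Fin.ext_iff] at this
      omega

/-- The centre of a single fan is the full row 0, and the rim is the tridiagonal rest; the index is
shifted by one because r counts only the rim. -/
lemma ladderPoly_eq (m : ℕ → ℕ) (r : ℕ) : ladderPoly (r + 1) = fanSum 0 m r := by
  let e : Fin (r + 1) ↪ ℕ := Fin.valEmbedding
  have he : ∀ i, e i = (i : ℕ) := fun i => rfl
  have hmap : (Finset.univ : Finset (Fin (r + 1))).map e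
      = Finset.range (start m 0 + 1 + r) := by
    rw [start_zero]
    ext i
    simp only [Finset.mem_map, Finset.mem_univ, true_and, Finset.mem_range, he]
    constructor
    · rintro ⟨j, rfl⟩
      have := j.2
      omega
    · intro h
      exact ⟨⟨i, by omega⟩, rfl⟩
  have hadj : ∀ i j : Fin (r + 1), ((strip 0 m).comap e).Adj i j ↔
      (i : ℕ) ≠ j ∧ ((i : ℕ) = 0 ∨ (j : ℕ) = 0 ∨ (i : ℕ) + 1 = j ∨ (j : ℕ) + 1 = i) := by
    intro i j
    rw [SimpleGraph.comap_adj, he, he]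
    rcases lt_trichotomy (i : ℕ) j with h | h | h
    · rw [strip_zero_adj (by omega)]; omega
    · rw [h]; exact iff_of_false (strip 0 m).irrefl (by omega)
    · rw [(strip 0 m).adj_comm, strip_zero_adj (by omega)]; omega
  rw [ladderPoly, fanSum, ← hmap, ← rankSum_comap_nat]
  refine rankPoly_eq_rankSum fun M => ?_
  rw [mem_supported, Set.mem_ofPred_eq]
  constructor
  · rintro ⟨x, y, z, rfl⟩
    refine ⟨fun i j => ?_, fun i j h => ⟨Finset.mem_univ _, Finset.mem_univ _, ?_⟩⟩
    · simp only [ladderMatrix, Matrix.of_apply]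
      split_ifs <;> first | omega | simp_all
    · rw [hadj, Fin.ext_iff]
      simp only [ladderMatrix, Matrix.of_apply] at h
      split_ifs at h <;> first | omega | exact absurd rfl h
  · rintro ⟨hsymm, hsupp⟩
    refine ⟨fun i => codeEntry e M (i, i), fun i => codeEntry e M (i, i + 1),
      fun i => codeEntry e M (0, i), ?_⟩
    ext i j
    simp only [ladderMatrix, Matrix.of_apply]
    split_ifs with h1 h2 h3 h4 h5
    · rw [codeEntry_apply e M i j (he i) (by rw [he]; omega)]
    · rw [codeEntry_apply e M i j (by rw [he]; omega) (he j)]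
    · rw [codeEntry_apply e M j i (by rw [he]; omega) (he i), hsymm]
    · rw [codeEntry_apply e M i j (he i) (by rw [he]; omega)]
    · rw [codeEntry_apply e M j i (he j) (by rw [he]; omega), hsymm]
    · by_contra h0
      have := (hsupp i j h0).2.2
      rw [hadj, Fin.ext_iff] at this
      omega

/-! ### Overlap matrices of `H_{m_1,…,m_k}` as matrices supported on the strip -/

section Overlap

variable {K : ℕ} {m : ℕ → ℕ}

lemma start_lt_iff {i j : ℕ} : start m i < start m j ↔ i < j := (start_mono m).lt_iff_lt

lemma start_inj {i j : ℕ} : start m i = start m j ↔ i = j := (start_mono m).injective.eq_iff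

lemma strip_adj_start (hm : ∀ j, 1 ≤ j → j ≤ K + 1 → 1 ≤ m j) {c d : ℕ} (hd : d ≤ K)
    (hcd : c < d) : (strip K m).Adj (start m c) (start m d) ↔ c + 1 = d := by
  have hlt := start_add_two_le hm hcd (by omega)
  rw [strip_adj_of_lt (by omega)]
  constructor
  · rintro (h | ⟨i, hi, h1, h2, h3⟩)
    · omega
    · rw [start_inj] at h1
      subst h1
      by_contra h
      have := h3 (by omega)
      have := start_add_two_le hm (show c + 1 < d by omega) (by omega)
      omega
  · rintro rfl
    exact Or.inr ⟨c, by omega, rfl, hlt, fun _ => by omega⟩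

/-- Besides its own rim, a centre reaches the first rim vertex of the next fan, because a fan
extends to `start m (i + 1) + 1`, and the last rim vertex of the preceding fan, which is its
predecessor on the path. -/
lemma strip_adj_side (hm : ∀ j, 1 ≤ j → j ≤ K + 1 → 1 ≤ m j) {c i j : ℕ} (hc : c ≤ K) (hi : i ≤ K)
    (hj : j < m (i + 1)) : (strip K m).Adj (start m c) (start m i + 1 + j) ↔
      c = i ∨ (c + 1 = i ∧ j = 0) ∨ (c = i + 1 ∧ j + 1 = m (i + 1)) := by
  have hs := start_succ m i
  rcases lt_trichotomy c i with h | rfl | h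
  · have hlt := start_add_two_le hm h (by omega)
    rw [strip_adj_of_lt (by omega)]
    constructor
    · rintro (h1 | ⟨i', hi', h1, h2, h3⟩)
      · omega
      · rw [start_inj] at h1
        subst h1
        have := h3 (by omega)
        have h4 : c + 1 = i := by
          by_contra h5
          have := start_add_two_le hm (show c + 1 < i by omega) (by omega)
          omega
        subst h4
        omega
    · rintro (h1 | ⟨rfl, rfl⟩ | ⟨h1, h2⟩)
      · omega
      · exact Or.inr ⟨c, hc, rfl, by omega, fun _ => by omega⟩
      · omega
  · rw [strip_adj_of_lt (by omega)]
    simp only [true_or, iff_true]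
    by_cases h0 : j = 0
    · exact Or.inl (by omega)
    · exact Or.inr ⟨c, hc, rfl, by omega, fun _ => by omega⟩
  · have := (start_mono m).monotone (show i + 1 ≤ c from h)
    rw [(strip K m).adj_comm, strip_adj_of_lt (by omega)]
    constructor
    · rintro (h1 | ⟨i', hi', h1, h2, h3⟩)
      · refine Or.inr (Or.inr ⟨?_, by omega⟩)
        by_contra h5
        have := start_add_two_le hm (show i + 1 < c by omega) (by omega)
        omega
      · have h5 : i < i' := start_lt_iff.1 (show start m i < start m i' by omega)
        have h6 : i' < i + 1 := start_lt_iff.1 (show start m i' < start m (i + 1) by omega)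
        omega
    · rintro (h1 | ⟨h1, h2⟩ | ⟨rfl, h2⟩)
      · omega
      · omega
      · exact Or.inl (by omega)

lemma strip_adj_inner {i i' j j' : ℕ}
    (hj : j < m (i + 1)) (hj' : j' < m (i' + 1)) :
    (strip K m).Adj (start m i + 1 + j) (start m i' + 1 + j') ↔
      i = i' ∧ (j + 1 = j' ∨ j' + 1 = j) := by
  have hfan : ∀ i j i'', j < m (i + 1) → start m i + 1 + j ≠ start m i'' := by
    intro i j i'' hj h
    have hs := start_succ m i
    have h5 : i < i'' := start_lt_iff.1 (show start m i < start m i'' by omega)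
    have h6 : i'' < i + 1 := start_lt_iff.1 (show start m i'' < start m (i + 1) by omega)
    omega
  wlog hlt : start m i + 1 + j < start m i' + 1 + j' generalizing i i' j j'
  · rcases (not_lt.1 hlt).eq_or_lt with h | h
    · have hne : ¬ (i = i' ∧ (j + 1 = j' ∨ j' + 1 = j)) := by
        rintro ⟨rfl, h1⟩
        omega
      simp only [h, SimpleGraph.irrefl, hne]
    · rw [(strip K m).adj_comm]
      refine (this hj' hj h).trans ?_
      constructor
      · rintro ⟨h1, h2⟩; exact ⟨h1.symm, h2.symm⟩
      · rintro ⟨h1, h2⟩; exact ⟨h1.symm, h2.symm⟩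
  rw [strip_adj_of_lt hlt]
  constructor
  · rintro (h | ⟨i'', -, h, -⟩)
    · have : i = i' := by
        by_contra hne
        rcases lt_or_gt_of_ne hne with h1 | h1
        · have hs := start_succ m i
          have := (start_mono m).monotone (show i + 1 ≤ i' from h1)
          exact absurd h (by
            rcases this.eq_or_lt with h2 | h2 <;> omega)
        · have hs := start_succ m i'
          have := (start_mono m).monotone (show i' + 1 ≤ i from h1)
          omega
      subst this
      exact ⟨rfl, by omega⟩
    · exact absurd h (hfan _ _ _ hj)
  · rintro ⟨rfl, h⟩
    exact Or.inl (by omega)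

/-- The lexicographic position of an index. -/
def overlapCode : OverlapIndex (K + 1) m ↪ ℕ where
  toFun a := match a with
    | Sum.inl c => start m c
    | Sum.inr ⟨i, j⟩ => start m i + 1 + j
  inj' := by
    have hfan : ∀ i j i'', j < m (i + 1) → start m i + 1 + j ≠ start m i'' := by
      intro i j i'' hj h
      have hs := start_succ m i
      have h5 : i < i'' := start_lt_iff.1 (show start m i < start m i'' by omega)
      have h6 : i'' < i + 1 := start_lt_iff.1 (show start m i'' < start m (i + 1) by omega)
      omega
    rintro (c | ⟨i, j⟩) (d | ⟨i', j'⟩) h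
    · simp only [start_inj] at h
      rw [Fin.ext h]
    · exact absurd h.symm (hfan _ _ _ j'.2)
    · exact absurd h (hfan _ _ _ j.2)
    · simp only at h
      have : i = i' := by
        by_contra hne
        have hne' : (i : ℕ) ≠ i' := fun h => hne (Fin.ext h)
        have hj := j.2
        have hj' := j'.2
        rcases lt_or_gt_of_ne hne' with h1 | h1
        · have hs := start_succ m i
          have := (start_mono m).monotone (show (i : ℕ) + 1 ≤ i' from h1)
          omega
        · have hs := start_succ m i'
          have := (start_mono m).monotone (show (i' : ℕ) + 1 ≤ i from h1)
          omega
      subst this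
      have : j = j' := Fin.ext (by omega)
      rw [this]

lemma overlapCode_inl (c : Fin (K + 1)) :
    overlapCode (m := m) (Sum.inl c) = start m c := rfl

lemma overlapCode_inr (i : Fin (K + 1)) (j : Fin (m ((i : ℕ) + 1))) :
    overlapCode (Sum.inr ⟨i, j⟩) = start m i + 1 + j := rfl

lemma exists_start_le (n : ℕ) (hn : n < start m (K + 1)) :
    ∃ i ≤ K, start m i ≤ n ∧ n < start m (i + 1) := by
  induction K with
  | zero => exact ⟨0, le_rfl, by simp [start_zero], hn⟩
  | succ K ih =>
    by_cases h : n < start m (K + 1)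
    · obtain ⟨i, hi, h1⟩ := ih h
      exact ⟨i, by omega, h1⟩
    · exact ⟨K + 1, le_rfl, not_lt.1 h, hn⟩

lemma exists_overlapCode (n : ℕ) (hn : n < start m (K + 1)) :
    ∃ a : OverlapIndex (K + 1) m, overlapCode a = n := by
  obtain ⟨i, hi, h1, h2⟩ := exists_start_le n hn
  rw [start_succ] at h2
  rcases h1.eq_or_lt with h | h
  · exact ⟨Sum.inl ⟨i, by omega⟩, h⟩
  · exact ⟨Sum.inr ⟨⟨i, by omega⟩, ⟨n - start m i - 1, by simp only; omega⟩⟩, by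
      rw [overlapCode_inr]; simp only; omega⟩

lemma overlapCode_lt (a : OverlapIndex (K + 1) m) : overlapCode a < start m (K + 1) := by
  rcases a with c | ⟨i, j⟩
  · exact start_mono m c.2
  · rw [overlapCode_inr]
    have := (start_mono m).monotone (show (i : ℕ) + 1 ≤ K + 1 from i.2)
    have := j.2
    have := start_succ m i
    omega

lemma overlapMatrix_symm (x₀ y₀ : ℕ → ZMod 2) (x y z : ℕ → ℕ → ZMod 2)
    (a b : OverlapIndex (K + 1) m) :
    overlapMatrix (K + 1) m x₀ y₀ x y z a b = overlapMatrix (K + 1) m x₀ y₀ x y z b a := by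
  rcases a with c | ⟨i, j⟩ <;> rcases b with d | ⟨i', j'⟩
  · simp only [overlapMatrix, tridiagonal, Matrix.of_apply]
    split_ifs <;> first | omega | simp_all
  · rfl
  · rfl
  · simp only [overlapMatrix, Matrix.of_apply]
    by_cases h : i = i'
    · subst h
      simp only [if_true]
      split_ifs <;> first | omega | simp_all
    · rw [if_neg h, if_neg (Ne.symm h)]

lemma strip_adj_of_overlapMatrix (hm : ∀ j, 1 ≤ j → j ≤ K + 1 → 1 ≤ m j) (x₀ y₀ : ℕ → ZMod 2)
    (x y z : ℕ → ℕ → ZMod 2) (a b : OverlapIndex (K + 1) m)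
    (h : overlapMatrix (K + 1) m x₀ y₀ x y z a b ≠ 0) :
    a = b ∨ (strip K m).Adj (overlapCode a) (overlapCode b) := by
  have hside : ∀ (c : Fin (K + 1)) (i : Fin (K + 1)) (j : Fin (m ((i : ℕ) + 1))),
      sideEntry m z (i + 1) (j + 1) (c + 1) ≠ 0 →
      (strip K m).Adj (start m c) (start m i + 1 + j) := by
    intro c i j h
    rw [strip_adj_side hm (Nat.lt_succ_iff.1 c.2) (Nat.lt_succ_iff.1 i.2) j.2]
    simp only [sideEntry] at h
    split_ifs at h <;> first | omega | exact absurd rfl h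
  rcases a with c | ⟨i, j⟩ <;> rcases b with d | ⟨i', j'⟩
  · simp only [overlapMatrix, tridiagonal, Matrix.of_apply] at h
    rw [overlapCode_inl, overlapCode_inl]
    split_ifs at h with h1 h2 h3
    · exact Or.inl (by rw [Fin.ext h1])
    · exact Or.inr ((strip_adj_start hm (Nat.lt_succ_iff.1 d.2) (by omega)).2 h2)
    · exact Or.inr ((strip_adj_start hm (Nat.lt_succ_iff.1 c.2) (by omega)).2 h3).symm
    · exact absurd rfl h
  · exact Or.inr (hside c i' j' h)
  · exact Or.inr (hside d i j h).symm
  · simp only [overlapMatrix, Matrix.of_apply] at h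
    rw [overlapCode_inr, overlapCode_inr]
    by_cases hi : i = i'
    · subst hi
      simp only [if_true] at h
      split_ifs at h with h1 h2 h3
      · exact Or.inl (by rw [Fin.ext h1])
      · exact Or.inr ((strip_adj_inner j.2 j'.2).2 ⟨rfl, Or.inl h2⟩)
      · exact Or.inr ((strip_adj_inner j.2 j'.2).2 ⟨rfl, Or.inr h3⟩)
      · exact absurd rfl h
    · rw [if_neg hi] at h
      exact absurd rfl h

/-- The parametrisation of the matrices has no redundancy constraints: each parameter is the entry
at one pair of codes, and every remaining entry is forced to vanish. -/
lemma exists_eq_overlapMatrix (hm : ∀ j, 1 ≤ j → j ≤ K + 1 → 1 ≤ m j)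
    (M : Matrix (OverlapIndex (K + 1) m) (OverlapIndex (K + 1) m) (ZMod 2))
    (hsymm : ∀ a b, M a b = M b a)
    (hsupp : ∀ a b, M a b ≠ 0 → a = b ∨ (strip K m).Adj (overlapCode a) (overlapCode b)) :
    ∃ (x₀ y₀ : ℕ → ZMod 2) (x y z : ℕ → ℕ → ZMod 2), M = overlapMatrix (K + 1) m x₀ y₀ x y z := by
  let v := codeEntry overlapCode M
  have hv : ∀ {p q : ℕ} (a b : OverlapIndex (K + 1) m), overlapCode a = p → overlapCode b = q →
      v (p, q) = M a b := fun a b ha hb => codeEntry_apply overlapCode M a b ha hb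
  -- `z i 0` sits at the predecessor of the i-th centre and `z i (m i + 1)` at the first rim vertex
  -- after the next centre; all other values lie on the rim of the fan itself.
  let z : ℕ → ℕ → ZMod 2 := fun i j =>
    if j = 0 then v (start m (i - 1), start m (i - 1) - 1)
    else if j = m i + 1 then v (start m (i - 1), start m i + 1)
    else v (start m (i - 1), start m (i - 1) + j)
  have hside : ∀ (c : Fin (K + 1)) (i : Fin (K + 1)) (j : Fin (m ((i : ℕ) + 1))),
      M (Sum.inl c) (Sum.inr ⟨i, j⟩) = sideEntry m z (i + 1) (j + 1) (c + 1) := by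
    intro c i j
    have hadj := strip_adj_side hm (Nat.lt_succ_iff.1 c.2) (Nat.lt_succ_iff.1 i.2) j.2
    have hj := j.2
    have hcode : ∀ q, start m i + 1 + j = q → v (start m c, q) = M (Sum.inl c) (Sum.inr ⟨i, j⟩) :=
      fun q hq => hv _ _ (overlapCode_inl c) ((overlapCode_inr i j).trans hq)
    have hi := i.2
    have hs := start_succ m i
    simp only [sideEntry]
    by_cases h1 : (c : ℕ) = i
    · rw [if_pos (by omega)]
      simp only [z]
      rw [if_neg (by omega), if_neg (by omega), Nat.add_sub_cancel]
      rw [← hcode (start m i + (j + 1)) (by omega), h1]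
    rw [if_neg (by omega)]
    by_cases h2 : (c : ℕ) + 1 = i ∧ (j : ℕ) = 0
    · rw [if_pos (by omega)]
      simp only [z]
      rw [if_neg (by omega), if_pos trivial, Nat.add_sub_cancel, hcode _ (by rw [h2.1]; omega)]
    rw [if_neg (by omega)]
    by_cases h3 : (c : ℕ) = i + 1 ∧ (j : ℕ) + 1 = m (i + 1)
    · rw [if_pos (by omega)]
      simp only [z]
      rw [if_pos trivial, Nat.add_sub_cancel, hcode _ (by rw [h3.1]; omega)]
    rw [if_neg (by omega)]
    by_contra h0
    have := (hsupp _ _ h0).resolve_left (by simp)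
    rw [overlapCode_inl, overlapCode_inr, hadj] at this
    omega
  refine ⟨fun i => v (start m (i - 1), start m (i - 1)), fun i => v (start m (i - 1), start m i),
    fun i j => v (start m (i - 1) + j, start m (i - 1) + j),
    fun i j => v (start m (i - 1) + j, start m (i - 1) + j + 1), z, ?_⟩
  ext a b
  rcases a with c | ⟨i, j⟩ <;> rcases b with d | ⟨i', j'⟩
  · simp only [overlapMatrix, tridiagonal, Matrix.of_apply, Nat.add_sub_cancel]
    split_ifs with h1 h2 h3
    · rw [hv (Sum.inl c) (Sum.inl d) (overlapCode_inl c) (by rw [overlapCode_inl, h1])]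
    · rw [hv (Sum.inl c) (Sum.inl d) (overlapCode_inl c) (by rw [overlapCode_inl, h2])]
    · rw [hv (Sum.inl d) (Sum.inl c) (overlapCode_inl d) (by rw [overlapCode_inl, h3]), hsymm]
    · by_contra h0
      have := (hsupp _ _ h0).resolve_left (by simp only [Sum.inl.injEq, Fin.ext_iff]; omega)
      rw [overlapCode_inl, overlapCode_inl] at this
      rcases lt_or_gt_of_ne h1 with h4 | h4
      · rw [strip_adj_start hm (Nat.lt_succ_iff.1 d.2) h4] at this
        omega
      · rw [(strip K m).adj_comm, strip_adj_start hm (Nat.lt_succ_iff.1 c.2) h4] at this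
        omega
  · exact hside c i' j'
  · rw [hsymm]
    exact hside d i j
  · simp only [overlapMatrix, Matrix.of_apply, Nat.add_sub_cancel]
    split_ifs with h0 h1 h2 h3
    · subst h0
      rw [hv (Sum.inr ⟨i, j⟩) (Sum.inr ⟨i, j'⟩) (by rw [overlapCode_inr]; omega)
        (by rw [overlapCode_inr]; omega)]
    · subst h0
      rw [hv (Sum.inr ⟨i, j⟩) (Sum.inr ⟨i, j'⟩) (by rw [overlapCode_inr]; omega)
        (by rw [overlapCode_inr]; omega)]
    · subst h0
      rw [hv (Sum.inr ⟨i, j'⟩) (Sum.inr ⟨i, j⟩) (by rw [overlapCode_inr]; omega)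
        (by rw [overlapCode_inr]; omega), hsymm]
    · subst h0
      by_contra h4
      have := (hsupp _ _ h4).resolve_left (fun h => h1 (by
        simp only [Sum.inr.injEq, Sigma.mk.injEq, heq_eq_eq, true_and] at h
        rw [h]))
      rw [overlapCode_inr, overlapCode_inr, strip_adj_inner j.2 j'.2] at this
      omega
    · by_contra h4
      have := (hsupp _ _ h4).resolve_left (fun h => h0 (by
        simp only [Sum.inr.injEq, Sigma.mk.injEq] at h
        exact h.1))
      rw [overlapCode_inr, overlapCode_inr, strip_adj_inner j.2 j'.2] at this
      exact h0 (Fin.ext this.1)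

/-- A vanishing row and column `e_k` means that the last centre `start m K` is removed from the
support. -/
theorem lambdaPoly_eq (hm : ∀ j, 1 ≤ j → j ≤ K + 1 → 1 ≤ m j) :
    lambdaPoly (K + 1) m = cutSum K m (m (K + 1)) := by
  have hmap : (Finset.univ.erase (Sum.inl (Fin.last K)) : Finset (OverlapIndex (K + 1) m)).map
      overlapCode = (Finset.range (start m K + 1 + m (K + 1))).erase (start m K) := by
    ext n
    simp only [Finset.mem_map, Finset.mem_erase, Finset.mem_univ, and_true, Finset.mem_range]
    have hs := start_succ m K
    constructor
    · rintro ⟨a, ha, rfl⟩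
      have := overlapCode_lt a
      refine ⟨fun h => ha ?_, by omega⟩
      exact overlapCode.injective h
    · rintro ⟨h1, h2⟩
      obtain ⟨a, rfl⟩ := exists_overlapCode (K := K) (m := m) n (by omega)
      exact ⟨a, fun h => h1 (by rw [h]; rfl), rfl⟩
  rw [lambdaPoly, cutSum, ← hmap, ← rankSum_comap_nat]
  refine rankPoly_eq_rankSum fun M => ?_
  rw [mem_supported, Set.mem_ofPred_eq]
  constructor
  · rintro ⟨⟨x₀, y₀, x, y, z, rfl⟩, h0⟩
    refine ⟨overlapMatrix_symm x₀ y₀ x y z, fun a b h => ?_⟩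
    simp only [Finset.mem_erase, Finset.mem_univ, and_true]
    refine ⟨?_, ?_, strip_adj_of_overlapMatrix hm x₀ y₀ x y z a b h⟩
    · rintro rfl
      exact h (h0 (Fin.last K) rfl b).1
    · rintro rfl
      exact h (h0 (Fin.last K) rfl a).2
  · rintro ⟨hsymm, hsupp⟩
    refine ⟨exists_eq_overlapMatrix hm M hsymm fun a b h => (hsupp a b h).2.2, ?_⟩
    intro c hc a
    have hc' : c = Fin.last K := Fin.ext (by simpa using hc)
    subst hc'
    constructor
    · by_contra h
      exact Finset.ne_of_mem_erase (hsupp _ _ h).1 rfl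
    · by_contra h
      exact Finset.ne_of_mem_erase (hsupp _ _ h).2.1 rfl

end Overlap

/-! ### Rotation systems of cubic graphs -/

/-- The two rotations of three edge-ends. -/
def sgn (b : Bool) : ZMod 3 := if b then 1 else -1

lemma sgn_not (b : Bool) : sgn (!b) = -sgn b := by cases b <;> rfl

/-- A numbering of the neighbours of every vertex of a cubic graph. -/
structure CubicPorts {V : Type*} (G : SimpleGraph V) where
  nb : V → ZMod 3 → V
  inj : ∀ v, Function.Injective (nb v)
  adj : ∀ v w, G.Adj v w ↔ ∃ i, nb v i = w

namespace CubicPorts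

variable {V : Type*} {G : SimpleGraph V} (P : CubicPorts G)

/-- The dart with number `i` at `v`. -/
def dart (v : V) (i : ZMod 3) : G.Dart := ⟨(v, P.nb v i), (P.adj v _).2 ⟨i, rfl⟩⟩

/-- The darts as pairs of a vertex and a number. -/
def dartEquiv : V × ZMod 3 ≃ G.Dart :=
  Equiv.ofBijective (fun q => P.dart q.1 q.2) <| by
    constructor
    · rintro ⟨v, i⟩ ⟨w, j⟩ h
      have h1 : v = w := congrArg (fun d : G.Dart => d.fst) h
      subst h1
      have h2 : P.nb v i = P.nb v j := congrArg (fun d : G.Dart => d.snd) h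
      rw [P.inj v h2]
    · intro d
      obtain ⟨i, hi⟩ := (P.adj _ _).1 d.adj
      exact ⟨(d.fst, i), by ext <;> simp [dart, hi]⟩

lemma dartEquiv_apply (v : V) (i : ZMod 3) : P.dartEquiv (v, i) = P.dart v i := rfl

lemma exists_eq_dart (d : G.Dart) : ∃ i, d = P.dart d.fst i := by
  obtain ⟨⟨v, i⟩, rfl⟩ := P.dartEquiv.surjective d
  exact ⟨i, rfl⟩

lemma dart_inj {v : V} {i j : ZMod 3} : P.dart v i = P.dart v j ↔ i = j := by
  rw [← dartEquiv_apply, ← dartEquiv_apply, P.dartEquiv.injective.eq_iff]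
  simp

/-- The rotation at all vertices that is cyclic in the numbering or in the reverse numbering. -/
def rot (b : V → Bool) : Equiv.Perm G.Dart :=
  P.dartEquiv.permCongr (Equiv.prodShear (Equiv.refl V) fun v => Equiv.addRight (sgn (b v)))

lemma rot_dart (b : V → Bool) (v : V) (i : ZMod 3) :
    P.rot b (P.dart v i) = P.dart v (i + sgn (b v)) := by
  rw [← dartEquiv_apply, rot, Equiv.permCongr_apply, Equiv.symm_apply_apply]
  rfl

/-- The rotation system with given rotations and twisted edges. -/
def system (b : V → Bool) (t : G.edgeSet → Bool) : RotationSystem G where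
  rot := P.rot b
  twist := t
  isCycleOn_rot v := by
    have hS : ∀ d : G.Dart, d ∈ {d : G.Dart | d.fst = v} ↔ ∃ i, d = P.dart v i := by
      intro d
      constructor
      · rintro rfl
        exact P.exists_eq_dart d
      · rintro ⟨i, rfl⟩
        rfl
    constructor
    · refine ⟨?_, (P.rot b).injective.injOn, ?_⟩
      · intro d hd
        obtain ⟨i, rfl⟩ := (hS d).1 hd
        rw [hS, rot_dart]
        exact ⟨_, rfl⟩
      · intro d hd
        obtain ⟨i, rfl⟩ := (hS d).1 hd
        exact ⟨P.dart v (i - sgn (b v)), (hS _).2 ⟨_, rfl⟩, by rw [rot_dart, sub_add_cancel]⟩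
    · intro x hx y hy
      obtain ⟨i, rfl⟩ := (hS x).1 hx
      obtain ⟨j, rfl⟩ := (hS y).1 hy
      have h : ∀ (c : Bool) (i j : ZMod 3), j = i ∨ j = i + sgn c ∨ j = i + sgn c + sgn c := by
        decide
      rcases h (b v) i j with h | h | h
      · exact ⟨0, by rw [h]; rfl⟩
      · exact ⟨1, by rw [h, ← rot_dart]; rfl⟩
      · exact ⟨2, by rw [h, ← rot_dart, ← rot_dart]; rfl⟩

/-- A cyclic permutation of three darts has no fixed point, and the only fixed-point-free bijections
of `ZMod 3` are the translations by 1 and by -1. -/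
lemma exists_rot_eq (R : RotationSystem G) : ∃ b, R.rot = P.rot b := by
  have h1 : ∀ v i, ∃ j, R.rot (P.dart v i) = P.dart v j := by
    intro v i
    have h : R.rot (P.dart v i) ∈ {d : G.Dart | d.fst = v} :=
      (R.isCycleOn_rot v).1.mapsTo (show P.dart v i ∈ {d : G.Dart | d.fst = v} from rfl)
    obtain ⟨j, hj⟩ := P.exists_eq_dart (R.rot (P.dart v i))
    rw [Set.mem_ofPred_eq] at h
    exact ⟨j, by rw [hj, h]⟩
  choose f hf using h1
  have h2 : ∀ v i, f v i ≠ i := by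
    intro v i h
    have hnt : ({d : G.Dart | d.fst = v} : Set G.Dart).Nontrivial :=
      ⟨P.dart v 0, rfl, P.dart v 1, rfl, fun h => by
        rw [dart_inj] at h; exact absurd h (by decide)⟩
    refine (R.isCycleOn_rot v).apply_ne hnt (show P.dart v i ∈ {d : G.Dart | d.fst = v} from rfl) ?_
    rw [hf, h]
  have h3 : ∀ v i j, f v i = f v j → i = j := by
    intro v i j h
    rw [← P.dart_inj (v := v)]
    apply R.rot.injective
    rw [hf, hf, h]
  have h4 : ∀ g : ZMod 3 → ZMod 3, (∀ i, g i ≠ i) → (∀ i j, g i = g j → i = j) →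
      ∃ c, ∀ i, g i = i + sgn c := by
    decide
  choose b hb using fun v => h4 (f v) (h2 v) (h3 v)
  refine ⟨b, ?_⟩
  ext1 d
  obtain ⟨i, hi⟩ := P.exists_eq_dart d
  rw [hi, hf, hb, rot_dart]

lemma rot_injective : Function.Injective P.rot := by
  intro b b' h
  funext v
  have := congrArg (fun r : Equiv.Perm G.Dart => r (P.dart v 0)) h
  simp only [rot_dart, dart_inj] at this
  revert this
  generalize b v = c
  generalize b' v = c'
  revert c c'
  decide

/-- The conditions on a binary function on the corners (a corner is numbered by the dart opposite
to it) to be constant on the faces. -/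
def IsFaceFun (b : V → Bool) (t : G.edgeSet → Bool) (h : V → ZMod 3 → ZMod 2) : Prop :=
  ∀ v i j, P.nb (P.nb v i) j = v → ∀ s : Bool, h v (i + sgn s) = h (P.nb v i)
    (j + sgn (xor (!s) (xor (xor (b v) (b (P.nb v i)))
      (t ⟨(P.dart v i).edge, (P.dart v i).edge_mem⟩))))

lemma symm_dart {v : V} {i j : ZMod 3} (h : P.nb (P.nb v i) j = v) :
    (P.dart v i).symm = P.dart (P.nb v i) j := by
  ext
  · rfl
  · exact h.symm

lemma exists_port (v : V) (i : ZMod 3) : ∃ j, P.nb (P.nb v i) j = v :=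
  (P.adj _ _).1 ((P.adj v _).2 ⟨i, rfl⟩).symm

/-- Functions on the faces are functions on the corners. -/
def faceFunEquiv (b : V → Bool) (t : G.edgeSet → Bool) :
    ((P.system b t).Face → ZMod 2) ≃ {h // P.IsFaceFun b t h} where
  -- Corner i lies between the darts i + 1 and i - 1. The rotation leads from i + sgn (b v) to i -
  -- sgn (b v), so the corner is the `true` side of the former and the `false` side of the latter.
  toFun f := ⟨fun v i => f (Quot.mk _ (P.dart v (i + sgn (b v)), true)), by
    intro v i j hj s
    have h3 : ∀ c : Bool, sgn c + sgn c = -sgn c := by decide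
    have hcor : ∀ v i, f (Quot.mk _ (P.dart v (i + sgn (b v)), true))
        = f (Quot.mk _ (P.dart v (i - sgn (b v)), false)) := by
      intro v i
      congr 1
      have h := Quot.sound (RotationSystem.Consecutive.corner (R := P.system b t)
        (P.dart v (i + sgn (b v))))
      have h2 : (P.system b t).rot (P.dart v (i + sgn (b v))) = P.dart v (i - sgn (b v)) := by
        rw [sub_eq_add_neg, ← h3, ← add_assoc]
        exact P.rot_dart b v _
      rw [h2] at h
      exact h
    -- Conversely, the side `xor c (b v)` of dart i borders the corner i + sgn c: the sign is
    -- geometric and no longer depends on the rotation.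
    have hval : ∀ v i c, f (Quot.mk _ (P.dart v (i + sgn c + sgn (b v)), true))
        = f (Quot.mk _ (P.dart v i, xor c (b v))) := by
      intro v i c
      by_cases hc : c = b v
      · subst hc
        rw [hcor, add_sub_cancel_right, Bool.xor_self]
      · have hc' : b v = !c := by
          revert hc; generalize b v = d; revert c d; decide
        rw [hc', sgn_not, add_neg_cancel_right]
        simp
    refine (hval v i s).trans (Eq.trans (congrArg f ?_) (hval _ _ _).symm)
    have h := Quot.sound (RotationSystem.Consecutive.side (R := P.system b t) (P.dart v i)
      (xor s (b v)))
    rw [P.symm_dart hj] at h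
    refine h.trans (congrArg (fun c => Quot.mk _ (P.dart (P.nb v i) j, c)) ?_)
    change xor _ (t _) = _
    clear h
    generalize t _ = d
    generalize b v = x
    generalize b (P.nb v i) = y
    revert s d x y
    decide⟩
  invFun h := Quot.lift (fun x => h.1 x.1.fst ((P.dartEquiv.symm x.1).2 +
      sgn (xor x.2 (b x.1.fst)))) <| by
    have hsymm : ∀ v i, P.dartEquiv.symm (P.dart v i) = (v, i) := fun v i => by
      rw [← dartEquiv_apply, Equiv.symm_apply_apply]
    rintro _ _ (d | ⟨d, s⟩)
    · obtain ⟨i, hi⟩ := P.exists_eq_dart d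
      have h1 : (P.system b t).rot d = P.dart d.fst (i + sgn (b d.fst)) := by
        conv_lhs => rw [hi]
        exact P.rot_dart b _ _
      simp only [h1]
      generalize d.fst = v at hi
      subst hi
      rw [hsymm, hsymm]
      refine congrArg (h.1 v) ?_
      change i + sgn (xor true (b v)) = i + sgn (b v) + sgn (xor false (b v))
      clear h1
      generalize b v = c
      revert i c
      decide
    · obtain ⟨i, hi⟩ := P.exists_eq_dart d
      generalize d.fst = v at hi
      subst hi
      obtain ⟨j, hj⟩ := P.exists_port v i
      simp only [P.symm_dart hj, hsymm]
      refine (h.2 v i j hj _).trans (congrArg (fun c => h.1 (P.nb v i) (j + sgn c)) ?_)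
      change xor (!(xor s (b v))) (xor (xor (b v) (b (P.nb v i))) _)
        = xor (xor (!s) (t _)) (b (P.nb v i))
      generalize t _ = d
      generalize b v = x
      generalize b (P.nb v i) = y
      revert s d x y
      decide
  left_inv f := by
    have hsymm : ∀ v i, P.dartEquiv.symm (P.dart v i) = (v, i) := fun v i => by
      rw [← dartEquiv_apply, Equiv.symm_apply_apply]
    have h3 : ∀ c : Bool, sgn c + sgn c = -sgn c := by decide
    funext x
    induction x using Quot.ind
    rename_i x
    obtain ⟨d, s⟩ := x
    obtain ⟨i, hi⟩ := P.exists_eq_dart d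
    generalize d.fst = v at hi
    subst hi
    change f (Quot.mk _ (P.dart v ((P.dartEquiv.symm (P.dart v i)).2 + sgn (xor s (b v))
      + sgn (b v)), true)) = f (Quot.mk _ (P.dart v i, s))
    rw [hsymm]
    change f (Quot.mk _ (P.dart v (i + sgn (xor s (b v)) + sgn (b v)), true)) = _
    congr 1
    cases s
    · rw [Bool.false_xor]
      have h := Quot.sound (RotationSystem.Consecutive.corner (R := P.system b t)
        (P.dart v (i + sgn (b v) + sgn (b v))))
      have h2 : (P.system b t).rot (P.dart v (i + sgn (b v) + sgn (b v))) = P.dart v i := by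
        refine (P.rot_dart b v _).trans ?_
        rw [add_assoc i, h3, neg_add_cancel_right]
      rw [h2] at h
      exact h
    · rw [Bool.true_xor, sgn_not, neg_add_cancel_right]
  right_inv h := by
    have hsymm : ∀ v i, P.dartEquiv.symm (P.dart v i) = (v, i) := fun v i => by
      rw [← dartEquiv_apply, Equiv.symm_apply_apply]
    ext v i
    change h.1 v ((P.dartEquiv.symm (P.dart v (i + sgn (b v)))).2 + sgn (xor true (b v))) = h.1 v i
    rw [hsymm]
    change h.1 v (i + sgn (b v) + sgn (xor true (b v))) = h.1 v i
    rw [Bool.true_xor, sgn_not, add_neg_cancel_right]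

/-- Counting functions to `ZMod 2` turns the number of faces into the exponent of a solution count,
hence accessible to linear algebra. -/
lemma card_face [Finite V] (b : V → Bool) (t : G.edgeSet → Bool) :
    2 ^ Nat.card (P.system b t).Face = Nat.card {h // P.IsFaceFun b t h} := by
  have : Finite G.Dart := Finite.of_equiv _ P.dartEquiv
  have : Finite (P.system b t).Face := inferInstanceAs (Finite (Quot _))
  rw [← Nat.card_congr (P.faceFunEquiv b t), Nat.card_fun, Nat.card_zmod]

lemma two_mul_card_edgeSet [Fintype V] (P : CubicPorts G) : 2 * Nat.card G.edgeSet = 3 * Fintype.card V := by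
  classical
  have h1 := G.sum_degrees_eq_twice_card_edges
  have h2 := G.dart_card_eq_twice_card_edges
  have h3 : Fintype.card G.Dart = Fintype.card V * 3 := by
    rw [← Fintype.card_congr P.dartEquiv, Fintype.card_prod, ZMod.card]
  rw [Nat.card_eq_fintype_card, ← SimpleGraph.edgeFinset_card]
  omega

/-- The rotation systems for a spanning tree `T`, if `cot` enumerates the co-tree edges. -/
def treeSystemEquiv (T : SimpleGraph V) {ι : Type*} (cot : ι → G.edgeSet)
    (hinj : Function.Injective cot)
    (hcot : ∀ e : G.edgeSet, (e : Sym2 V) ∈ T.edgeSet ↔ e ∉ Set.range cot) :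
    (V → Bool) × (ι → Bool) ≃ {R : RotationSystem G // R.IsTRotation T} :=
  Equiv.ofBijective (fun q => ⟨P.system q.1 (Function.extend cot q.2 fun _ => false), by
      intro e he
      change Function.extend cot q.2 (fun _ => false) e = false
      exact Function.extend_apply' _ _ _ ((hcot e).1 he)⟩) <| by
    constructor
    · rintro ⟨b, t⟩ ⟨b', t'⟩ h
      have h := congrArg Subtype.val h
      have h1 : P.rot b = P.rot b' := congrArg RotationSystem.rot h
      have h2 : Function.extend cot t (fun _ => false) = Function.extend cot t' fun _ => false :=
        congrArg RotationSystem.twist h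
      rw [P.rot_injective h1]
      congr 1
      funext n
      have := congrFun h2 (cot n)
      rwa [hinj.extend_apply, hinj.extend_apply] at this
    · rintro ⟨R, hR⟩
      obtain ⟨b, hb⟩ := P.exists_rot_eq R
      refine ⟨(b, fun n => R.twist (cot n)), Subtype.ext ?_⟩
      have htw : Function.extend cot (fun n => R.twist (cot n)) (fun _ => false) = R.twist := by
        funext e
        by_cases he : e ∈ Set.range cot
        · obtain ⟨n, rfl⟩ := he
          rw [hinj.extend_apply]
        · rw [Function.extend_apply' _ _ _ he, hR e ((hcot e).2 he)]
      obtain ⟨r, hr, t⟩ := R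
      simp only at hb htw
      subst hb
      simp only [htw]
      rfl

end CubicPorts

/-! ### Open faces along the spine -/

section Positions

/-- The leaf at position `p` is on the side `s`, for pendant edges directed by `D`. -/
def SideAt (l : ℕ) (D : ℕ → Bool) (s : Bool) (p : ℕ) : Prop := p = 0 ∨ p = l + 1 ∨ D p = s

instance (l : ℕ) (D : ℕ → Bool) (s : Bool) : DecidablePred (SideAt l D s) :=
  fun _ => inferInstanceAs (Decidable (_ ∨ _ ∨ _))

lemma sideAt_self (l : ℕ) (D : ℕ → Bool) (p : ℕ) : SideAt l D (D p) p := Or.inr (Or.inr rfl)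

lemma exists_sideAt_gt {l : ℕ} (D : ℕ → Bool) (s : Bool) {p : ℕ} (hp : p ≤ l) :
    ∃ q, p < q ∧ SideAt l D s q := ⟨l + 1, by omega, Or.inr (Or.inl rfl)⟩

/-- The next position on the side `s` (for `p ≤ l`). -/
def nextPos (l : ℕ) (D : ℕ → Bool) (s : Bool) (p : ℕ) : ℕ :=
  if hp : p ≤ l then Nat.find (exists_sideAt_gt D s hp) else 0

/-- The previous position on the side `s` (for `1 ≤ p`). -/
def prevPos (l : ℕ) (D : ℕ → Bool) (s : Bool) (p : ℕ) : ℕ :=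
  Nat.findGreatest (SideAt l D s) (p - 1)

variable {l : ℕ} {D : ℕ → Bool} {s : Bool} {p q : ℕ}

lemma lt_nextPos (hp : p ≤ l) : p < nextPos l D s p := by
  rw [nextPos, dif_pos hp]
  exact (Nat.find_spec (exists_sideAt_gt D s hp)).1

lemma sideAt_nextPos (hp : p ≤ l) : SideAt l D s (nextPos l D s p) := by
  rw [nextPos, dif_pos hp]
  exact (Nat.find_spec (exists_sideAt_gt D s hp)).2

lemma not_sideAt_of_lt_nextPos (hp : p ≤ l) (h1 : p < q) (h2 : q < nextPos l D s p) :
    ¬ SideAt l D s q := by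
  rw [nextPos, dif_pos hp] at h2
  exact fun h => Nat.find_min (exists_sideAt_gt D s hp) h2 ⟨h1, h⟩

lemma nextPos_le (hp : p ≤ l) : nextPos l D s p ≤ l + 1 := by
  by_contra h
  exact not_sideAt_of_lt_nextPos (D := D) (s := s) hp (show p < l + 1 by omega) (by omega) (Or.inr (Or.inl rfl))

lemma nextPos_eq (hp : p ≤ l) (hpq : p < q) (hq : SideAt l D s q)
    (h : ∀ r, p < r → r < q → ¬ SideAt l D s r) : nextPos l D s p = q := by
  rcases lt_trichotomy (nextPos l D s p) q with h1 | h1 | h1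
  · exact absurd (sideAt_nextPos hp) (h _ (lt_nextPos hp) h1)
  · exact h1
  · exact absurd hq (not_sideAt_of_lt_nextPos hp hpq h1)

lemma prevPos_lt (hp : 1 ≤ p) : prevPos l D s p < p := by
  have : prevPos l D s p ≤ p - 1 := Nat.findGreatest_le _
  omega

lemma sideAt_prevPos : SideAt l D s (prevPos l D s p) := by
  exact Nat.findGreatest_spec (P := SideAt l D s) (m := 0) (Nat.zero_le _) (Or.inl rfl)

lemma not_sideAt_of_prevPos_lt (h1 : prevPos l D s p < q) (h2 : q < p) : ¬ SideAt l D s q := by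
  exact Nat.findGreatest_is_greatest h1 (by omega)

lemma nextPos_prevPos (hp : 1 ≤ p) (hp' : p ≤ l + 1) (h : SideAt l D s p) :
    nextPos l D s (prevPos l D s p) = p := by
  have h1 := prevPos_lt (l := l) (D := D) (s := s) hp
  exact nextPos_eq (by omega) h1 h fun r h2 h3 => not_sideAt_of_prevPos_lt h2 h3

lemma prevPos_nextPos (hp : p ≤ l) (h : SideAt l D s p) :
    prevPos l D s (nextPos l D s p) = p := by
  have h1 := lt_nextPos (D := D) (s := s) hp
  rcases lt_trichotomy (prevPos l D s (nextPos l D s p)) p with h2 | h2 | h2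
  · exact absurd h (not_sideAt_of_prevPos_lt h2 h1)
  · exact h2
  · exact absurd sideAt_prevPos (not_sideAt_of_lt_nextPos hp h2 (prevPos_lt (by omega)))

/-- The label of the face on the side `s` of the spine edge from position `r` to `r + 1`: the faces
are numbered from left to right, starting with the lower and the upper face at position `0`. -/
def openFace (D : ℕ → Bool) (s : Bool) : ℕ → ℕ
  | 0 => if s then 1 else 0
  | r + 1 => if D (r + 1) = s then r + 2 else openFace D s r

/-- The leaf at position p closes the open face on its side and opens the face p + 1. For p = 0 this
is the upper face, which is why `D 0 = true` is the convention. -/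
lemma openFace_self (h0 : D 0 = true) (h : D p = s) : openFace D s p = p + 1 := by
  cases p with
  | zero => rw [openFace, ← h, h0, if_pos rfl]
  | succ p => rw [openFace, if_pos h]

lemma openFace_succ (h : D (p + 1) ≠ s) : openFace D s (p + 1) = openFace D s p := by
  rw [openFace, if_neg h]

lemma openFace_le (D : ℕ → Bool) (s : Bool) (r : ℕ) : openFace D s r ≤ r + 1 := by
  induction r with
  | zero => rw [openFace]; split_ifs <;> omega
  | succ r ih => rw [openFace]; split_ifs <;> omega

lemma openFace_lt (h0 : D 0 = true) (h : D p ≠ s) : openFace D s p < p + 1 := by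
  cases p with
  | zero =>
    rw [h0] at h
    rw [openFace, if_neg (by cases s <;> simp_all)]
    omega
  | succ p =>
    rw [openFace_succ h]
    have := openFace_le D s p
    omega

lemma openFace_mono (D : ℕ → Bool) (s : Bool) : Monotone (openFace D s) := by
  refine monotone_nat_of_le_succ fun r => ?_
  rw [openFace]
  have := openFace_le D s r
  split_ifs <;> omega

/-- The side on which a face is open. -/
def faceSide (D : ℕ → Bool) (n : ℕ) : Bool := if n = 0 then false else D (n - 1)

lemma faceSide_openFace (h0 : D 0 = true) (s : Bool) (r : ℕ) :
    faceSide D (openFace D s r) = s := by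
  induction r with
  | zero => cases s <;> simp [openFace, faceSide, h0]
  | succ r ih =>
    by_cases h : D (r + 1) = s
    · rw [openFace, if_pos h, faceSide, if_neg (by omega)]
      exact h
    · rw [openFace_succ h, ih]

lemma openFace_ne (h0 : D 0 = true) {s' : Bool} (h : s ≠ s') (r r' : ℕ) :
    openFace D s r ≠ openFace D s' r' := fun h1 =>
  h (by rw [← faceSide_openFace h0 s r, h1, faceSide_openFace h0])

lemma sideAt_faceSide (D : ℕ → Bool) (l n : ℕ) : SideAt l D (faceSide D n) (n - 1) := by
  rw [faceSide]
  split_ifs with h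
  · exact Or.inl (by omega)
  · exact sideAt_self l D _

/-- The face n opens at position n - 1. Truncated subtraction is intended: the labels 0 and 1 both
open at position 0, on the two sides. -/
lemma openFace_faceSide (h0 : D 0 = true) (n : ℕ) : openFace D (faceSide D n) (n - 1) = n := by
  rw [faceSide]
  split_ifs with h
  · subst h; rfl
  · rw [openFace_self h0 rfl]
    omega

lemma openFace_sub_one (h0 : D 0 = true) (hp : p ≤ l) (h : SideAt l D s p) :
    openFace D s p - 1 = p := by
  rcases h with rfl | h | h
  · rw [openFace]; split_ifs <;> rfl
  · omega
  · rw [openFace_self h0 h]; rfl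

/-- A face is open exactly from its opening leaf to the next leaf on the same side. -/
lemma openFace_eq_iff (h0 : D 0 = true) (hp : p ≤ l) (h : SideAt l D s p) {r : ℕ} (hr : r ≤ l) :
    openFace D s r = openFace D s p ↔ p ≤ r ∧ r < nextPos l D s p := by
  have hlt := lt_nextPos (D := D) (s := s) hp
  have hsub := openFace_sub_one h0 hp h
  constructor
  · intro h1
    have h2 := openFace_le D s r
    refine ⟨by omega, ?_⟩
    by_contra h3
    rcases sideAt_nextPos (D := D) (s := s) hp with h4 | h4 | h4
    · omega
    · omega
    · have h5 := openFace_self h0 h4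
      have h6 := openFace_mono D s (not_lt.1 h3)
      omega
  · rintro ⟨h1, h2⟩
    induction r, h1 using Nat.le_induction with
    | base => rfl
    | succ r h3 ih =>
      rw [openFace_succ, ih (by omega) (by omega)]
      intro h4
      exact not_sideAt_of_lt_nextPos hp (by omega) h2 (Or.inr (Or.inr h4))

lemma openFace_pred_nextPos (h0 : D 0 = true) (hp : p ≤ l) (h : SideAt l D s p) :
    openFace D s (nextPos l D s p - 1) = openFace D s p := by
  have h1 := lt_nextPos (D := D) (s := s) hp
  have h2 := nextPos_le (D := D) (s := s) hp
  exact (openFace_eq_iff h0 hp h (by omega)).2 ⟨by omega, by omega⟩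

end Positions

/-! ### Face functions of a plane cubic graph -/

section Planar

/-- A binary digit as an element of `ZMod 2`. -/
def bit (b : Bool) : ZMod 2 := if b then 1 else 0

lemma bit_xor (a b : Bool) : bit (xor a b) = bit a + bit b := by revert a b; decide

lemma bit_injective : Function.Injective bit := by decide

lemma bit_surjective : Function.Surjective bit := by decide

namespace CubicPorts

variable {V : Type*} {G : SimpleGraph V} (P : CubicPorts G)

/-- Labels `c` of the corners of a plane embedding, in which the numbering at `v` is
counterclockwise or clockwise according to `o v`. -/
def IsPlane (c : V → ZMod 3 → ℕ) (o : V → Bool) : Prop :=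
  ∀ v i j, P.nb (P.nb v i) j = v → ∀ s : Bool, c v (i + sgn s) =
    c (P.nb v i) (j + sgn (xor (!s) (xor (o v) (o (P.nb v i)))))

/-- The equation along an edge for a function of the form `g (c v i) + a v`. -/
lemma isFaceFun_iff {c : V → ZMod 3 → ℕ} {o : V → Bool} (hc : P.IsPlane c o) (b : V → Bool)
    (t : G.edgeSet → Bool) (g : ℕ → ZMod 2) (a : V → ZMod 2) :
    P.IsFaceFun b t (fun v i => g (c v i) + a v) ↔ ∀ v i, a v + a (P.nb v i) =
      (g (c v (i + 1)) + g (c v (i - 1))) * (bit (xor (b v) (o v)) +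
        bit (xor (b (P.nb v i)) (o (P.nb v i))) +
        bit (t ⟨(P.dart v i).edge, (P.dart v i).edge_mem⟩)) := by
  have hs1 : sgn true = 1 := rfl
  have hs2 : sgn false = -1 := rfl
  have key : ∀ v i j, P.nb (P.nb v i) j = v → ((∀ s : Bool, g (c v (i + sgn s)) + a v
      = g (c (P.nb v i) (j + sgn (xor (!s) (xor (xor (b v) (b (P.nb v i)))
      (t ⟨(P.dart v i).edge, (P.dart v i).edge_mem⟩))))) + a (P.nb v i)) ↔ a v + a (P.nb v i) =
      (g (c v (i + 1)) + g (c v (i - 1))) * (bit (xor (b v) (o v)) +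
        bit (xor (b (P.nb v i)) (o (P.nb v i))) +
        bit (t ⟨(P.dart v i).edge, (P.dart v i).edge_mem⟩))) := by
    intro v i j hj
    have h1 := hc v i j hj
    generalize t ⟨(P.dart v i).edge, (P.dart v i).edge_mem⟩ = t'
    generalize b v = x
    generalize b (P.nb v i) = y
    have h2 : ∀ s : Bool, c (P.nb v i) (j + sgn (xor (!s) (xor (xor x y) t')))
        = c v (i + sgn (xor s (xor (xor (xor x y) t') (xor (o v) (o (P.nb v i)))))) := by
      intro s
      rw [h1]
      congr 3
      generalize o v = u
      generalize o (P.nb v i) = u'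
      clear h1
      revert s x y t' u u'
      decide
    simp only [h2]
    rw [← bit_xor, ← bit_xor]
    have h3 : xor (xor (xor x (o v)) (xor y (o (P.nb v i)))) t'
        = xor (xor (xor x y) t') (xor (o v) (o (P.nb v i))) := by
      generalize o v = u
      generalize o (P.nb v i) = u'
      clear h1 h2
      revert x y t' u u'
      decide
    rw [h3]
    generalize xor (xor (xor x y) t') (xor (o v) (o (P.nb v i))) = κ
    rw [Bool.forall_bool, hs1, hs2, ← sub_eq_add_neg]
    generalize a v = a₁
    generalize a (P.nb v i) = a₂
    cases κ <;>
    · simp only [Bool.xor_false, Bool.xor_true, Bool.not_true, Bool.not_false, hs1, hs2,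
        ← sub_eq_add_neg]
      generalize g (c v (i + 1)) = g₁
      generalize g (c v (i - 1)) = g₂
      clear h1 h2 h3
      revert a₁ a₂ g₁ g₂
      decide
  constructor
  · intro h v i
    obtain ⟨j, hj⟩ := P.exists_port v i
    exact (key v i j hj).1 (h v i j hj)
  · intro h v i j hj
    exact (key v i j hj).2 (h v i)

end CubicPorts

end Planar

/-! ### The ports of a Halin graph of a caterpillar -/

/-- The cycle through the leaves of a caterpillar whose pendant edges are directed by `D`. -/
def ringGraph (l : ℕ) (D : ℕ → Bool) : SimpleGraph (Vertex l) :=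
  SimpleGraph.fromRel fun a b =>
    IsLeaf a ∧ IsLeaf b ∧ position a < position b ∧
      ∃ s : Bool, SideAt l D s (position a) ∧ SideAt l D s (position b) ∧
        ∀ p : ℕ, position a < p → p < position b → ¬ SideAt l D s p

/-- The Halin graph of a caterpillar whose pendant edges are directed by `D`. -/
def ringHalin (l : ℕ) (D : ℕ → Bool) : SimpleGraph (Vertex l) := caterpillar l ⊔ ringGraph l D

/-- Both sides of the spine carry pendant edges; the directions at the ends are a convention. -/
structure TwoSided (l : ℕ) (D : ℕ → Bool) : Prop where
  zero : D 0 = true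
  last : D (l + 1) = false
  both : ∀ s, ∃ p, 1 ≤ p ∧ p ≤ l ∧ D p = s

/-- The vertex `v_p`. -/
def spineV (l p : ℕ) : Vertex l := Sum.inl ⟨min p (l + 1), by omega⟩

/-- The leaf at position `p`. -/
def leafV (l p : ℕ) : Vertex l :=
  if h : 1 ≤ p ∧ p ≤ l then Sum.inr ⟨p - 1, by omega⟩ else spineV l p

/-- Case distinction between inner vertices and leaves. -/
def byKind {l : ℕ} {α : Type*} (f g : ℕ → α) : Vertex l → α
  | Sum.inl i => if (i : ℕ) = 0 ∨ (i : ℕ) = l + 1 then g i else f i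
  | Sum.inr i => g ((i : ℕ) + 1)

section Kinds

variable {l p q : ℕ} {α : Type*} (f g : ℕ → α)

lemma byKind_spineV (h1 : 1 ≤ p) (h2 : p ≤ l) : byKind f g (spineV l p) = f p := by
  have : min p (l + 1) = p := by omega
  simp only [spineV, byKind, this]
  rw [if_neg (by omega)]

lemma byKind_leafV (h : p ≤ l + 1) : byKind f g (leafV l p) = g p := by
  rw [leafV]
  split_ifs with h1
  · simp only [byKind]
    rw [Nat.sub_add_cancel h1.1]
  · have : min p (l + 1) = p := by omega
    simp only [spineV, byKind, this]
    rw [if_pos (by omega)]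

lemma leafV_zero : leafV l 0 = spineV l 0 := rfl

lemma leafV_last : leafV l (l + 1) = spineV l (l + 1) := by
  rw [leafV, dif_neg (by omega)]

lemma vertex_cases (v : Vertex l) :
    (∃ p, 1 ≤ p ∧ p ≤ l ∧ v = spineV l p) ∨ ∃ p, p ≤ l + 1 ∧ v = leafV l p := by
  rcases v with i | i
  · by_cases h : (i : ℕ) = 0 ∨ (i : ℕ) = l + 1
    · refine Or.inr ⟨i, by omega, ?_⟩
      rw [leafV, dif_neg (by omega), spineV]
      congr 1
      ext
      simp only
      omega
    · have := i.2
      refine Or.inl ⟨i, by omega, by omega, ?_⟩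
      rw [spineV]
      congr 1
      ext
      simp only
      omega
  · refine Or.inr ⟨i + 1, by omega, ?_⟩
    rw [leafV, dif_pos (by omega)]
    rfl

lemma position_spineV (h : p ≤ l + 1) : position (spineV l p) = p := by
  simp only [spineV, position]
  omega

lemma position_leafV (h : p ≤ l + 1) : position (leafV l p) = p := by
  rw [leafV]
  split_ifs with h1
  · simp only [position]
    omega
  · exact position_spineV h

lemma spineV_inj (hp : p ≤ l + 1) (hq : q ≤ l + 1) : spineV l p = spineV l q ↔ p = q :=
  ⟨fun h => by rw [← position_spineV hp, h, position_spineV hq], fun h => by rw [h]⟩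

lemma leafV_inj (hp : p ≤ l + 1) (hq : q ≤ l + 1) : leafV l p = leafV l q ↔ p = q :=
  ⟨fun h => by rw [← position_leafV hp, h, position_leafV hq], fun h => by rw [h]⟩

lemma spineV_ne_leafV (h1 : 1 ≤ p) (h2 : p ≤ l) (hq : q ≤ l + 1) : spineV l p ≠ leafV l q := by
  intro h
  have := congrArg (byKind (fun _ => true) (fun _ => false)) h
  rw [byKind_spineV _ _ h1 h2, byKind_leafV _ _ hq] at this
  exact absurd this (by decide)

/-- Spine positions as vertices: a leaf has a given position exactly at the ends. -/
lemma spineV_eq_leafV_iff (hp : p ≤ l + 1) (hq : q ≤ l + 1) :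
    spineV l p = leafV l q ↔ p = q ∧ (p = 0 ∨ p = l + 1) := by
  constructor
  · intro h
    have h1 : p = q := by rw [← position_spineV hp, h, position_leafV hq]
    refine ⟨h1, ?_⟩
    by_contra h2
    exact spineV_ne_leafV (by omega) (by omega) hq h
  · rintro ⟨rfl, rfl | rfl⟩
    · rfl
    · rw [leafV_last]

lemma isLeaf_leafV : IsLeaf (leafV l p) := by
  rw [leafV]
  split_ifs with h
  · trivial
  · simp only [spineV, IsLeaf]
    omega

lemma eq_leafV_of_isLeaf {v : Vertex l} (h : IsLeaf v) : v = leafV l (position v) := by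
  rcases vertex_cases v with ⟨p, h1, h2, rfl⟩ | ⟨p, h1, rfl⟩
  · simp only [spineV, IsLeaf] at h
    omega
  · rw [position_leafV h1]

lemma position_le (v : Vertex l) : position v ≤ l + 1 := by
  rcases v with i | i
  · exact Nat.lt_succ_iff.1 i.2
  · exact Nat.succ_le_succ i.2.le

lemma caterpillar_adj_spineV (h : p ≤ l) : (caterpillar l).Adj (spineV l p) (spineV l (p + 1)) := by
  rw [caterpillar, SimpleGraph.fromRel_adj]
  refine ⟨fun h1 => ?_, Or.inl ?_⟩
  · rw [spineV_inj (by omega) (by omega)] at h1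
    omega
  · simp only [spineV]
    omega

lemma caterpillar_adj_leafV (h1 : 1 ≤ p) (h2 : p ≤ l) :
    (caterpillar l).Adj (spineV l p) (leafV l p) := by
  rw [caterpillar, SimpleGraph.fromRel_adj]
  refine ⟨spineV_ne_leafV h1 h2 (by omega), Or.inl ?_⟩
  rw [leafV, dif_pos ⟨h1, h2⟩]
  simp only [spineV]
  omega

lemma not_caterpillar_adj (hl : 1 ≤ l) : ¬ (caterpillar l).Adj (leafV l p) (leafV l q) := by
  have key : ∀ a b : Vertex l, IsLeaf a → IsLeaf b → ¬ (match a, b with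
    | Sum.inl i, Sum.inl j => (j : ℕ) = (i : ℕ) + 1
    | Sum.inl i, Sum.inr j => (i : ℕ) = (j : ℕ) + 1
    | _, _ => False) := by
    rintro (i | i) (j | j) ha hb h
    · simp only [IsLeaf] at *
      omega
    · simp only [IsLeaf] at *
      have := j.2
      omega
    · exact h
    · exact h
  rw [caterpillar, SimpleGraph.fromRel_adj]
  rintro ⟨-, h | h⟩
  · exact key _ _ isLeaf_leafV isLeaf_leafV h
  · exact key _ _ isLeaf_leafV isLeaf_leafV h

end Kinds

/-- The edges with the numbers of their two ends. -/
inductive Link (l : ℕ) (D : ℕ → Bool) : Vertex l → ZMod 3 → Vertex l → ZMod 3 → Prop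
  -- At inner vertices 0 is left, 1 is right and 2 is the pendant edge. At leaves 2 is the tree
  -- edge, and 0 and 1 lead to the previous and the next leaf on its side. At the two end leaves 0
  -- is the lower and 1 the upper edge of the leaf cycle.
  | spine (p : ℕ) (hp : p ≤ l) : Link l D (spineV l p) (if p = 0 then 2 else 1)
      (spineV l (p + 1)) (if p = l then 2 else 0)
  | pendant (p : ℕ) (h1 : 1 ≤ p) (hp : p ≤ l) : Link l D (spineV l p) 2 (leafV l p) 2
  | ring (p : ℕ) (s : Bool) (hp : p ≤ l) (hs : SideAt l D s p) :
      Link l D (leafV l p) (if p = 0 ∧ s = false then 0 else 1) (leafV l (nextPos l D s p))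
        (if nextPos l D s p = l + 1 ∧ s = true then 1 else 0)

/-- The neighbours of an inner vertex. -/
def spineNb (l p : ℕ) (i : ZMod 3) : Vertex l :=
  if i = 0 then spineV l (p - 1) else if i = 1 then spineV l (p + 1) else leafV l p

/-- The neighbours of a leaf. -/
def leafNb (l : ℕ) (D : ℕ → Bool) (p : ℕ) (i : ZMod 3) : Vertex l :=
  if i = 0 then leafV l (if p = 0 then nextPos l D false 0 else prevPos l D (D p) p)
  else if i = 1 then leafV l (if p = l + 1 then prevPos l D true p else nextPos l D (D p) p)
  else spineV l (if p = 0 then 1 else if p = l + 1 then l else p)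

/-- The neighbours of a vertex. -/
def ringNb (l : ℕ) (D : ℕ → Bool) (v : Vertex l) (i : ZMod 3) : Vertex l :=
  byKind (spineNb l) (leafNb l D) v i

section Ports

variable {l : ℕ} {D : ℕ → Bool}

lemma TwoSided.one_le (h : TwoSided l D) : 1 ≤ l := by
  obtain ⟨p, h1, h2, -⟩ := h.both true
  omega

lemma TwoSided.nextPos_zero_le (h : TwoSided l D) (s : Bool) : nextPos l D s 0 ≤ l := by
  obtain ⟨p, h1, h2, h3⟩ := h.both s
  by_contra h4
  exact not_sideAt_of_lt_nextPos (Nat.zero_le l) (show 0 < p by omega) (by omega)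
    (Or.inr (Or.inr h3))

lemma TwoSided.one_le_prevPos (h : TwoSided l D) (s : Bool) : 1 ≤ prevPos l D s (l + 1) := by
  obtain ⟨p, h1, h2, h3⟩ := h.both s
  by_contra h4
  exact not_sideAt_of_prevPos_lt (show prevPos l D s (l + 1) < p by omega) (by omega)
    (Or.inr (Or.inr h3))

lemma TwoSided.nextPos_zero (h : TwoSided l D) (s : Bool) : D (nextPos l D s 0) = s := by
  have h1 := h.nextPos_zero_le s
  have h2 := lt_nextPos (D := D) (s := s) (Nat.zero_le l)
  rcases sideAt_nextPos (D := D) (s := s) (Nat.zero_le l) with h3 | h3 | h3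
  · omega
  · omega
  · exact h3

lemma TwoSided.prevPos_last (h : TwoSided l D) (s : Bool) : D (prevPos l D s (l + 1)) = s := by
  have h1 := h.one_le_prevPos s
  have h2 := prevPos_lt (l := l) (D := D) (s := s) (show 1 ≤ l + 1 by omega)
  rcases sideAt_prevPos (l := l) (D := D) (s := s) (p := l + 1) with h3 | h3 | h3
  · omega
  · omega
  · exact h3

lemma two_ne_zero' : (2 : ZMod 3) ≠ 0 := by decide
lemma two_ne_one' : (2 : ZMod 3) ≠ 1 := by decide

lemma zmod_three_cases (i : ZMod 3) : i = 0 ∨ i = 1 ∨ i = 2 := by revert i; decide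

/-- The linked ends are neighbours. -/
lemma Link.nb_eq (hD : TwoSided l D) {v w : Vertex l} {i j : ZMod 3} (h : Link l D v i w j) :
    ringNb l D v i = w ∧ ringNb l D w j = v := by
  have hl := hD.one_le
  have h20 := two_ne_zero'
  have h21 := two_ne_one'
  rcases h with ⟨p, hp⟩ | ⟨p, h1, hp⟩ | ⟨p, s, hp, hs⟩
  · constructor
    · by_cases h0 : p = 0
      · subst h0
        rw [← leafV_zero, ringNb, byKind_leafV _ _ (by omega), leafNb]
        simp [h20, h21]
      · rw [ringNb, byKind_spineV _ _ (by omega) hp, spineNb]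
        simp [h0]
    · by_cases h0 : p = l
      · subst h0
        rw [← leafV_last, ringNb, byKind_leafV _ _ (by omega), leafNb]
        simp [h20, h21]
      · rw [ringNb, byKind_spineV _ _ (by omega) (by omega), spineNb]
        simp [h0]
  · constructor
    · rw [ringNb, byKind_spineV _ _ (by omega) hp, spineNb]
      simp [h20, h21]
    · rw [ringNb, byKind_leafV _ _ (by omega), leafNb]
      simp only [h20, h21, if_false]
      rw [if_neg (by omega), if_neg (by omega)]
  · have hlt := lt_nextPos (D := D) (s := s) hp
    have hle := nextPos_le (D := D) (s := s) hp
    have hprev := prevPos_nextPos hp hs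
    constructor
    · rw [ringNb, byKind_leafV _ _ (by omega), leafNb]
      by_cases h0 : p = 0 ∧ s = false
      · obtain ⟨rfl, rfl⟩ := h0
        simp
      · rw [if_neg h0]
        have h1 : p ≠ l + 1 := by omega
        simp only [one_ne_zero, if_false, if_true, h1]
        have : D p = s := by
          rcases hs with h2 | h2 | h2
          · subst h2
            rw [hD.zero]
            cases s <;> simp_all
          · omega
          · exact h2
        rw [this]
    · rw [ringNb, byKind_leafV _ _ hle, leafNb]
      by_cases h0 : nextPos l D s p = l + 1 ∧ s = true
      · rw [if_pos h0]
        simp only [one_ne_zero, if_false, if_true, h0.1]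
        rw [← h0.1, ← h0.2, hprev]
      · rw [if_neg h0, if_pos rfl, if_neg (by omega)]
        have : D (nextPos l D s p) = s := by
          rcases sideAt_nextPos (D := D) (s := s) hp with h2 | h2 | h2
          · omega
          · rw [h2, hD.last]
            cases s <;> simp_all
          · exact h2
        rw [this, hprev]

/-- Every end of an edge is an end of a link. -/
lemma exists_link (hD : TwoSided l D) (v : Vertex l) (i : ZMod 3) :
    ∃ w j, Link l D v i w j ∨ Link l D w j v i := by
  have hl := hD.one_le
  rcases vertex_cases v with ⟨p, h1, h2, rfl⟩ | ⟨p, h1, rfl⟩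
  · rcases zmod_three_cases i with rfl | rfl | rfl
    · have := Link.spine (D := D) (p - 1) (show p - 1 ≤ l by omega)
      rw [Nat.sub_add_cancel h1, if_neg (show p - 1 ≠ l by omega)] at this
      exact ⟨_, _, Or.inr this⟩
    · have := Link.spine (D := D) p h2
      rw [if_neg (show p ≠ 0 by omega)] at this
      exact ⟨_, _, Or.inl this⟩
    · exact ⟨_, _, Or.inl (Link.pendant p h1 h2)⟩
  · rcases zmod_three_cases i with rfl | rfl | rfl
    · by_cases h0 : p = 0
      · subst h0
        have := Link.ring (D := D) 0 false (Nat.zero_le l) (Or.inl rfl)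
        simp only [and_self, if_true] at this
        exact ⟨_, _, Or.inl this⟩
      · have hs : SideAt l D (D p) p := sideAt_self l D p
        have h2 := prevPos_lt (l := l) (D := D) (s := D p) (show 1 ≤ p by omega)
        have := Link.ring (D := D) (prevPos l D (D p) p) (D p) (by omega) sideAt_prevPos
        rw [nextPos_prevPos (by omega) h1 hs, if_neg (c := p = l + 1 ∧ _)] at this
        · exact ⟨_, _, Or.inr this⟩
        · rintro ⟨rfl, h3⟩
          rw [hD.last] at h3
          exact absurd h3 (by decide)
    · by_cases h0 : p = l + 1
      · subst h0
        have h2 := prevPos_lt (l := l) (D := D) (s := true) (show 1 ≤ l + 1 by omega)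
        have := Link.ring (D := D) (prevPos l D true (l + 1)) true (by omega) sideAt_prevPos
        rw [nextPos_prevPos (by omega) h1 (Or.inr (Or.inl rfl)),
          if_pos (show l + 1 = l + 1 ∧ true = true from ⟨rfl, rfl⟩)] at this
        exact ⟨_, _, Or.inr this⟩
      · have := Link.ring (D := D) p (D p) (by omega) (sideAt_self l D p)
        rw [if_neg (c := p = 0 ∧ _)] at this
        · exact ⟨_, _, Or.inl this⟩
        · rintro ⟨rfl, h3⟩
          rw [hD.zero] at h3
          exact absurd h3 (by decide)
    · by_cases h0 : p = 0
      · subst h0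
        exact ⟨_, _, Or.inl (Link.spine 0 (Nat.zero_le l))⟩
      · by_cases h3 : p = l + 1
        · subst h3
          have := Link.spine (D := D) l le_rfl
          rw [if_pos rfl, ← leafV_last] at this
          exact ⟨_, _, Or.inr this⟩
        · exact ⟨_, _, Or.inr (Link.pendant p (by omega) (by omega))⟩

lemma Link.adj {v w : Vertex l} {i j : ZMod 3} (h : Link l D v i w j) :
    (ringHalin l D).Adj v w := by
  rcases h with ⟨p, hp⟩ | ⟨p, h1, hp⟩ | ⟨p, s, hp, hs⟩
  · exact Or.inl (caterpillar_adj_spineV hp)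
  · exact Or.inl (caterpillar_adj_leafV h1 hp)
  · refine Or.inr ?_
    have h1 := lt_nextPos (D := D) (s := s) hp
    have h2 := nextPos_le (D := D) (s := s) hp
    rw [ringGraph, SimpleGraph.fromRel_adj, position_leafV (by omega), position_leafV h2]
    refine ⟨fun h => ?_, Or.inl ⟨isLeaf_leafV, isLeaf_leafV, h1, s, hs, sideAt_nextPos hp,
      fun q h3 h4 => not_sideAt_of_lt_nextPos hp h3 h4⟩⟩
    rw [leafV_inj (by omega) h2] at h
    omega

lemma exists_link_of_adj {v w : Vertex l} (h : (ringHalin l D).Adj v w) :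
    ∃ i j, Link l D v i w j ∨ Link l D w j v i := by
  have hspine : ∀ (i : Fin (l + 2)), (Sum.inl i : Vertex l) = spineV l i := by
    intro i
    rw [spineV]
    congr 1
    ext
    simp only
    omega
  have hcat : ∀ a b : Vertex l, (match a, b with
      | Sum.inl i, Sum.inl j => (j : ℕ) = (i : ℕ) + 1
      | Sum.inl i, Sum.inr j => (i : ℕ) = (j : ℕ) + 1
      | _, _ => False) → ∃ i j, Link l D a i b j := by
    rintro (i | i) (j | j) h
    · have := j.2
      simp only at h
      rw [hspine i, hspine j, h]
      exact ⟨_, _, Link.spine i (by omega)⟩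
    · have := j.2
      have h1 : (Sum.inr j : Vertex l) = leafV l (j + 1) := by
        rw [leafV, dif_pos (by omega)]
        rfl
      simp only at h
      rw [hspine i, h1, h]
      exact ⟨_, _, Link.pendant (j + 1) (by omega) (by omega)⟩
    · exact absurd h id
    · exact absurd h id
  have hring : ∀ a b : Vertex l, (IsLeaf a ∧ IsLeaf b ∧ position a < position b ∧
      ∃ s : Bool, SideAt l D s (position a) ∧ SideAt l D s (position b) ∧
        ∀ p : ℕ, position a < p → p < position b → ¬ SideAt l D s p) → ∃ i j, Link l D a i b j := by
    rintro a b ⟨ha, hb, hlt, s, h1, h2, h3⟩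
    have hle := position_le b
    have h4 := nextPos_eq (D := D) (by omega) hlt h2 h3
    have := Link.ring (D := D) (position a) s (by omega) h1
    rw [h4, ← eq_leafV_of_isLeaf ha, ← eq_leafV_of_isLeaf hb] at this
    exact ⟨_, _, this⟩
  rcases h with h | h
  · rw [caterpillar, SimpleGraph.fromRel_adj] at h
    rcases h.2 with h1 | h1
    · obtain ⟨i, j, h2⟩ := hcat v w h1
      exact ⟨i, j, Or.inl h2⟩
    · obtain ⟨i, j, h2⟩ := hcat w v h1
      exact ⟨j, i, Or.inr h2⟩
  · rw [ringGraph, SimpleGraph.fromRel_adj] at h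
    rcases h.2 with h1 | h1
    · obtain ⟨i, j, h2⟩ := hring v w h1
      exact ⟨i, j, Or.inl h2⟩
    · obtain ⟨i, j, h2⟩ := hring w v h1
      exact ⟨j, i, Or.inr h2⟩

/-- Pendant edges on both sides are needed here: otherwise an end leaf could have the same neighbour
above and below, and the graph would not be cubic. -/
lemma ringNb_injective (hD : TwoSided l D) (v : Vertex l) : Function.Injective (ringNb l D v) := by
  have hl := hD.one_le
  have hinj : ∀ f : ZMod 3 → Vertex l, f 0 ≠ f 1 → f 0 ≠ f 2 → f 1 ≠ f 2 →
      Function.Injective f := by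
    intro f h1 h2 h3 i j h
    rcases zmod_three_cases i with rfl | rfl | rfl <;>
    rcases zmod_three_cases j with rfl | rfl | rfl <;> first | rfl | exact absurd h (by tauto)
  have h20 := two_ne_zero'
  have h21 := two_ne_one'
  have h10 : (1 : ZMod 3) ≠ 0 := one_ne_zero
  rcases vertex_cases v with ⟨p, h1, h2, rfl⟩ | ⟨p, h1, rfl⟩
  · refine hinj _ ?_ ?_ ?_ <;>
    · simp only [ringNb, byKind_spineV _ _ h1 h2, spineNb, if_true, h20, h21, h10, if_false]
      first
      | rw [ne_eq, spineV_inj (by omega) (by omega)]; omega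
      | rw [ne_eq, spineV_eq_leafV_iff (by omega) (by omega)]; omega
  · have hz := hD.nextPos_zero_le false
    have hz' := hD.nextPos_zero_le true
    have hp' := hD.one_le_prevPos true
    have hp := hD.one_le_prevPos false
    have hlt : prevPos l D true (l + 1) < l + 1 := prevPos_lt (by omega)
    have hlt' : prevPos l D false (l + 1) < l + 1 := prevPos_lt (by omega)
    have hpos : ∀ s, 0 < nextPos l D s 0 := fun s => lt_nextPos (Nat.zero_le l)
    have hpos1 := hpos true
    have hpos2 := hpos false
    have e0 : ∀ p, leafNb l D p 0
        = leafV l (if p = 0 then nextPos l D false 0 else prevPos l D (D p) p) := fun p => rfl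
    have e1 : ∀ p, leafNb l D p 1
        = leafV l (if p = l + 1 then prevPos l D true p else nextPos l D (D p) p) := fun p => rfl
    have e2 : ∀ p, leafNb l D p 2
        = spineV l (if p = 0 then 1 else if p = l + 1 then l else p) := fun p => rfl
    have hrange : (1 ≤ if p = 0 then 1 else if p = l + 1 then l else p) ∧
        (if p = 0 then 1 else if p = l + 1 then l else p) ≤ l := by
      split_ifs <;> omega
    have hb0 : (if p = 0 then nextPos l D false 0 else prevPos l D (D p) p) ≤ l + 1 := by
      split_ifs with h
      · omega
      · have := prevPos_lt (l := l) (D := D) (s := D p) (show 1 ≤ p by omega)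
        omega
    have hb1 : (if p = l + 1 then prevPos l D true p else nextPos l D (D p) p) ≤ l + 1 := by
      split_ifs with h
      · rw [h]; omega
      · exact nextPos_le (by omega)
    have hfun : ringNb l D (leafV l p) = leafNb l D p := by
      funext i
      rw [ringNb, byKind_leafV _ _ h1]
    rw [hfun]
    refine hinj _ ?_ ?_ ?_
    · rw [e0, e1, ne_eq, leafV_inj hb0 hb1]
      by_cases h3 : p = 0
      · rw [if_pos h3, if_neg (by omega), h3, hD.zero]
        intro h4
        have h5 := hD.nextPos_zero false
        rw [h4, hD.nextPos_zero true] at h5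
        exact absurd h5 (by decide)
      · rw [if_neg h3]
        have h6 := prevPos_lt (l := l) (D := D) (s := D p) (show 1 ≤ p by omega)
        by_cases h4 : p = l + 1
        · rw [if_pos h4, h4, hD.last]
          intro h4
          have h5 := hD.prevPos_last false
          rw [h4, hD.prevPos_last true] at h5
          exact absurd h5 (by decide)
        · rw [if_neg h4]
          have := lt_nextPos (D := D) (s := D p) (show p ≤ l by omega)
          omega
    · rw [e0, e2]
      exact (spineV_ne_leafV hrange.1 hrange.2 hb0).symm
    · rw [e1, e2]
      exact (spineV_ne_leafV hrange.1 hrange.2 hb1).symm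

/-- The numbering of the neighbours in the Halin graph. -/
def ringPorts (hD : TwoSided l D) : CubicPorts (ringHalin l D) where
  nb := ringNb l D
  inj := ringNb_injective hD
  adj v w := by
    constructor
    · intro h
      obtain ⟨i, j, h | h⟩ := exists_link_of_adj h
      · exact ⟨i, (h.nb_eq hD).1⟩
      · exact ⟨i, (h.nb_eq hD).2⟩
    · rintro ⟨i, rfl⟩
      obtain ⟨w, j, h | h⟩ := exists_link hD v i
      · rw [(h.nb_eq hD).1]
        exact h.adj
      · rw [(h.nb_eq hD).2]
        exact h.adj.symm

end Ports

/-! ### The faces of the plane Halin graph -/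

/-- The labels of the corners at an inner vertex. -/
def spineFace (D : ℕ → Bool) (p : ℕ) (i : ZMod 3) : ℕ :=
  if i = 0 then openFace D (D p) p else if i = 1 then openFace D (D p) (p - 1)
  else openFace D (!D p) p

/-- The labels of the corners at a leaf; the outer face has the label `l + 2`. -/
def leafFace (l : ℕ) (D : ℕ → Bool) (p : ℕ) (i : ZMod 3) : ℕ :=
  if i = 0 then (if p = l + 1 then openFace D true l else openFace D (D p) p)
  else if i = 1 then (if p = 0 then openFace D false 0 else openFace D (D p) (p - 1))
  else l + 2

/-- The labels of the corners. -/
def ringFace (l : ℕ) (D : ℕ → Bool) (v : Vertex l) (i : ZMod 3) : ℕ :=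
  byKind (spineFace D) (leafFace l D) v i

/-- The orientation of the numbering of the neighbours. -/
def ringOri (l : ℕ) (D : ℕ → Bool) (v : Vertex l) : Bool := byKind D (fun p => !D p) v

section Faces

variable {l p : ℕ} {D : ℕ → Bool}

lemma spineFace_zero (D : ℕ → Bool) (p : ℕ) : spineFace D p 0 = openFace D (D p) p := rfl
lemma spineFace_one (D : ℕ → Bool) (p : ℕ) : spineFace D p 1 = openFace D (D p) (p - 1) := rfl
lemma spineFace_two (D : ℕ → Bool) (p : ℕ) : spineFace D p 2 = openFace D (!D p) p := rfl
lemma leafFace_zero (l : ℕ) (D : ℕ → Bool) (p : ℕ) : leafFace l D p 0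
    = if p = l + 1 then openFace D true l else openFace D (D p) p := rfl
lemma leafFace_one (l : ℕ) (D : ℕ → Bool) (p : ℕ) : leafFace l D p 1
    = if p = 0 then openFace D false 0 else openFace D (D p) (p - 1) := rfl
lemma leafFace_two (l : ℕ) (D : ℕ → Bool) (p : ℕ) : leafFace l D p 2 = l + 2 := rfl

lemma sgn_true : sgn true = 1 := rfl
lemma sgn_false : sgn false = -1 := rfl
lemma zmod_zero_sub : (0 : ZMod 3) + -1 = 2 := rfl
lemma zmod_one_sub : (1 : ZMod 3) + -1 = 0 := rfl
lemma zmod_two_sub : (2 : ZMod 3) + -1 = 1 := rfl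
lemma zmod_zero_add : (0 : ZMod 3) + 1 = 1 := rfl
lemma zmod_one_add : (1 : ZMod 3) + 1 = 2 := rfl
lemma zmod_two_add : (2 : ZMod 3) + 1 = 0 := rfl

lemma ringFace_leafV (hp : p ≤ l + 1) (i : ZMod 3) :
    ringFace l D (leafV l p) i = leafFace l D p i := by rw [ringFace, byKind_leafV _ _ hp]

lemma ringFace_spineV (h1 : 1 ≤ p) (hp : p ≤ l) (i : ZMod 3) :
    ringFace l D (spineV l p) i = spineFace D p i := by rw [ringFace, byKind_spineV _ _ h1 hp]

lemma ringOri_leafV (hp : p ≤ l + 1) : ringOri l D (leafV l p) = !D p := by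
  rw [ringOri, byKind_leafV _ _ hp]

lemma ringOri_spineV (h1 : 1 ≤ p) (hp : p ≤ l) : ringOri l D (spineV l p) = D p := by
  rw [ringOri, byKind_spineV _ _ h1 hp]

/-- Adding the orientation bit undoes the choice between clockwise and counterclockwise numbering,
so the two corners along the edge are named by the side of the spine on which they lie. The end v_0
is treated apart because it is numbered as a leaf. -/
lemma ringFace_spine_left (hD : TwoSided l D) (hp : p ≤ l) (s : Bool) :
    ringFace l D (spineV l p) ((if p = 0 then 2 else 1) + sgn s)
      = openFace D (xor s (ringOri l D (spineV l p))) p := by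
  by_cases h0 : p = 0
  · subst h0
    rw [← leafV_zero, ringFace_leafV (by omega), ringOri_leafV (by omega), if_pos rfl, hD.zero]
    cases s
    · rw [sgn_false, zmod_two_sub, leafFace_one, if_pos rfl]; rfl
    · rw [sgn_true, zmod_two_add, leafFace_zero, if_neg (by omega), hD.zero]; rfl
  · rw [ringFace_spineV (by omega) hp, ringOri_spineV (by omega) hp, if_neg h0]
    cases s
    · rw [sgn_false, zmod_one_sub, spineFace_zero, Bool.false_xor]
    · rw [sgn_true, zmod_one_add, spineFace_two, Bool.true_xor]

lemma ringFace_spine_right (hD : TwoSided l D) (hp : p ≤ l) (s : Bool) :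
    ringFace l D (spineV l (p + 1)) ((if p = l then 2 else 0) + sgn s)
      = openFace D (!(xor s (ringOri l D (spineV l (p + 1))))) p := by
  by_cases h0 : p = l
  · subst h0
    rw [← leafV_last, ringFace_leafV le_rfl, ringOri_leafV le_rfl, if_pos rfl, hD.last]
    cases s
    · rw [sgn_false, zmod_two_sub, leafFace_one, if_neg (by omega), hD.last]; rfl
    · rw [sgn_true, zmod_two_add, leafFace_zero, if_pos rfl]; rfl
  · rw [ringFace_spineV (by omega) (by omega), ringOri_spineV (by omega) (by omega), if_neg h0]
    cases s
    · rw [sgn_false, zmod_zero_sub, spineFace_two, Bool.false_xor]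
      exact openFace_succ (by cases D (p + 1) <;> simp)
    · rw [sgn_true, zmod_zero_add, spineFace_one, Bool.true_xor, Bool.not_not, Nat.add_sub_cancel]

lemma ringFace_pendant_spine (h1 : 1 ≤ p) (hp : p ≤ l) (s : Bool) :
    ringFace l D (spineV l p) (2 + sgn s) = openFace D (D p) (if s then p else p - 1) := by
  rw [ringFace_spineV h1 hp]
  cases s
  · rw [sgn_false, zmod_two_sub, spineFace_one]; rfl
  · rw [sgn_true, zmod_two_add, spineFace_zero]; rfl

lemma ringFace_pendant_leaf (h1 : 1 ≤ p) (hp : p ≤ l) (s : Bool) :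
    ringFace l D (leafV l p) (2 + sgn s) = openFace D (D p) (if s then p else p - 1) := by
  rw [ringFace_leafV (by omega)]
  cases s
  · rw [sgn_false, zmod_two_sub, leafFace_one, if_neg (by omega)]; rfl
  · rw [sgn_true, zmod_two_add, leafFace_zero, if_neg (by omega)]; rfl

lemma ringFace_ring_left (hD : TwoSided l D) {s : Bool} (hp : p ≤ l) (hs : SideAt l D s p)
    (c : Bool) : ringFace l D (leafV l p) ((if p = 0 ∧ s = false then 0 else 1) + sgn c)
      = if xor (xor c (ringOri l D (leafV l p))) s then openFace D s p else l + 2 := by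
  rw [ringFace_leafV (by omega), ringOri_leafV (by omega)]
  by_cases h0 : p = 0 ∧ s = false
  · obtain ⟨rfl, rfl⟩ := h0
    rw [if_pos ⟨rfl, rfl⟩, hD.zero]
    cases c
    · rw [sgn_false, zmod_zero_sub, leafFace_two]; rfl
    · rw [sgn_true, zmod_zero_add, leafFace_one]; rfl
  · have h1 : D p = s := by
      rcases hs with h2 | h2 | h2
      · subst h2
        rw [hD.zero]
        cases s <;> simp_all
      · omega
      · exact h2
    rw [if_neg h0, ← h1]
    cases c
    · rw [sgn_false, zmod_one_sub, leafFace_zero, if_neg (by omega), if_pos]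
      cases D p <;> rfl
    · rw [sgn_true, zmod_one_add, leafFace_two, if_neg]
      cases D p <;> decide

lemma ringFace_ring_right (hD : TwoSided l D) {s : Bool} (hp : p ≤ l) (hs : SideAt l D s p)
    (c : Bool) : ringFace l D (leafV l (nextPos l D s p))
      ((if nextPos l D s p = l + 1 ∧ s = true then 1 else 0) + sgn c)
      = if !(xor (xor c (ringOri l D (leafV l (nextPos l D s p)))) s) then openFace D s p
        else l + 2 := by
  have hlt := lt_nextPos (D := D) (s := s) hp
  have hle := nextPos_le (D := D) (s := s) hp
  have hpred := openFace_pred_nextPos hD.zero hp hs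
  rw [ringFace_leafV hle, ringOri_leafV hle]
  by_cases h0 : nextPos l D s p = l + 1 ∧ s = true
  · rw [if_pos h0, h0.1, hD.last, h0.2]
    rw [h0.1, h0.2] at hpred
    cases c
    · rw [sgn_false, zmod_one_sub, leafFace_zero, if_pos rfl]; exact hpred
    · rw [sgn_true, zmod_one_add, leafFace_two]; rfl
  · have h1 : D (nextPos l D s p) = s := by
      rcases sideAt_nextPos (D := D) (s := s) hp with h2 | h2 | h2
      · omega
      · rw [h2, hD.last]
        cases s <;> simp_all
      · exact h2
    rw [if_neg h0, h1]
    cases c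
    · rw [sgn_false, zmod_zero_sub, leafFace_two, if_neg]
      cases s <;> decide
    · rw [sgn_true, zmod_zero_add, leafFace_one, if_neg (by omega), h1, hpred, if_pos]
      cases s <;> rfl

/-- The two faces along a link. -/
lemma Link.exists_faces (hD : TwoSided l D) {v w : Vertex l} {i j : ZMod 3} (h : Link l D v i w j) :
    ∃ A : Bool → ℕ, (∀ s, ringFace l D v (i + sgn s) = A (xor s (ringOri l D v))) ∧
      ∀ s, ringFace l D w (j + sgn s) = A (!(xor s (ringOri l D w))) := by
  rcases h with ⟨p, hp⟩ | ⟨p, h1, hp⟩ | ⟨p, s, hp, hs⟩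
  · exact ⟨fun c => openFace D c p, ringFace_spine_left hD hp, ringFace_spine_right hD hp⟩
  · refine ⟨fun c => openFace D (D p) (if xor c (D p) then p else p - 1), fun c => ?_, fun c => ?_⟩
    · rw [ringFace_pendant_spine h1 hp, ringOri_spineV h1 hp]
      congr 2
      cases c <;> cases D p <;> rfl
    · rw [ringFace_pendant_leaf h1 hp, ringOri_leafV (by omega)]
      congr 2
      cases c <;> cases D p <;> rfl
  · refine ⟨fun c => if xor c s then openFace D s p else l + 2, ringFace_ring_left hD hp hs,
      fun c => ?_⟩
    rw [ringFace_ring_right hD hp hs]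
    congr 2
    generalize ringOri l D _ = o
    cases c <;> cases o <;> cases s <;> rfl

/-- Along each edge both ends see the same two faces, and after correction by orientation they see
them in opposite order. -/
lemma isPlane (hD : TwoSided l D) : (ringPorts hD).IsPlane (ringFace l D) (ringOri l D) := by
  intro v i j hj s
  change ringNb l D (ringNb l D v i) j = v at hj
  change _ = ringFace l D (ringNb l D v i) (j + sgn (xor (!s) (xor (ringOri l D v)
    (ringOri l D (ringNb l D v i)))))
  obtain ⟨w, j', h | h⟩ := exists_link hD v i
  · obtain ⟨h1, h2⟩ := h.nb_eq hD
    subst h1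
    obtain rfl : j = j' := ringNb_injective hD _ (hj.trans h2.symm)
    obtain ⟨A, hA, hA'⟩ := h.exists_faces hD
    rw [hA, hA']
    congr 1
    generalize ringOri l D _ = o
    generalize ringOri l D _ = o'
    clear hA hA' h h2 hj
    revert s o o'
    decide
  · obtain ⟨h1, h2⟩ := h.nb_eq hD
    subst h2
    obtain rfl : j = j' := ringNb_injective hD _ (hj.trans h1.symm)
    obtain ⟨A, hA, hA'⟩ := h.exists_faces hD
    rw [hA, hA']
    congr 1
    generalize ringOri l D _ = o
    generalize ringOri l D _ = o'
    clear hA hA' h h1 hj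
    revert s o o'
    decide

/-! ### The co-tree edges -/

/-- The edge of the leaf cycle on the boundary of a face. -/
def ringEdge (l : ℕ) (D : ℕ → Bool) (n : Fin (l + 2)) : (ringHalin l D).edgeSet :=
  ⟨s(leafV l (n - 1), leafV l (nextPos l D (faceSide D n) (n - 1))),
    (Link.ring (D := D) ((n : ℕ) - 1) (faceSide D n) (by omega) (sideAt_faceSide D l n)).adj⟩

lemma ringEdge_openFace (hD : TwoSided l D) {s : Bool} (hp : p ≤ l) (hs : SideAt l D s p)
    (h : openFace D s p < l + 2) :
    (ringEdge l D ⟨openFace D s p, h⟩ : Sym2 (Vertex l))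
      = s(leafV l p, leafV l (nextPos l D s p)) := by
  simp only [ringEdge]
  rw [openFace_sub_one hD.zero hp hs, faceSide_openFace hD.zero]

/-- The left end of the edge is the position n - 1, so only the labels 0 and 1 could collide. Their
right ends lie on different sides of the spine. -/
lemma ringEdge_injective (hD : TwoSided l D) : Function.Injective (ringEdge l D) := by
  intro n n' h
  have h := congrArg Subtype.val h
  simp only [ringEdge, Sym2.eq_iff] at h
  have hb : ∀ n : Fin (l + 2), (n : ℕ) - 1 ≤ l := fun n => by omega
  have hlt := fun n : Fin (l + 2) => lt_nextPos (D := D) (s := faceSide D n) (hb n)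
  have hle := fun n : Fin (l + 2) => nextPos_le (D := D) (s := faceSide D n) (hb n)
  have h1 := hlt n
  have h2 := hlt n'
  have h3 := hle n
  have h4 := hle n'
  have h5 := hb n
  have h6 := hb n'
  rw [leafV_inj (by omega) (by omega), leafV_inj (by omega) (by omega),
    leafV_inj (by omega) (by omega), leafV_inj (by omega) (by omega)] at h
  have h7 : (n : ℕ) - 1 = n' - 1 := by omega
  have h8 : nextPos l D (faceSide D n) (n - 1) = nextPos l D (faceSide D n') (n' - 1) := by omega
  have key : ∀ a b : Fin (l + 2), (a : ℕ) = 0 → (b : ℕ) = 1 →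
      nextPos l D (faceSide D a) (a - 1) ≠ nextPos l D (faceSide D b) (b - 1) := by
    intro a b ha hb h9
    have e1 : faceSide D a = false := by rw [ha]; rfl
    have e2 : faceSide D b = true := by rw [hb]; exact hD.zero
    rw [e1, e2, ha, hb] at h9
    have := hD.nextPos_zero false
    simp only [Nat.zero_sub, Nat.sub_self] at h9
    rw [h9, hD.nextPos_zero true] at this
    exact absurd this (by decide)
  apply Fin.ext
  by_contra hne
  rcases lt_or_gt_of_ne hne with h9 | h9
  · exact key n n' (by omega) (by omega) h8
  · exact key n' n (by omega) (by omega) h8.symm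

lemma mem_caterpillar_iff (hD : TwoSided l D) (e : (ringHalin l D).edgeSet) :
    (e : Sym2 (Vertex l)) ∈ (caterpillar l).edgeSet ↔ e ∉ Set.range (ringEdge l D) := by
  have h1 : ∀ n, (ringEdge l D n : Sym2 (Vertex l)) ∉ (caterpillar l).edgeSet := by
    intro n h
    simp only [ringEdge, SimpleGraph.mem_edgeSet] at h
    exact not_caterpillar_adj hD.one_le h
  constructor
  · rintro h ⟨n, rfl⟩
    exact h1 n h
  · intro h
    have key : ∀ v w i j, Link l D v i w j → s(v, w) = (e : Sym2 (Vertex l)) →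
        s(v, w) ∈ (caterpillar l).edgeSet := by
      rintro v w i j (⟨p, hp⟩ | ⟨p, h1, hp⟩ | ⟨p, s, hp, hs⟩) he
      · exact caterpillar_adj_spineV hp
      · exact caterpillar_adj_leafV h1 hp
      · refine absurd ⟨⟨openFace D s p, ?_⟩, Subtype.ext ?_⟩ h
        · have := openFace_le D s p
          omega
        · rw [ringEdge_openFace hD hp hs, he]
    obtain ⟨e, he⟩ := e
    induction e using Sym2.ind with
    | _ v w =>
      obtain ⟨i, j, h2 | h2⟩ := exists_link_of_adj (show (ringHalin l D).Adj v w from he)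
      · exact key v w i j h2 rfl
      · have h3 := key w v _ _ h2 Sym2.eq_swap
        rw [Sym2.eq_swap] at h3
        exact h3

end Faces

/-! ### The equations of the face functions -/

/-- The relative reversals of the rotations with respect to the plane embedding. -/
def reversal (l : ℕ) (D : ℕ → Bool) (b : Vertex l → Bool) (v : Vertex l) : ZMod 2 :=
  bit (xor (b v) (ringOri l D v))

/-- The twists of the edges of the leaf cycle, extended by zero. -/
def ringTwist (l : ℕ) (D : ℕ → Bool) (t : Fin (l + 2) → Bool) : (ringHalin l D).edgeSet → Bool :=
  Function.extend (ringEdge l D) t fun _ => false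

section Equations

variable {l : ℕ} {D : ℕ → Bool}

lemma openFace_lt_add_two {p : ℕ} (s : Bool) (hp : p ≤ l) : openFace D s p < l + 2 := by
  have := openFace_le D s p
  omega

/-- A condition on darts that is symmetric in the two ends of an edge need be checked only in the
chosen direction of each link. -/
lemma forall_port_iff (hD : TwoSided l D) {Q : Vertex l → ZMod 3 → Vertex l → Prop}
    (hQ : ∀ v w i j, Link l D v i w j → (Q v i w ↔ Q w j v)) :
    (∀ v i, Q v i ((ringPorts hD).nb v i)) ↔ ∀ v w i j, Link l D v i w j → Q v i w := by
  constructor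
  · intro h v w i j hl
    have := h v i
    rwa [show (ringPorts hD).nb v i = w from (hl.nb_eq hD).1] at this
  · intro h v i
    obtain ⟨w, j, hl | hl⟩ := exists_link hD v i
    · rw [show (ringPorts hD).nb v i = w from (hl.nb_eq hD).1]
      exact h _ _ _ _ hl
    · rw [show (ringPorts hD).nb v i = w from (hl.nb_eq hD).2]
      exact (hQ _ _ _ _ hl).1 (h _ _ _ _ hl)

/-- The sum of the values at the two corners along an edge. -/
lemma Link.sum_corners (hD : TwoSided l D) {v w : Vertex l} {i j : ZMod 3} (h : Link l D v i w j)
    (g : ℕ → ZMod 2) : g (ringFace l D v (i + 1)) + g (ringFace l D v (i - 1))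
      = g (ringFace l D w (j + 1)) + g (ringFace l D w (j - 1)) := by
  obtain ⟨A, h1, h2⟩ := h.exists_faces hD
  have key : ∀ (f : Bool → ℕ) (c : Bool), g (f (xor true c)) + g (f (xor false c))
      = g (f true) + g (f false) := by
    intro f c
    cases c
    · rfl
    · exact add_comm _ _
  have key' : ∀ (f : Bool → ℕ) (c : Bool), g (f (!(xor true c))) + g (f (!(xor false c)))
      = g (f true) + g (f false) := by
    intro f c
    cases c
    · exact add_comm _ _
    · rfl
  have e1 : ringFace l D v (i + 1) = _ := h1 true
  have e2 : ringFace l D v (i - 1) = _ := (congrArg _ (sub_eq_add_neg i 1)).trans (h1 false)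
  have e3 : ringFace l D w (j + 1) = _ := h2 true
  have e4 : ringFace l D w (j - 1) = _ := (congrArg _ (sub_eq_add_neg j 1)).trans (h2 false)
  rw [e1, e2, e3, e4, key, key']

lemma ringTwist_of_mem (hD : TwoSided l D) (t : Fin (l + 2) → Bool) (e : (ringHalin l D).edgeSet)
    (he : (e : Sym2 (Vertex l)) ∈ (caterpillar l).edgeSet) : ringTwist l D t e = false :=
  Function.extend_apply' _ _ _ ((mem_caterpillar_iff hD e).1 he)

lemma ringTwist_ringEdge (hD : TwoSided l D) (t : Fin (l + 2) → Bool) (n : Fin (l + 2)) :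
    ringTwist l D t (ringEdge l D n) = t n := (ringEdge_injective hD).extend_apply _ _ _

lemma sum_spine_left (hD : TwoSided l D) (g : ℕ → ZMod 2) {p : ℕ} (hp : p ≤ l) :
    g (ringFace l D (spineV l p) ((if p = 0 then 2 else 1) + 1)) +
      g (ringFace l D (spineV l p) ((if p = 0 then 2 else 1) - 1))
      = g (openFace D true p) + g (openFace D false p) := by
  have h1 : ∀ i : ZMod 3, i + 1 = i + sgn true := fun i => rfl
  have h2 : ∀ i : ZMod 3, i - 1 = i + sgn false := fun i => sub_eq_add_neg i 1
  rw [h1, h2,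
    ringFace_spine_left hD hp, ringFace_spine_left hD hp]
  cases ringOri l D (spineV l p)
  · rfl
  · exact add_comm _ _

lemma sum_pendant_spine (g : ℕ → ZMod 2) {p : ℕ} (h1 : 1 ≤ p) (hp : p ≤ l) :
    g (ringFace l D (spineV l p) (2 + 1)) + g (ringFace l D (spineV l p) (2 - 1))
      = g (openFace D (D p) p) + g (openFace D (D p) (p - 1)) := by
  have h3 : ∀ i : ZMod 3, i + 1 = i + sgn true := fun i => rfl
  have h2 : ∀ i : ZMod 3, i - 1 = i + sgn false := fun i => sub_eq_add_neg i 1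
  rw [h3, h2,
    ringFace_pendant_spine h1 hp, ringFace_pendant_spine h1 hp]
  rfl

lemma sum_ring_left (hD : TwoSided l D) (g : ℕ → ZMod 2) {p : ℕ} {s : Bool} (hp : p ≤ l)
    (hs : SideAt l D s p) :
    g (ringFace l D (leafV l p) ((if p = 0 ∧ s = false then 0 else 1) + 1)) +
      g (ringFace l D (leafV l p) ((if p = 0 ∧ s = false then 0 else 1) - 1))
      = g (openFace D s p) + g (l + 2) := by
  have h1 : ∀ i : ZMod 3, i + 1 = i + sgn true := fun i => rfl
  have h2 : ∀ i : ZMod 3, i - 1 = i + sgn false := fun i => sub_eq_add_neg i 1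
  rw [h1, h2, ringFace_ring_left hD hp hs, ringFace_ring_left hD hp hs]
  cases ringOri l D (leafV l p) <;> cases s
  · rfl
  · exact add_comm _ _
  · exact add_comm _ _
  · rfl

/-- The equations for a face function that is given by its values `g` on the faces of the plane
embedding and by the values `a` on the vertices. -/
lemma isFaceFun_ring_iff (hD : TwoSided l D) (b : Vertex l → Bool) (t : Fin (l + 2) → Bool)
    (g : ℕ → ZMod 2) (a : Vertex l → ZMod 2) :
    (ringPorts hD).IsFaceFun b (ringTwist l D t) (fun v i => g (ringFace l D v i) + a v) ↔
      (∀ p ≤ l, a (spineV l p) + a (spineV l (p + 1)) =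
        (g (openFace D true p) + g (openFace D false p)) *
          (reversal l D b (spineV l p) + reversal l D b (spineV l (p + 1)))) ∧
      (∀ p, 1 ≤ p → p ≤ l → a (spineV l p) + a (leafV l p) =
        (g (openFace D (D p) p) + g (openFace D (D p) (p - 1))) *
          (reversal l D b (spineV l p) + reversal l D b (leafV l p))) ∧
      (∀ p s (hp : p ≤ l), SideAt l D s p → a (leafV l p) + a (leafV l (nextPos l D s p)) =
        (g (openFace D s p) + g (l + 2)) *
          (reversal l D b (leafV l p) + reversal l D b (leafV l (nextPos l D s p)) +
            bit (t ⟨openFace D s p, openFace_lt_add_two s hp⟩))) := by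
  classical
  rw [CubicPorts.isFaceFun_iff _ (isPlane hD)]
  -- The twists as a symmetric function of two vertices, which avoids transporting membership proofs
  -- when an edge is written in different ways.
  obtain ⟨τ, hτ', hτ⟩ : ∃ τ : Vertex l → Vertex l → ZMod 2,
      (∀ v w (h : s(v, w) ∈ (ringHalin l D).edgeSet),
        τ v w = bit (ringTwist l D t ⟨s(v, w), h⟩)) ∧ ∀ v w, τ v w = τ w v := by
    refine ⟨fun v w => if h : s(v, w) ∈ (ringHalin l D).edgeSet then
      bit (ringTwist l D t ⟨s(v, w), h⟩) else 0, fun v w h => dif_pos h, fun v w => ?_⟩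
    have h : s(v, w) = s(w, v) := Sym2.eq_swap
    simp only [h]
  have h0 := forall_port_iff hD (Q := fun v i w => a v + a w
    = (g (ringFace l D v (i + 1)) + g (ringFace l D v (i - 1))) *
      (reversal l D b v + reversal l D b w + τ v w)) (by
      intro v w i j h
      rw [h.sum_corners hD g, hτ v w, add_comm (a v), add_comm (reversal l D b v)])
  have h1 : ∀ v i, bit (ringTwist l D t ⟨((ringPorts hD).dart v i).edge,
      ((ringPorts hD).dart v i).edge_mem⟩) = τ v ((ringPorts hD).nb v i) := fun v i =>
    (hτ' _ _ ((ringPorts hD).dart v i).edge_mem).symm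
  have hcat : ∀ v w, (caterpillar l).Adj v w → τ v w = 0 := by
    intro v w h
    have h' : s(v, w) ∈ (ringHalin l D).edgeSet := Or.inl h
    rw [hτ' _ _ h', ringTwist_of_mem hD _ _ (show s(v, w) ∈ (caterpillar l).edgeSet from h)]
    rfl
  have hring : ∀ p s (hp : p ≤ l), SideAt l D s p → τ (leafV l p) (leafV l (nextPos l D s p))
      = bit (t ⟨openFace D s p, openFace_lt_add_two s hp⟩) := by
    intro p s hp hs
    have hlt := openFace_lt_add_two (D := D) s hp
    have h3 := ringEdge_openFace hD hp hs hlt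
    have h4 : s(leafV l p, leafV l (nextPos l D s p)) ∈ (ringHalin l D).edgeSet :=
      h3 ▸ (ringEdge l D ⟨openFace D s p, hlt⟩).2
    rw [hτ' _ _ h4, ← ringTwist_ringEdge hD t]
    congr 2
    exact Subtype.ext h3.symm
  simp only [h1]
  refine h0.trans ⟨fun h => ⟨fun p hp => ?_, fun p h1 hp => ?_, fun p s hp hs => ?_⟩, ?_⟩
  · rw [h _ _ _ _ (Link.spine p hp), hcat _ _ (caterpillar_adj_spineV hp), add_zero,
      sum_spine_left hD g hp]
  · rw [h _ _ _ _ (Link.pendant p h1 hp), hcat _ _ (caterpillar_adj_leafV h1 hp), add_zero,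
      sum_pendant_spine g h1 hp]
  · rw [h _ _ _ _ (Link.ring p s hp hs), sum_ring_left hD g hp hs, hring p s hp hs]
  · rintro ⟨h2, h3, h4⟩ v w i j (⟨p, hp⟩ | ⟨p, h5, hp⟩ | ⟨p, s, hp, hs⟩)
    · rw [h2 p hp, hcat _ _ (caterpillar_adj_spineV hp), add_zero, sum_spine_left hD g hp]
    · rw [h3 p h5 hp, hcat _ _ (caterpillar_adj_leafV h5 hp), add_zero, sum_pendant_spine g h5 hp]
    · rw [h4 p s hp hs, sum_ring_left hD g hp hs, hring p s hp hs]

/-! ### The overlap matrix -/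

/-- The part below the diagonal of the overlap matrix: `y r` belongs to the spine edge from `r` to
`r + 1`, and `w r` to the pendant edge at `r`. -/
def lowEntry (D : ℕ → Bool) (y w : ℕ → ZMod 2) (n c : ℕ) : ZMod 2 :=
  if n = 0 then 0 else (if openFace D (!D (n - 1)) (n - 1) = c then y (n - 1) else 0) +
    if openFace D (D (n - 1)) (n - 1 - 1) = c then w (n - 1) else 0

/-- The overlap matrix of the leaf cycle. -/
def faceMatrix (l : ℕ) (D : ℕ → Bool) (y w : ℕ → ZMod 2) (t : Fin (l + 2) → ZMod 2) :
    Matrix (Fin (l + 2)) (Fin (l + 2)) (ZMod 2) :=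
  Matrix.of fun i j => (if i = j then t i else 0) + lowEntry D y w i j + lowEntry D y w j i

/-- Extension by zero. -/
def extendZero {N : ℕ} (g : Fin N → ZMod 2) (n : ℕ) : ZMod 2 := if h : n < N then g ⟨n, h⟩ else 0

lemma sum_fin_extendZero {N : ℕ} (g : Fin N → ZMod 2) (f : ℕ → ZMod 2) :
    ∑ i : Fin N, f i * g i = ∑ i ∈ Finset.range N, f i * extendZero g i := by
  rw [← Fin.sum_univ_eq_sum_range (fun i => f i * extendZero g i)]
  refine Finset.sum_congr rfl fun i _ => ?_
  rw [extendZero, dif_pos i.2]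

/-- The row is reorganised by positions: position r accounts for the entries linking the face r + 1,
which opens there, with the faces across the spine edge and across the pendant edge. -/
lemma faceMatrix_mulVec (y w : ℕ → ZMod 2) (t : Fin (l + 2) → ZMod 2) (g : Fin (l + 2) → ZMod 2)
    (n : Fin (l + 2)) : (faceMatrix l D y w t *ᵥ g) n = t n * g n +
      ∑ r ∈ Finset.range (l + 1), ((if (n : ℕ) = r + 1 then
        y r * extendZero g (openFace D (!D r) r) + w r * extendZero g (openFace D (D r) (r - 1))
        else 0) + ((if openFace D (!D r) r = n then y r else 0) +
          if openFace D (D r) (r - 1) = n then w r else 0) * extendZero g (r + 1)) := by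
  have h1 : (faceMatrix l D y w t *ᵥ g) n = t n * g n + (∑ j : Fin (l + 2), lowEntry D y w n j * g j
      + ∑ j : Fin (l + 2), lowEntry D y w j n * g j) := by
    rw [mulVec, dotProduct]
    simp only [faceMatrix, Matrix.of_apply, add_mul, Finset.sum_add_distrib, add_assoc]
    congr 1
    simp
  rw [h1, sum_fin_extendZero g (fun j => lowEntry D y w n j),
    sum_fin_extendZero g (fun j => lowEntry D y w j n), Finset.sum_add_distrib]
  congr 2
  · rcases Nat.eq_zero_or_pos n with h0 | h0
    · rw [h0, Finset.sum_eq_zero, Finset.sum_eq_zero]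
      · intro r _
        rw [if_neg (by omega)]
      · intro r _
        rw [lowEntry, if_pos rfl, zero_mul]
    · have hn := n.2
      rw [Finset.sum_eq_single_of_mem ((n : ℕ) - 1) (Finset.mem_range.2 (by omega))
        (fun r _ hr => if_neg (by omega)), if_pos (by omega)]
      simp only [lowEntry, if_neg (show (n : ℕ) ≠ 0 by omega), add_mul, ite_mul, zero_mul,
        Finset.sum_add_distrib, Finset.sum_ite_eq]
      rw [if_pos, if_pos]
      · have := openFace_le D (D (n - 1)) (n - 1 - 1)
        rw [Finset.mem_range]
        omega
      · have := openFace_le D (!D (n - 1)) (n - 1)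
        rw [Finset.mem_range]
        omega
  · rw [Finset.sum_range_succ']
    rw [lowEntry, if_pos rfl, zero_mul, add_zero]
    rfl

end Equations

/-! ### Equations along the leaf cycle as rows of the overlap matrix -/

section RingEquation

variable {l : ℕ} {D : ℕ → Bool}

lemma add_eq_sum_Ico (f : ℕ → ZMod 2) {p q : ℕ} (h : p ≤ q) :
    f p + f q = ∑ r ∈ Finset.Ico p q, (f r + f (r + 1)) := by
  induction q, h using Nat.le_induction with
  | base => rw [Finset.Ico_self, Finset.sum_empty, CharTwo.add_self_eq_zero]
  | succ q hq ih =>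
    rw [Finset.sum_Ico_succ_top hq, ← ih]
    linear_combination (-f q) * CharTwo.two_eq_zero (R := ZMod 2)

/-- The pendant edge at p separates the face opened there from its predecessor, so it contributes
the value of that predecessor. The right-hand side writes this with the jump across the pendant
edge; the value of the new face cancels. -/
lemma sum_left_end (hD : TwoSided l D) (g w : ℕ → ZMod 2) (hw0 : w 0 = 0) {p : ℕ} {s : Bool}
    (hp : p ≤ l) (hs : SideAt l D s p) :
    (∑ r ∈ Finset.range (l + 1), if openFace D s p = r + 1 then w r * g (openFace D (D r) (r - 1))
      else 0) = (g (openFace D (D p) p) + g (openFace D (D p) (p - 1))) * w p +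
        g (openFace D s p) * w p := by
  have h2 := CharTwo.two_eq_zero (R := ZMod 2)
  by_cases h : D p = s
  · rw [openFace_self hD.zero h, openFace_self hD.zero rfl,
      Finset.sum_eq_single_of_mem p (Finset.mem_range.2 (by omega))
      (fun r _ hr => if_neg (by omega)), if_pos rfl]
    linear_combination (-(g (p + 1) * w p)) * h2
  · obtain rfl : p = 0 := by
      rcases hs with h1 | h1 | h1
      · exact h1
      · omega
      · exact absurd h1 h
    have := openFace_lt hD.zero h
    rw [hw0, mul_zero, mul_zero, add_zero]
    exact Finset.sum_eq_zero fun r _ => if_neg (by omega)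

/-- The only later face that replaces the given one is opened by the next leaf on the same side. At
the right end of the graph nothing opens, and `hwl` makes both sides vanish. -/
lemma sum_right_end (hD : TwoSided l D) (g w : ℕ → ZMod 2) (hw0 : w 0 = 0) (hwl : w (l + 1) = 0)
    {p : ℕ} {s : Bool} (hp : p ≤ l) (hs : SideAt l D s p) :
    (∑ r ∈ Finset.range (l + 1), (if openFace D (D r) (r - 1) = openFace D s p then w r else 0) *
      g (r + 1)) = (g (openFace D (D (nextPos l D s p)) (nextPos l D s p)) +
        g (openFace D (D (nextPos l D s p)) (nextPos l D s p - 1))) * w (nextPos l D s p) +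
        g (openFace D s p) * w (nextPos l D s p) := by
  have h2 := CharTwo.two_eq_zero (R := ZMod 2)
  have h3 := lt_nextPos (D := D) (s := s) hp
  have h4 := nextPos_le (D := D) (s := s) hp
  have h5 : ∀ r ∈ Finset.range (l + 1), r ≠ nextPos l D s p →
      (if openFace D (D r) (r - 1) = openFace D s p then w r else 0) * g (r + 1) = 0 := by
    intro r hr hne
    rw [Finset.mem_range] at hr
    rcases Nat.eq_zero_or_pos r with rfl | h0
    · rw [hw0, ite_self, zero_mul]
    · rw [if_neg, zero_mul]
      intro h6
      have h7 : D r = s := by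
        by_contra h7
        exact openFace_ne hD.zero h7 _ _ h6
      rw [h7, openFace_eq_iff hD.zero hp hs (by omega)] at h6
      exact not_sideAt_of_lt_nextPos (D := D) (s := s) hp (show p < r by omega) (by omega)
        (Or.inr (Or.inr h7))
  rcases h4.lt_or_eq with h6 | h6
  · have h7 : D (nextPos l D s p) = s := by
      rcases sideAt_nextPos (D := D) (s := s) hp with h8 | h8 | h8
      · omega
      · omega
      · exact h8
    rw [Finset.sum_eq_single_of_mem _ (Finset.mem_range.2 h6) h5, h7,
      openFace_pred_nextPos hD.zero hp hs, if_pos rfl, openFace_self hD.zero h7]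
    linear_combination (-(g (openFace D s p) * w (nextPos l D s p))) * h2
  · rw [h6, hwl, mul_zero, mul_zero, add_zero]
    refine Finset.sum_eq_zero fun r hr => h5 r hr ?_
    rw [Finset.mem_range] at hr
    omega

/-- While the face is open, each spine edge pairs it with the face on the opposite side of the
spine; modulo 2 that face's value is the sum of both faces at the edge plus the own value. -/
lemma sum_between (hD : TwoSided l D) (g y : ℕ → ZMod 2) {p : ℕ} {s : Bool} (hp : p ≤ l)
    (hs : SideAt l D s p) :
    (∑ r ∈ Finset.range (l + 1), ((if openFace D s p = r + 1 then y r * g (openFace D (!D r) r)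
        else 0) + (if openFace D (!D r) r = openFace D s p then y r else 0) * g (r + 1)))
      = ∑ r ∈ Finset.Ico p (nextPos l D s p), (g (openFace D true r) + g (openFace D false r) +
        g (openFace D s p)) * y r := by
  have h2 := CharTwo.two_eq_zero (R := ZMod 2)
  have h3 := lt_nextPos (D := D) (s := s) hp
  have h4 := nextPos_le (D := D) (s := s) hp
  have h5 : Finset.Ico p (nextPos l D s p)
      = (Finset.range (l + 1)).filter fun r => openFace D s r = openFace D s p := by
    ext r
    rw [Finset.mem_Ico, Finset.mem_filter, Finset.mem_range]
    constructor
    · intro h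
      exact ⟨by omega, (openFace_eq_iff hD.zero hp hs (by omega)).2 h⟩
    · intro h
      exact (openFace_eq_iff hD.zero hp hs (by omega)).1 h.2
  rw [h5, Finset.sum_filter]
  refine Finset.sum_congr rfl fun r _ => ?_
  have h6 : openFace D s r = openFace D s p → g (openFace D true r) + g (openFace D false r) +
      g (openFace D s p) = g (openFace D (!s) r) := by
    intro h
    rw [← h]
    cases s
    · rw [Bool.not_false]
      linear_combination g (openFace D false r) * h2
    · rw [Bool.not_true]
      linear_combination g (openFace D true r) * h2
  by_cases h : D r = s
  · rw [h, if_neg (openFace_ne hD.zero (by cases s <;> decide) _ _), zero_mul, add_zero]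
    rw [openFace_self hD.zero h] at h6 ⊢
    by_cases h7 : openFace D s p = r + 1
    · rw [if_pos h7, if_pos h7.symm, h6 h7.symm, mul_comm]
    · rw [if_neg h7, if_neg (Ne.symm h7)]
  · have h8 : (!D r) = s := by clear h6 h5; cases s <;> simpa using h
    have h9 : openFace D (!s) r = r + 1 := openFace_self hD.zero (by rw [← h8, Bool.not_not])
    rw [h8, if_neg, zero_add]
    · by_cases h7 : openFace D s r = openFace D s p
      · rw [if_pos h7, if_pos h7, h6 h7, h9, mul_comm]
      · rw [if_neg h7, if_neg h7, zero_mul]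
    · rw [← h9]
      exact openFace_ne hD.zero (by cases s <;> decide) _ _

/-- Under the equations along the tree edges, the equation along an edge of the leaf cycle
becomes a row of a linear system. -/
lemma ring_equation_iff (hD : TwoSided l D) {A B S L y w g : ℕ → ZMod 2} (hw0 : w 0 = 0)
    (hwl : w (l + 1) = 0) (hS : ∀ r ≤ l, S r + S (r + 1) = y r)
    (hL : ∀ p ≤ l + 1, S p + L p = w p)
    (hA : ∀ r ≤ l, A r + A (r + 1) = (g (openFace D true r) + g (openFace D false r)) * y r)
    (hB : ∀ p ≤ l + 1, A p + B p = (g (openFace D (D p) p) + g (openFace D (D p) (p - 1))) * w p)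
    (τ : ZMod 2) {p : ℕ} {s : Bool} (hp : p ≤ l) (hs : SideAt l D s p) :
    B p + B (nextPos l D s p) = g (openFace D s p) * (L p + L (nextPos l D s p) + τ) ↔
      τ * g (openFace D s p) + ∑ r ∈ Finset.range (l + 1), ((if openFace D s p = r + 1 then
        y r * g (openFace D (!D r) r) + w r * g (openFace D (D r) (r - 1)) else 0) +
        ((if openFace D (!D r) r = openFace D s p then y r else 0) +
          if openFace D (D r) (r - 1) = openFace D s p then w r else 0) * g (r + 1)) = 0 := by
  have h2 := CharTwo.two_eq_zero (R := ZMod 2)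
  have h3 := lt_nextPos (D := D) (s := s) hp
  have h4 := nextPos_le (D := D) (s := s) hp
  have hmem : ∀ r ∈ Finset.Ico p (nextPos l D s p), r ≤ l := fun r hr => by
    rw [Finset.mem_Ico] at hr
    omega
  -- Between two consecutive leaves on one side, the vertex values and the reversals telescope along
  -- the spine.
  have hA' := (add_eq_sum_Ico A h3.le).trans (Finset.sum_congr rfl fun r hr => hA r (hmem r hr))
  have hS' := (add_eq_sum_Ico S h3.le).trans (Finset.sum_congr rfl fun r hr => hS r (hmem r hr))
  have e1 := sum_left_end hD g w hw0 hp hs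
  have e2 := sum_right_end hD g w hw0 hwl hp hs
  have e3 := sum_between hD g y hp hs
  have e4 : ∑ r ∈ Finset.range (l + 1), ((if openFace D s p = r + 1 then
        y r * g (openFace D (!D r) r) + w r * g (openFace D (D r) (r - 1)) else 0) +
        ((if openFace D (!D r) r = openFace D s p then y r else 0) +
          if openFace D (D r) (r - 1) = openFace D s p then w r else 0) * g (r + 1))
      = B p + B (nextPos l D s p) + g (openFace D s p) * (L p + L (nextPos l D s p)) := by
    have e5 : ∀ (P : Prop) [Decidable P] (a b : ZMod 2), (if P then a + b else 0)
        = (if P then a else 0) + if P then b else 0 := by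
      intro P _ a b
      split_ifs <;> simp
    have e6 : ∑ r ∈ Finset.Ico p (nextPos l D s p), (g (openFace D true r) +
        g (openFace D false r) + g (openFace D s p)) * y r = A p + A (nextPos l D s p) +
          g (openFace D s p) * (S p + S (nextPos l D s p)) := by
      rw [hA', hS', Finset.mul_sum, ← Finset.sum_add_distrib]
      exact Finset.sum_congr rfl fun r _ => add_mul _ _ _
    rw [e6] at e3
    simp only [e5, add_mul, Finset.sum_add_distrib] at e3 ⊢
    linear_combination e1 + e2 + e3 - hB p (by omega) - hB _ h4
      - g (openFace D s p) * (hL p (by omega) + hL _ h4) + (A p + A (nextPos l D s p) +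
        g (openFace D s p) * (S p + S (nextPos l D s p))) * h2
  rw [e4]
  constructor
  · intro h
    linear_combination h + g (openFace D s p) * (L p + L (nextPos l D s p)+τ) * h2
  · intro h
    linear_combination h - g (openFace D s p) * (L p + L (nextPos l D s p)+τ) * h2

end RingEquation

/-! ### Face functions, the kernel of the overlap matrix, and the genus -/

section Solutions

variable {l : ℕ} {D : ℕ → Bool}

/-- The entries of the overlap matrix that belong to the spine edges. -/
def spineEntry (l : ℕ) (D : ℕ → Bool) (b : Vertex l → Bool) (r : ℕ) : ZMod 2 :=
  reversal l D b (spineV l r) + reversal l D b (spineV l (r + 1))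

/-- The entries of the overlap matrix that belong to the pendant edges. -/
def pendantEntry (l : ℕ) (D : ℕ → Bool) (b : Vertex l → Bool) (p : ℕ) : ZMod 2 :=
  reversal l D b (spineV l p) + reversal l D b (leafV l p)

lemma pendantEntry_zero (b : Vertex l → Bool) : pendantEntry l D b 0 = 0 := by
  rw [pendantEntry, leafV_zero, CharTwo.add_self_eq_zero]

lemma pendantEntry_last (b : Vertex l → Bool) : pendantEntry l D b (l + 1) = 0 := by
  rw [pendantEntry, leafV_last, CharTwo.add_self_eq_zero]

/-- The overlap matrix of a rotation system. -/
def systemMatrix (l : ℕ) (D : ℕ → Bool) (b : Vertex l → Bool) (t : Fin (l + 2) → Bool) :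
    Matrix (Fin (l + 2)) (Fin (l + 2)) (ZMod 2) :=
  faceMatrix l D (spineEntry l D b) (pendantEntry l D b) fun n => bit (t n)

/-- The equations along the tree edges. -/
def TreeEquations (l : ℕ) (D : ℕ → Bool) (b : Vertex l → Bool) (g : ℕ → ZMod 2)
    (a : Vertex l → ZMod 2) : Prop :=
  (∀ p ≤ l, a (spineV l p) + a (spineV l (p + 1)) =
    (g (openFace D true p) + g (openFace D false p)) * spineEntry l D b p) ∧
  ∀ p, 1 ≤ p → p ≤ l → a (spineV l p) + a (leafV l p) =
    (g (openFace D (D p) p) + g (openFace D (D p) (p - 1))) * pendantEntry l D b p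

lemma extendZero_last {N : ℕ} (g : Fin N → ZMod 2) : extendZero g N = 0 := dif_neg (lt_irrefl N)

lemma extendZero_coe {N : ℕ} (g : Fin N → ZMod 2) (n : Fin N) : extendZero g n = g n := dif_pos n.2

/-- Extension by zero puts the value 0 on the outer face `l + 2`. Given the tree equations, the
remaining equation along each leaf-cycle edge is the row of the plane face bounded by that edge. -/
lemma isFaceFun_extendZero_iff (hD : TwoSided l D) (b : Vertex l → Bool) (t : Fin (l + 2) → Bool)
    (g : Fin (l + 2) → ZMod 2) (a : Vertex l → ZMod 2) :
    (ringPorts hD).IsFaceFun b (ringTwist l D t)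
      (fun v i => extendZero g (ringFace l D v i) + a v) ↔
      TreeEquations l D b (extendZero g) a ∧ systemMatrix l D b t *ᵥ g = 0 := by
  rw [isFaceFun_ring_iff, ← and_assoc]
  refine and_congr_right fun hT => ?_
  obtain ⟨h1, h2⟩ := hT
  have h3 : ∀ p ≤ l + 1, a (spineV l p) + a (leafV l p) = (extendZero g (openFace D (D p) p) +
      extendZero g (openFace D (D p) (p - 1))) * pendantEntry l D b p := by
    intro p hp
    rcases Nat.eq_zero_or_pos p with rfl | h0
    · rw [pendantEntry_zero, leafV_zero, CharTwo.add_self_eq_zero, mul_zero]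
    · rcases hp.lt_or_eq with h4 | rfl
      · exact h2 p h0 (by omega)
      · rw [pendantEntry_last, leafV_last, CharTwo.add_self_eq_zero, mul_zero]
  have key := fun (p : ℕ) (s : Bool) (hp : p ≤ l) (hs : SideAt l D s p) =>
    ring_equation_iff hD (A := fun p => a (spineV l p)) (B := fun p => a (leafV l p))
      (S := fun p => reversal l D b (spineV l p)) (L := fun p => reversal l D b (leafV l p))
      (y := spineEntry l D b) (g := extendZero g) (pendantEntry_zero b) (pendantEntry_last b) (fun r _ => rfl)
      (fun p _ => rfl) h1 h3 (bit (t ⟨openFace D s p, openFace_lt_add_two s hp⟩)) hp hs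
  rw [extendZero_last]
  simp only [add_zero]
  have hrow : ∀ (p : ℕ) (s : Bool) (hp : p ≤ l) (hs : SideAt l D s p),
      a (leafV l p) + a (leafV l (nextPos l D s p)) = extendZero g (openFace D s p) *
        (reversal l D b (leafV l p) + reversal l D b (leafV l (nextPos l D s p)) +
          bit (t ⟨openFace D s p, openFace_lt_add_two s hp⟩)) ↔
      (systemMatrix l D b t *ᵥ g) ⟨openFace D s p, openFace_lt_add_two s hp⟩ = 0 := by
    intro p s hp hs
    rw [key p s hp hs, systemMatrix, faceMatrix_mulVec,
      ← extendZero_coe g ⟨openFace D s p, openFace_lt_add_two s hp⟩]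
  constructor
  · intro h
    funext n
    have hn := n.2
    have h4 := (hrow (n - 1) (faceSide D n) (by omega) (sideAt_faceSide D l n)).1
      (h _ _ (by omega) (sideAt_faceSide D l n))
    simp only [openFace_faceSide hD.zero] at h4
    exact h4
  · intro h p s hp hs
    rw [hrow p s hp hs, h]
    rfl

/-- The solution of the equations along the tree edges. -/
def treeSolution (l : ℕ) (D : ℕ → Bool) (b : Vertex l → Bool) (g : ℕ → ZMod 2) (x : ZMod 2) :
    Vertex l → ZMod 2 :=
  let A : ℕ → ZMod 2 := fun p => x + ∑ r ∈ Finset.range p,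
    (g (openFace D true r) + g (openFace D false r)) * spineEntry l D b r
  byKind A fun p => A p +
    (g (openFace D (D p) p) + g (openFace D (D p) (p - 1))) * pendantEntry l D b p

lemma treeSolution_spineV (b : Vertex l → Bool) (g : ℕ → ZMod 2) (x : ZMod 2) {p : ℕ}
    (hp : p ≤ l + 1) : treeSolution l D b g x (spineV l p) = x + ∑ r ∈ Finset.range p,
      (g (openFace D true r) + g (openFace D false r)) * spineEntry l D b r := by
  rcases Nat.eq_zero_or_pos p with rfl | h0
  · rw [← leafV_zero, treeSolution, byKind_leafV _ _ hp, pendantEntry_zero, mul_zero, add_zero]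
  · rcases hp.lt_or_eq with h4 | rfl
    · rw [treeSolution, byKind_spineV _ _ h0 (by omega)]
    · rw [← leafV_last, treeSolution, byKind_leafV _ _ hp, pendantEntry_last, mul_zero, add_zero]

lemma treeSolution_leafV (b : Vertex l → Bool) (g : ℕ → ZMod 2) (x : ZMod 2) {p : ℕ}
    (hp : p ≤ l + 1) : treeSolution l D b g x (leafV l p) = treeSolution l D b g x (spineV l p) +
      (g (openFace D (D p) p) + g (openFace D (D p) (p - 1))) * pendantEntry l D b p := by
  rw [treeSolution_spineV b g x hp, treeSolution, byKind_leafV _ _ hp]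

lemma treeSolution_zero (b : Vertex l → Bool) (g : ℕ → ZMod 2) (x : ZMod 2) :
    treeSolution l D b g x (spineV l 0) = x := by
  rw [treeSolution_spineV b g x (Nat.zero_le _), Finset.range_zero, Finset.sum_empty, add_zero]

/-- On a tree the differences of a along the edges may be prescribed freely, so a is determined by
its value at v_0. -/
lemma treeEquations_iff (b : Vertex l → Bool) (g : ℕ → ZMod 2) (a : Vertex l → ZMod 2) :
    TreeEquations l D b g a ↔ a = treeSolution l D b g (a (spineV l 0)) := by
  have h2 := CharTwo.two_eq_zero (R := ZMod 2)
  constructor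
  · rintro ⟨h3, h4⟩
    have hs : ∀ p ≤ l + 1, a (spineV l p) = treeSolution l D b g (a (spineV l 0)) (spineV l p) := by
      intro p
      induction p with
      | zero => intro _; rw [treeSolution_zero]
      | succ p ih =>
        intro hp
        have e1 := ih (by omega)
        rw [treeSolution_spineV b g _ (by omega)] at e1 ⊢
        rw [Finset.sum_range_succ, ← h3 p (by omega)]
        linear_combination e1 - (a (spineV l p)) * h2
    funext v
    rcases vertex_cases v with ⟨p, h5, h6, rfl⟩ | ⟨p, h5, rfl⟩
    · exact hs p (by omega)
    · rcases Nat.eq_zero_or_pos p with rfl | h0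
      · exact hs 0 h5
      · rcases h5.lt_or_eq with h6 | rfl
        · rw [treeSolution_leafV b g _ h5, ← hs p h5, ← h4 p h0 (by omega)]
          linear_combination (-(a (spineV l p))) * h2
        · rw [leafV_last]
          exact hs _ h5
  · intro h
    generalize a (spineV l 0) = x at h
    subst h
    refine ⟨fun p hp => ?_, fun p h3 hp => ?_⟩
    · rw [treeSolution_spineV b g x (by omega), treeSolution_spineV b g x (by omega),
        Finset.sum_range_succ]
      linear_combination (x + ∑ r ∈ Finset.range p,
        (g (openFace D true r) + g (openFace D false r)) * spineEntry l D b r) * h2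
    · rw [treeSolution_leafV b g x (by omega)]
      linear_combination treeSolution l D b g x (spineV l p) * h2

/-- A binary function on the corners whose corner sums along the leaf cycle vanish is constant at
every vertex, if it has equal corner sums at the two ends of every edge. -/
lemma eq_of_sums (hD : TwoSided l D) {k : Vertex l → ZMod 3 → ZMod 2}
    (hk : ∀ v w i j, Link l D v i w j → k v (i + 1) + k v (i - 1) = k w (j + 1) + k w (j - 1))
    (h0 : ∀ p s, p ≤ l → SideAt l D s p → k (leafV l p) ((if p = 0 ∧ s = false then 0 else 1) + 1)
      + k (leafV l p) ((if p = 0 ∧ s = false then 0 else 1) - 1) = 0) (v : Vertex l) (i : ZMod 3) :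
    k v i = k v 0 := by
  have hring : ∀ p s, p ≤ l → SideAt l D s p →
      k (leafV l (nextPos l D s p)) ((if nextPos l D s p = l + 1 ∧ s = true then 1 else 0) + 1) +
      k (leafV l (nextPos l D s p)) ((if nextPos l D s p = l + 1 ∧ s = true then 1 else 0) - 1)
        = 0 := fun p s hp hs => by
    rw [← hk _ _ _ _ (Link.ring p s hp hs), h0 p s hp hs]
  -- Two different pair sums among three bits vanish only if the bits are equal.
  have key : ∀ f : ZMod 3 → ZMod 2, (∃ i j, i ≠ j ∧ f (i + 1) + f (i - 1) = 0 ∧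
      f (j + 1) + f (j - 1) = 0) → ∀ i, f i = f 0 := by decide
  have hport : ∀ {f : ZMod 3 → ZMod 2}, (∀ i, f i = f 0) → ∀ i, f (i + 1) + f (i - 1) = 0 := by
    intro f hf i
    rw [hf (i + 1), hf (i - 1), CharTwo.add_self_eq_zero]
  have hleaf : ∀ p ≤ l + 1, ∀ i, k (leafV l p) i = k (leafV l p) 0 := by
    intro p hp
    apply key
    rcases Nat.eq_zero_or_pos p with rfl | hp0
    · refine ⟨0, 1, by decide, ?_, ?_⟩
      · have := h0 0 false (Nat.zero_le _) (Or.inl rfl)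
        rwa [if_pos ⟨rfl, rfl⟩] at this
      · have := h0 0 true (Nat.zero_le _) (Or.inl rfl)
        rwa [if_neg (by simp)] at this
    · refine ⟨0, 1, by decide, ?_, ?_⟩
      · have hlt := prevPos_lt (l := l) (D := D) (s := D p) hp0
        have := hring (prevPos l D (D p) p) (D p) (by omega) sideAt_prevPos
        rw [nextPos_prevPos hp0 hp (sideAt_self l D p)] at this
        rwa [if_neg] at this
        rintro ⟨rfl, h⟩
        rw [hD.last] at h
        exact absurd h (by decide)
      · rcases hp.lt_or_eq with h1 | rfl
        · have := h0 p (D p) (by omega) (sideAt_self l D p)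
          rwa [if_neg (by omega)] at this
        · have hlt := prevPos_lt (l := l) (D := D) (s := true) hp0
          have := hring (prevPos l D true (l + 1)) true (by omega) sideAt_prevPos
          rw [nextPos_prevPos hp0 hp (Or.inr (Or.inl rfl))] at this
          rwa [if_pos ⟨rfl, rfl⟩] at this
  -- From left to right: the edge from the preceding vertex and the pendant edge from the leaf give
  -- the two vanishing sums.
  have hspine : ∀ p ≤ l, ∀ i, k (spineV l p) i = k (spineV l p) 0 := by
    intro p
    induction p with
    | zero =>
      intro _
      exact hleaf 0 (by omega)
    | succ p ih =>
      intro hp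
      apply key
      refine ⟨0, 2, by decide, ?_, ?_⟩
      · have := hk _ _ _ _ (Link.spine (D := D) p (show p ≤ l by omega))
        rw [hport (ih (by omega)), if_neg (show p ≠ l by omega)] at this
        exact this.symm
      · rw [hk _ _ _ _ (Link.pendant (D := D) (p + 1) (by omega) hp)]
        exact hport (hleaf _ (by omega)) 2
  rcases vertex_cases v with ⟨p, h5, h6, rfl⟩ | ⟨p, h5, rfl⟩
  · exact hspine p h6 i
  · exact hleaf p h5 i

/-- The face functions correspond to the kernel of the overlap matrix. -/
def faceFunKerEquiv (hD : TwoSided l D) (b : Vertex l → Bool) (t : Fin (l + 2) → Bool) :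
    ZMod 2 × LinearMap.ker (systemMatrix l D b t).mulVecLin ≃
      {h // (ringPorts hD).IsFaceFun b (ringTwist l D t) h} :=
  Equiv.ofBijective (fun q => ⟨fun v i => extendZero q.2.1 (ringFace l D v i) +
      treeSolution l D b (extendZero q.2.1) q.1 v, by
      rw [isFaceFun_extendZero_iff, treeEquations_iff, treeSolution_zero]
      exact ⟨rfl, q.2.2⟩⟩) <| by
    have h2 := CharTwo.two_eq_zero (R := ZMod 2)
    -- g can be read off: along a leaf-cycle edge the two corners belong to the face n and to the
    -- outer face, where the value is 0.
    have hsum : ∀ (g : Fin (l + 2) → ZMod 2) (n : Fin (l + 2)) (hs : SideAt l D (faceSide D n) (n - 1)),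
        extendZero g (ringFace l D (leafV l (n - 1)) ((if (n : ℕ) - 1 = 0 ∧ faceSide D n = false then 0 else 1) + 1))
        + extendZero g (ringFace l D (leafV l (n - 1)) ((if (n : ℕ) - 1 = 0 ∧ faceSide D n = false then 0 else 1) - 1))
        = g n := by
      intro g n hs
      have hn := n.2
      rw [sum_ring_left hD _ (by omega) hs, openFace_faceSide hD.zero, extendZero_last, add_zero,
        extendZero_coe]
    constructor
    · rintro ⟨x, g, hg⟩ ⟨x', g', hg'⟩ h
      have h := congrArg Subtype.val h
      simp only at h
      have h3 : ∀ v i, extendZero g (ringFace l D v i) + treeSolution l D b (extendZero g) x v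
          = extendZero g' (ringFace l D v i) + treeSolution l D b (extendZero g') x' v :=
        fun v i => congrFun (congrFun h v) i
      have hgg : g = g' := by
        funext n
        rw [← hsum g n (sideAt_faceSide D l n), ← hsum g' n (sideAt_faceSide D l n)]
        have e1 := h3 (leafV l (n - 1))
          ((if (n : ℕ) - 1 = 0 ∧ faceSide D n = false then 0 else 1) + 1)
        have e2 := h3 (leafV l (n - 1))
          ((if (n : ℕ) - 1 = 0 ∧ faceSide D n = false then 0 else 1) - 1)
        linear_combination e1 + e2 - (treeSolution l D b (extendZero g) x (leafV l (n - 1)) -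
          treeSolution l D b (extendZero g') x' (leafV l (n - 1))) * h2
      subst hgg
      have e1 := add_left_cancel (h3 (spineV l 0) 0)
      rw [treeSolution_zero, treeSolution_zero] at e1
      rw [e1]
    · rintro ⟨h, hh⟩
      -- Surjectivity: read g off the given function in the same way. What remains after adding the
      -- plane part has vanishing sums along the leaf cycle, hence depends only on the vertex.
      obtain ⟨g, hg⟩ : ∃ g : Fin (l + 2) → ZMod 2, ∀ n, g n =
        h (leafV l (n - 1)) ((if (n : ℕ) - 1 = 0 ∧ faceSide D n = false then 0 else 1) + 1) +
        h (leafV l (n - 1)) ((if (n : ℕ) - 1 = 0 ∧ faceSide D n = false then 0 else 1) - 1) := ⟨_, fun _ => rfl⟩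
      let k : Vertex l → ZMod 3 → ZMod 2 := fun v i => h v i + extendZero g (ringFace l D v i)
      have hk := eq_of_sums hD (k := k) (by
        intro v w i j hl
        have e1 := hl.sum_corners hD (extendZero g)
        have e2 : h v (i + 1) + h v (i - 1) = h w (j + 1) + h w (j - 1) := by
          have hl' := hl.nb_eq hD
          have e3 := hh v i j (by
            rw [show (ringPorts hD).nb v i = w from hl'.1]
            exact hl'.2)
          rw [show (ringPorts hD).nb v i = w from hl'.1] at e3
          have e4 : ∀ (f : ZMod 3 → ZMod 2) (j : ZMod 3) (c : Bool), f (j + sgn (xor (!true) c)) +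
              f (j + sgn (xor (!false) c)) = f (j + 1) + f (j - 1) := by decide
          rw [sub_eq_add_neg i]
          exact (congrArg₂ (· + ·) (e3 true) (e3 false)).trans (e4 (h w) j _)
        linear_combination e1 + e2)
        (by
        intro p s hp hs
        have e1 := hsum g ⟨openFace D s p, openFace_lt_add_two s hp⟩
        simp only [openFace_sub_one hD.zero hp hs, faceSide_openFace hD.zero] at e1
        have e2 := e1 hs
        simp only [hg, openFace_sub_one hD.zero hp hs, faceSide_openFace hD.zero] at e2
        simp only [k]
        linear_combination e2 + (h (leafV l p) ((if p = 0 ∧ s = false then 0 else 1) + 1) +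
          h (leafV l p) ((if p = 0 ∧ s = false then 0 else 1) - 1)) * h2)
      have hfun : h = fun v i => extendZero g (ringFace l D v i) + k v 0 := by
        funext v i
        rw [← hk v i]
        linear_combination (-extendZero g (ringFace l D v i)) * h2
      have hh' := hh
      rw [hfun, isFaceFun_extendZero_iff, treeEquations_iff] at hh'
      refine ⟨(k (spineV l 0) 0, ⟨g, hh'.2⟩), Subtype.ext ?_⟩
      simp only [hfun]
      rw [← hh'.1]

lemma card_ker_mulVecLin {N : ℕ} (M : Matrix (Fin N) (Fin N) (ZMod 2)) :
    Nat.card (LinearMap.ker M.mulVecLin) = 2 ^ (N - M.rank) := by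
  have h1 := LinearMap.finrank_range_add_finrank_ker M.mulVecLin
  rw [Module.finrank_fin_fun] at h1
  rw [Module.natCard_eq_pow_finrank (K := ZMod 2), Nat.card_zmod, Matrix.rank]
  congr 1
  omega

lemma card_vertex (l : ℕ) : Fintype.card (Vertex l) = 2 * l + 2 := by
  rw [Fintype.card_sum, Fintype.card_fin, Fintype.card_fin]
  omega

/-- The Euler genus is the rank of the overlap matrix. -/
theorem eulerGenus_system (hD : TwoSided l D) (b : Vertex l → Bool) (t : Fin (l + 2) → Bool) :
    ((ringPorts hD).system b (ringTwist l D t)).eulerGenus = (systemMatrix l D b t).rank := by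
  have h1 := (ringPorts hD).card_face b (ringTwist l D t)
  rw [← Nat.card_congr (faceFunKerEquiv hD b t), Nat.card_prod, Nat.card_zmod,
    card_ker_mulVecLin, ← pow_succ'] at h1
  -- Now |F| = (l + 2 - rank) + 1. With |V| = 2l + 2 and |E| = 3l + 3 the Euler genus comes out as
  -- the rank.
  have h2 := Nat.pow_right_injective le_rfl h1
  have h3 := (ringPorts hD).two_mul_card_edgeSet
  have h4 : (systemMatrix l D b t).rank ≤ l + 2 := by
    simpa using (systemMatrix l D b t).rank_le_card_width
  rw [card_vertex] at h3
  rw [RotationSystem.eulerGenus, h2, Nat.card_eq_fintype_card, card_vertex]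
  omega

end Solutions

/-- The Euler-genus polynomial as a sum over an enumeration of the `T`-rotation systems. -/
lemma eulerGenusPoly_eq_sum {V : Type*} {G T : SimpleGraph V} {ι : Type*} [Fintype ι]
    (e : ι ≃ {R : RotationSystem G // R.IsTRotation T}) (r : ι → ℕ)
    (hr : ∀ i, (e i).1.eulerGenus = r i) (hle : ∀ i, r i ≤ Nat.card G.edgeSet) :
    eulerGenusPoly G T = ∑ i, (X : ℤ[X]) ^ r i := by
  classical
  have h1 : ∀ j, embeddingCount G T j = (Finset.univ.filter fun i => r i = j).card := by
    intro j
    rw [embeddingCount, ← Fintype.card_subtype, ← Nat.card_eq_fintype_card]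
    refine (Nat.card_congr ((e.subtypeEquiv (p := fun i => r i = j)
      (q := fun R => R.1.eulerGenus = (j : ℤ)) fun i => ?_).trans
        (Equiv.subtypeSubtypeEquivSubtypeInter (fun R : RotationSystem G => R.IsTRotation T)
          fun R => R.eulerGenus = (j : ℤ)))).symm
    rw [hr]
    exact Nat.cast_inj.symm
  rw [← Finset.sum_fiberwise_of_maps_to (g := r) (t := Finset.range (Nat.card G.edgeSet + 1))
    (fun i _ => Finset.mem_range.2 (Nat.lt_succ_of_le (hle i))), eulerGenusPoly]
  refine Finset.sum_congr rfl fun j _ => ?_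
  rw [h1, Finset.sum_congr rfl (g := fun _ => (X : ℤ[X]) ^ j)
    (fun i hi => by rw [(Finset.mem_filter.1 hi).2]), Finset.sum_const, nsmul_eq_mul]
  simp

/-- The graph of the possible nonzero entries of the overlap matrix. -/
def faceGraph (D : ℕ → Bool) : SimpleGraph ℕ :=
  SimpleGraph.fromRel fun a c =>
    ∃ r, c = r + 1 ∧ (a = openFace D (!D r) r ∨ 1 ≤ r ∧ a = openFace D (D r) (r - 1))

/-! ### Every matrix on the support graph is an overlap matrix -/

section Overlap

variable {l : ℕ} {D : ℕ → Bool}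

lemma openFace_not_lt (h0 : D 0 = true) (r : ℕ) : openFace D (!D r) r < r + 1 :=
  openFace_lt h0 (by cases D r <;> decide)

lemma openFace_pred_lt {r : ℕ} (h : 1 ≤ r) : openFace D (D r) (r - 1) < r + 1 := by
  have := openFace_le D (D r) (r - 1)
  omega

lemma openFace_not_ne (h0 : D 0 = true) (r : ℕ) :
    openFace D (!D r) r ≠ openFace D (D r) (r - 1) :=
  openFace_ne h0 (by cases D r <;> decide) _ _

lemma lowEntry_eq_zero (h0 : D 0 = true) {y w : ℕ → ZMod 2} (hw : w 0 = 0) {n c : ℕ} (h : n ≤ c) :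
    lowEntry D y w n c = 0 := by
  rw [lowEntry]
  split_ifs with h1 h2 h3 h3
  · rfl
  · have := openFace_not_lt h0 (n - 1)
    omega
  · have := openFace_not_lt h0 (n - 1)
    omega
  · rcases Nat.eq_zero_or_pos (n - 1) with h4 | h4
    · rw [h4, hw, add_zero]
    · have := openFace_pred_lt (D := D) h4
      omega
  · rw [add_zero]

lemma lowEntry_succ (y w : ℕ → ZMod 2) (r c : ℕ) : lowEntry D y w (r + 1) c =
    (if openFace D (!D r) r = c then y r else 0) +
      if openFace D (D r) (r - 1) = c then w r else 0 := by
  rw [lowEntry, if_neg (by omega), Nat.add_sub_cancel]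

lemma faceMatrix_symm (y w : ℕ → ZMod 2) (t : Fin (l + 2) → ZMod 2) (i j : Fin (l + 2)) :
    faceMatrix l D y w t i j = faceMatrix l D y w t j i := by
  simp only [faceMatrix, Matrix.of_apply]
  by_cases h : i = j
  · rw [h]
  · rw [if_neg h, if_neg (Ne.symm h)]
    ring

lemma faceMatrix_diag (y w : ℕ → ZMod 2) (t : Fin (l + 2) → ZMod 2) (i : Fin (l + 2)) :
    faceMatrix l D y w t i i = t i := by
  rw [faceMatrix, Matrix.of_apply, if_pos rfl, add_assoc, CharTwo.add_self_eq_zero, add_zero]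

lemma faceMatrix_of_lt (h0 : D 0 = true) {y w : ℕ → ZMod 2} (hw : w 0 = 0)
    (t : Fin (l + 2) → ZMod 2) {r c : ℕ} (hr : r + 1 < l + 2) (hc : c < l + 2) (hcr : c < r + 1) :
    faceMatrix l D y w t ⟨r + 1, hr⟩ ⟨c, hc⟩ = (if openFace D (!D r) r = c then y r else 0) +
      if openFace D (D r) (r - 1) = c then w r else 0 := by
  simp only [faceMatrix, Matrix.of_apply]
  rw [if_neg (by rw [Fin.mk.injEq]; omega), zero_add, lowEntry_eq_zero h0 hw hcr.le, add_zero,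
    lowEntry_succ]

lemma faceMatrix_spine (h0 : D 0 = true) {y w : ℕ → ZMod 2} (hw : w 0 = 0)
    (t : Fin (l + 2) → ZMod 2) {r : ℕ} (hr : r ≤ l) :
    faceMatrix l D y w t ⟨r + 1, by omega⟩
      ⟨openFace D (!D r) r, openFace_lt_add_two _ hr⟩ = y r := by
  rw [faceMatrix_of_lt h0 hw t _ _ (openFace_not_lt h0 r), if_pos rfl,
    if_neg (openFace_not_ne h0 r).symm, add_zero]

lemma faceMatrix_pendant (h0 : D 0 = true) {y w : ℕ → ZMod 2} (hw : w 0 = 0)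
    (t : Fin (l + 2) → ZMod 2) {r : ℕ} (h1 : 1 ≤ r) (hr : r ≤ l) :
    faceMatrix l D y w t ⟨r + 1, by omega⟩
      ⟨openFace D (D r) (r - 1), openFace_lt_add_two _ (by omega)⟩ = w r := by
  rw [faceMatrix_of_lt h0 hw t _ _ (openFace_pred_lt h1), if_pos rfl,
    if_neg (openFace_not_ne h0 r), zero_add]

/-- The face r + 1 opens at position r, so its only earlier partners are the face opposite across
the spine and, for r ≥ 1, the face it replaces. -/
lemma faceGraph_adj_succ (h0 : D 0 = true) {c r : ℕ} (h : c < r + 1) :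
    (faceGraph D).Adj c (r + 1) ↔
      c = openFace D (!D r) r ∨ 1 ≤ r ∧ c = openFace D (D r) (r - 1) := by
  rw [faceGraph, SimpleGraph.fromRel_adj]
  constructor
  · rintro ⟨-, ⟨q, hq, h1⟩ | ⟨q, hq, h1⟩⟩
    · obtain rfl : r = q := by omega
      exact h1
    · exfalso
      rcases h1 with h1 | ⟨h2, h1⟩
      · have := openFace_not_lt h0 q
        omega
      · have := openFace_pred_lt (D := D) h2
        omega
  · intro h1
    exact ⟨by omega, Or.inl ⟨r, rfl, h1⟩⟩

lemma faceMatrix_mem_supported (hD : TwoSided l D) {y w : ℕ → ZMod 2} (hw : w 0 = 0)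
    (t : Fin (l + 2) → ZMod 2) : faceMatrix l D y w t ∈
      supported ((faceGraph D).comap (Fin.valEmbedding (n := l + 2))) Finset.univ := by
  rw [mem_supported]
  refine ⟨faceMatrix_symm y w t, fun i j hij => ⟨Finset.mem_univ _, Finset.mem_univ _, ?_⟩⟩
  have key : ∀ i j : Fin (l + 2), (j : ℕ) < i → faceMatrix l D y w t i j ≠ 0 →
      (faceGraph D).Adj j i := by
    rintro ⟨i, hi⟩ ⟨j, hj⟩ hlt h
    simp only at hlt
    obtain ⟨r, rfl⟩ : ∃ r, i = r + 1 := ⟨i - 1, by omega⟩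
    rw [faceMatrix_of_lt hD.zero hw t hi hj hlt] at h
    rw [faceGraph_adj_succ hD.zero hlt]
    by_contra h1
    push Not at h1
    apply h
    rw [if_neg (Ne.symm h1.1), zero_add]
    split_ifs with h2
    · rcases Nat.eq_zero_or_pos r with rfl | h3
      · exact hw
      · exact absurd h2.symm (h1.2 h3)
    · rfl
  rcases lt_trichotomy (i : ℕ) j with h | h | h
  · rw [faceMatrix_symm] at hij
    exact Or.inr (key j i h hij)
  · exact Or.inl (Fin.ext h)
  · exact Or.inr (key i j h hij).symm

lemma reversal_injective (l : ℕ) (D : ℕ → Bool) : Function.Injective (reversal l D) := by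
  intro b b' h
  funext v
  have h1 := bit_injective (congrFun h v)
  revert h1
  generalize b v = x
  generalize b' v = x'
  generalize ringOri l D v = o
  cases x <;> cases x' <;> cases o <;> decide

/-- Along the spanning tree, the value at v_0 and the differences along the edges determine all
reversal bits. -/
lemma reversal_ext {b b' : Vertex l → Bool} (h0 : b (spineV l 0) = b' (spineV l 0))
    (hy : ∀ r ≤ l, spineEntry l D b r = spineEntry l D b' r)
    (hw : ∀ p, 1 ≤ p → p ≤ l → pendantEntry l D b p = pendantEntry l D b' p) : b = b' := by
  have hs : ∀ p ≤ l + 1, reversal l D b (spineV l p) = reversal l D b' (spineV l p) := by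
    intro p
    induction p with
    | zero => intro _; rw [reversal, reversal, h0]
    | succ p ih =>
      intro hp
      have h1 := hy p (by omega)
      rw [spineEntry, spineEntry, ih (by omega)] at h1
      exact add_left_cancel h1
  apply reversal_injective l D
  funext v
  rcases vertex_cases v with ⟨p, h5, h6, rfl⟩ | ⟨p, h5, rfl⟩
  · exact hs p (by omega)
  · rcases Nat.eq_zero_or_pos p with rfl | h6
    · exact hs 0 h5
    · rcases h5.lt_or_eq with h7 | rfl
      · have h1 := hw p h6 (by omega)
        rw [pendantEntry, pendantEntry, hs p h5] at h1
        exact add_left_cancel h1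
      · rw [leafV_last]
        exact hs _ h5

/-- Conversely the differences are free: sum them along the spine and add the pendant difference at
each leaf. -/
lemma exists_reversal (l : ℕ) (D : ℕ → Bool) (c : Bool) (y w : ℕ → ZMod 2) :
    ∃ b : Vertex l → Bool, b (spineV l 0) = c ∧ (∀ r ≤ l, spineEntry l D b r = y r) ∧
      ∀ p, 1 ≤ p → p ≤ l → pendantEntry l D b p = w p := by
  have h2 := CharTwo.two_eq_zero (R := ZMod 2)
  let S : ℕ → ZMod 2 := fun p => bit (xor c (ringOri l D (spineV l 0))) + ∑ r ∈ Finset.range p, y r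
  let ρ : Vertex l → ZMod 2 := byKind S fun p => S p + if 1 ≤ p ∧ p ≤ l then w p else 0
  obtain ⟨b', hb'⟩ : ∃ b' : Vertex l → Bool, ∀ v, bit (b' v) = ρ v :=
    ⟨fun v => (bit_surjective (ρ v)).choose, fun v => (bit_surjective (ρ v)).choose_spec⟩
  have hρ : ∀ v, reversal l D (fun v => xor (b' v) (ringOri l D v)) v = ρ v := by
    intro v
    rw [reversal, Bool.xor_assoc, Bool.xor_self, Bool.xor_false, hb']
  have hS : ∀ p ≤ l + 1, ρ (spineV l p) = S p := by
    intro p hp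
    rcases Nat.eq_zero_or_pos p with rfl | h6
    · simp only [ρ]
      rw [← leafV_zero, byKind_leafV _ _ hp, if_neg (by omega), add_zero]
    · rcases hp.lt_or_eq with h7 | rfl
      · simp only [ρ]
        rw [byKind_spineV _ _ h6 (by omega)]
      · simp only [ρ]
        rw [← leafV_last, byKind_leafV _ _ hp, if_neg (by omega), add_zero]
  refine ⟨fun v => xor (b' v) (ringOri l D v), ?_, fun r hr => ?_, fun p h1 hp => ?_⟩
  · have h1 := hS 0 (Nat.zero_le _)
    rw [← hb'] at h1
    simp only [S, Finset.range_zero, Finset.sum_empty, add_zero] at h1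
    simp only [bit_injective h1, Bool.xor_assoc, Bool.xor_self, Bool.xor_false]
  · rw [spineEntry, hρ, hρ, hS r (by omega), hS (r + 1) (by omega)]
    simp only [S]
    rw [Finset.sum_range_succ]
    linear_combination (bit (xor c (ringOri l D (spineV l 0))) + ∑ r ∈ Finset.range r, y r) * h2
  · rw [pendantEntry, hρ, hρ, hS p (by omega)]
    simp only [ρ]
    rw [byKind_leafV _ _ (by omega), if_pos ⟨h1, hp⟩]
    linear_combination S p * h2

/-- Different tree edges occupy different positions below the diagonal, so the entries there can be
prescribed independently; the twists supply the diagonal. -/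
lemma exists_systemMatrix_eq (hD : TwoSided l D) (c : Bool)
    {N : Matrix (Fin (l + 2)) (Fin (l + 2)) (ZMod 2)}
    (hN : N ∈ supported ((faceGraph D).comap (Fin.valEmbedding (n := l + 2))) Finset.univ) :
    ∃ b t, b (spineV l 0) = c ∧ systemMatrix l D b t = N := by
  rw [mem_supported] at hN
  obtain ⟨hsymm, hsupp⟩ := hN
  let E : ℕ → ℕ → ZMod 2 := fun i j =>
    if h : i < l + 2 ∧ j < l + 2 then N ⟨i, h.1⟩ ⟨j, h.2⟩ else 0
  obtain ⟨b, h0, h1, h2⟩ := exists_reversal l D c (fun r => E (r + 1) (openFace D (!D r) r))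
    (fun r => E (r + 1) (openFace D (D r) (r - 1)))
  refine ⟨b, fun n => (bit_surjective (N n n)).choose, h0, ?_⟩
  have key : ∀ i j : Fin (l + 2), (j : ℕ) < i →
      systemMatrix l D b (fun n => (bit_surjective (N n n)).choose) i j = N i j := by
    rintro ⟨i, hi⟩ ⟨j, hj⟩ hlt
    simp only at hlt
    obtain ⟨r, rfl⟩ : ∃ r, i = r + 1 := ⟨i - 1, by omega⟩
    rw [systemMatrix, faceMatrix_of_lt hD.zero (pendantEntry_zero b) _ hi hj hlt]
    by_cases h3 : openFace D (!D r) r = j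
    · rw [if_pos h3, if_neg (by rw [← h3]; exact (openFace_not_ne hD.zero r).symm), add_zero,
        h1 r (by omega), h3]
      exact dif_pos ⟨hi, hj⟩
    · rw [if_neg h3, zero_add]
      rcases Nat.eq_zero_or_pos r with rfl | h5
      · rw [pendantEntry_zero, ite_self]
        by_contra h4
        rcases (hsupp _ _ (Ne.symm h4)).2.2 with h6 | h6
        · rw [Fin.mk.injEq] at h6
          omega
        · rcases (faceGraph_adj_succ hD.zero hlt).1 h6.symm with h7 | h7
          · exact h3 h7.symm
          · omega
      · split_ifs with h4
        · rw [h2 r h5 (by omega), h4]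
          exact dif_pos ⟨hi, hj⟩
        · by_contra h8
          rcases (hsupp _ _ (Ne.symm h8)).2.2 with h6 | h6
          · rw [Fin.mk.injEq] at h6
            omega
          · rcases (faceGraph_adj_succ hD.zero hlt).1 h6.symm with h7 | h7
            · exact h3 h7.symm
            · exact h4 h7.2.symm
  ext i j
  rcases lt_trichotomy (i : ℕ) j with h | h | h
  · rw [hsymm, ← key j i h]
    exact faceMatrix_symm _ _ _ _ _
  · obtain rfl : i = j := Fin.ext h
    rw [systemMatrix, faceMatrix_diag]
    exact (bit_surjective (N i i)).choose_spec
  · exact key i j h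

/-- The Euler-genus polynomial as the rank polynomial of the overlap matrices. -/
theorem eulerGenusPoly_ringHalin (hD : TwoSided l D) :
    eulerGenusPoly (ringHalin l D) (caterpillar l)
      = 2 * rankSumNat (faceGraph D) (Finset.range (l + 2)) := by
  classical
  rw [eulerGenusPoly_eq_sum ((ringPorts hD).treeSystemEquiv (caterpillar l) (ringEdge l D)
    (ringEdge_injective hD) (mem_caterpillar_iff hD)) (fun q => (systemMatrix l D q.1 q.2).rank)
    (fun q => eulerGenus_system hD q.1 q.2) (fun q => ?_)]
  · have h1 : Finset.range (l + 2) = Finset.univ.map (Fin.valEmbedding (n := l + 2)) := by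
      ext n
      simp only [Finset.mem_range, Finset.mem_map, Finset.mem_univ, true_and,
        Fin.valEmbedding_apply]
      exact ⟨fun h => ⟨⟨n, h⟩, rfl⟩, by rintro ⟨i, rfl⟩; exact i.2⟩
    rw [h1, ← rankSum_comap_nat, rankSum]
    have h2 : (2 : ℤ[X]) * ∑ M ∈ supported ((faceGraph D).comap (Fin.valEmbedding (n := l + 2)))
        Finset.univ, X ^ M.rank = ∑ q ∈ (Finset.univ : Finset Bool) ×ˢ supported
          ((faceGraph D).comap (Fin.valEmbedding (n := l + 2))) Finset.univ, X ^ q.2.rank := by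
      rw [Finset.sum_product]
      simp
    rw [h2]
    -- A rotation system is encoded bijectively by its overlap matrix and one bit, the rotation at
    -- v_0; this bit accounts for the factor 2.
    refine Finset.sum_nbij (fun q => (q.1 (spineV l 0), systemMatrix l D q.1 q.2)) ?_ ?_ ?_ ?_
    · intro q _
      exact Finset.mem_product.2 ⟨Finset.mem_univ _,
        faceMatrix_mem_supported hD (pendantEntry_zero _) _⟩
    · rintro ⟨b, t⟩ _ ⟨b', t'⟩ _ h
      simp only [Prod.mk.injEq] at h
      obtain ⟨h3, h4⟩ := h
      simp only [systemMatrix] at h4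
      have hb : b = b' := by
        refine reversal_ext (D := D) h3 (fun r hr => ?_) fun p h5 hp => ?_
        · rw [← faceMatrix_spine hD.zero (pendantEntry_zero b) (y := spineEntry l D b) (fun n => bit (t n)) hr, h4,
            faceMatrix_spine hD.zero (pendantEntry_zero b') _ hr]
        · rw [← faceMatrix_pendant hD.zero (pendantEntry_zero b) (y := spineEntry l D b)
            (fun n => bit (t n)) h5 hp, h4,
            faceMatrix_pendant hD.zero (pendantEntry_zero b') _ h5 hp]
      subst hb
      congr 1
      funext n
      apply bit_injective
      rw [← faceMatrix_diag (spineEntry l D b) (pendantEntry l D b) (fun n => bit (t n)) n, h4,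
        faceMatrix_diag]
    · rintro ⟨c, N⟩ h
      obtain ⟨b, t, h3, h4⟩ := exists_systemMatrix_eq hD c (Finset.mem_product.1 h).2
      exact ⟨(b, t), Finset.mem_univ _, by simp only [h3, h4]⟩
    · intro q _
      rfl
  · have h1 := (ringPorts hD).two_mul_card_edgeSet
    have h2 : (systemMatrix l D q.1 q.2).rank ≤ l + 2 := by
      simpa using (systemMatrix l D q.1 q.2).rank_le_card_width
    rw [card_vertex] at h1
    omega

end Overlap

/-! ### The face adjacencies of `H_{m_1,…,m_k}` form the strip of fans -/

section Identification

/-- The directions of the pendant edges, with the convention for the last position. -/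
def pendantDir (k : ℕ) (m : ℕ → ℕ) (p : ℕ) : Bool :=
  if p = spineLength k m + 1 then false else direction k m p

/-- The last position lies on both sides anyway, so its direction may be set to the value that
`TwoSided` requires. -/
lemma onSide_iff (k : ℕ) (m : ℕ → ℕ) (s : Bool) (p : ℕ) :
    OnSide k m s p ↔ SideAt (spineLength k m) (pendantDir k m) s p := by
  rw [OnSide, SideAt, pendantDir]
  refine or_congr_right ?_
  by_cases h : p = spineLength k m + 1
  · simp [h]
  · rw [if_neg h]

lemma eulerPoly_eq_ringHalin (k : ℕ) (m : ℕ → ℕ) :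
    eulerPoly k m = eulerGenusPoly (ringHalin (spineLength k m) (pendantDir k m))
      (caterpillar (spineLength k m)) := by
  rw [eulerPoly, halinGraph, ringHalin, outerCycle, ringGraph]
  simp only [onSide_iff]

variable {K : ℕ} {m : ℕ → ℕ}

/-- The inner runs have length m_i + 1, the same as the distance between successive centres. The
first run is one shorter, so the runs end just before the centres. -/
lemma runEnd_add_one {i : ℕ} (h1 : 1 ≤ i) (h2 : i ≤ K) : runEnd (K + 1) m i + 1 = start m i := by
  induction i, h1 using Nat.le_induction with
  | base => simp [runEnd, runLength, start]
  | succ i h1 ih =>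
    have h3 := ih (by omega)
    rw [start_succ, ← h3, runEnd, Finset.sum_Icc_succ_top (by omega), runLength,
      if_neg (by omega), runEnd]
    omega

lemma spineLength_add_two (hK : 1 ≤ K) :
    spineLength (K + 1) m + 2 = start m K + 1 + m (K + 1) := by
  have h1 := runEnd_add_one (m := m) hK le_rfl
  rw [spineLength, ← h1, runEnd, Finset.sum_Icc_succ_top (by omega), runEnd]
  rw [show runLength (K + 1) m (K + 1) = m (K + 1) by rw [runLength, if_pos (Or.inr rfl)]]
  omega

/-- The positions from `start m c` up to the next centre form the run c + 1, with position 0 counted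
in the first run, and the sides alternate. -/
lemma pendantDir_eq {c p : ℕ} (hp : p ≤ spineLength (K + 1) m) (hc : c ≤ K)
    (h1 : start m c ≤ p) (h2 : c < K → p < start m (c + 1)) :
    pendantDir (K + 1) m p = decide (Even c) := by
  have h3 : (Finset.Icc 1 (K + 1)).filter (fun i => runEnd (K + 1) m i < p) = Finset.Icc 1 c := by
    ext i
    rw [Finset.mem_filter, Finset.mem_Icc, Finset.mem_Icc]
    constructor
    · rintro ⟨⟨h4, h5⟩, h6⟩
      refine ⟨h4, ?_⟩
      by_contra h7
      rcases h5.lt_or_eq with h8 | rfl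
      · have h9 := runEnd_add_one (m := m) h4 (show i ≤ K by omega)
        have := (start_mono m).monotone (show c + 1 ≤ i by omega)
        have := h2 (by omega)
        omega
      · rw [spineLength] at hp
        omega
    · rintro ⟨h4, h5⟩
      have h9 := runEnd_add_one (m := m) h4 (show i ≤ K by omega)
      have := (start_mono m).monotone h5
      omega
  rw [pendantDir, if_neg (by omega), direction, h3, Nat.card_Icc, Nat.add_sub_cancel]

/-- The run of a position. -/
lemma exists_run (m : ℕ → ℕ) (K p : ℕ) :
    ∃ c ≤ K, start m c ≤ p ∧ (c < K → p < start m (c + 1)) := by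
  induction K with
  | zero => exact ⟨0, le_rfl, by rw [start_zero]; omega, fun h => absurd h (lt_irrefl 0)⟩
  | succ K ih =>
    by_cases h : start m (K + 1) ≤ p
    · exact ⟨K + 1, le_rfl, h, fun h => absurd h (lt_irrefl _)⟩
    · obtain ⟨c, h1, h2, h3⟩ := ih
      refine ⟨c, by omega, h2, fun h4 => ?_⟩
      rcases h1.lt_or_eq with h5 | rfl
      · exact h3 h5
      · omega

lemma not_decide_even_succ (c : ℕ) : (!decide (Even (c + 1))) = decide (Even c) := by
  by_cases h : Even c <;> simp [Nat.even_add_one, h]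

lemma decide_even_succ (c : ℕ) : decide (Even (c + 1)) = !decide (Even c) := by
  by_cases h : Even c <;> simp [Nat.even_add_one, h]

/-- Two runs are needed: position 1 belongs to the first run and points up, and `start m 1` begins
the second, which points down. -/
lemma twoSided (hK : 1 ≤ K) (hm : ∀ j, 1 ≤ j → j ≤ K + 1 → 1 ≤ m j) :
    TwoSided (spineLength (K + 1) m) (pendantDir (K + 1) m) := by
  have hl := spineLength_add_two (m := m) hK
  have h1 := start_succ m 0
  have h2 := (start_mono m).monotone hK
  have h3 := hm 1 le_rfl (by omega)
  have h4 := hm (K + 1) (by omega) le_rfl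
  have h5 := start_zero m
  have h6 : ∀ c, start m c < start m (c + 1) := fun c => start_mono m (Nat.lt_succ_self c)
  have h7 := h6 1
  rw [zero_add] at h1
  refine ⟨?_, if_pos rfl, fun s => ?_⟩
  · rw [pendantDir_eq (c := 0) (Nat.zero_le _) (Nat.zero_le _) (by omega) (fun _ => by rw [zero_add]; omega)]
    rfl
  · cases s
    · refine ⟨start m 1, by omega, by omega, ?_⟩
      rw [pendantDir_eq (c := 1) (by omega) hK le_rfl (fun _ => h7)]
      rfl
    · refine ⟨1, le_rfl, by omega, ?_⟩
      rw [pendantDir_eq (c := 0) (by omega) (by omega) (by omega) (fun _ => by rw [zero_add]; omega)]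
      rfl

/-- During a run the face on the side away from its leaves stays open. It was opened by the last
leaf of the preceding run, at position `start m c - 1`, and so has the label `start m c`: this is
why a run produces a fan with that centre. -/
lemma openFace_pendantDir (hK : 1 ≤ K) (hm : ∀ j, 1 ≤ j → j ≤ K + 1 → 1 ≤ m j) {c p : ℕ}
    (hp : p ≤ spineLength (K + 1) m) (hc : c ≤ K) (h1 : start m c ≤ p)
    (h2 : c < K → p < start m (c + 1)) :
    openFace (pendantDir (K + 1) m) (!decide (Even c)) p = start m c := by
  have h6 : ∀ c, start m c < start m (c + 1) := fun c => start_mono m (Nat.lt_succ_self c)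
  induction p generalizing c with
  | zero =>
    rcases Nat.eq_zero_or_pos c with rfl | h3
    · rw [start_zero]; rfl
    · have := start_mono m h3
      omega
  | succ p ih =>
    have hdir := pendantDir_eq hp hc h1 h2
    rw [openFace_succ (by rw [hdir]; cases decide (Even c) <;> decide)]
    rcases h1.lt_or_eq with h3 | h3
    · exact ih (by omega) hc (by omega) (fun h => by have := h2 h; omega)
    · obtain ⟨c, rfl⟩ : ∃ c', c = c' + 1 := by
        refine ⟨c - 1, ?_⟩
        rcases Nat.eq_zero_or_pos c with rfl | h4
        · rw [start_zero] at h3; omega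
        · omega
      have h7 := h6 c
      rw [not_decide_even_succ, openFace_self (twoSided hK hm).zero, h3]
      exact pendantDir_eq (by omega) (by omega) (by omega) (fun _ => by omega)

/-- Inside a run, the face r + 1 meets the opposite face, which is the centre, and its predecessor
r. At the beginning of a later run the roles change: the opposite face is the predecessor, and the
replaced face is the previous centre. -/
lemma faceGraph_adj_iff_strip (hK : 1 ≤ K) (hm : ∀ j, 1 ≤ j → j ≤ K + 1 → 1 ≤ m j) {a r : ℕ}
    (hr : r ≤ spineLength (K + 1) m) (ha : a < r + 1) :
    (faceGraph (pendantDir (K + 1) m)).Adj a (r + 1) ↔ (strip K m).Adj a (r + 1) := by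
  have hD := twoSided hK hm
  have h6 : ∀ c, start m c < start m (c + 1) := fun c => start_mono m (Nat.lt_succ_self c)
  obtain ⟨c, hc, h1, h2⟩ := exists_run m K r
  have hdir := pendantDir_eq hr hc h1 h2
  rw [faceGraph_adj_succ hD.zero ha, strip_adj_of_lt ha, hdir,
    openFace_pendantDir hK hm hr hc h1 h2]
  rcases h1.lt_or_eq with h3 | h3
  · have hdir' := pendantDir_eq (show r - 1 ≤ spineLength (K + 1) m by omega) hc
      (show start m c ≤ r - 1 by omega) (fun h => by have := h2 h; omega)
    rw [openFace_self hD.zero hdir']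
    constructor
    · rintro (rfl | h4)
      · exact Or.inr ⟨c, hc, rfl, by omega, fun h => by have := h2 h; omega⟩
      · exact Or.inl (by omega)
    · rintro (h4 | ⟨i, hi, rfl, h4, h5⟩)
      · exact Or.inr (by omega)
      · left
        rcases lt_trichotomy i c with h7 | rfl | h7
        · have := h5 (by omega)
          have := (start_mono m).monotone (show i + 1 ≤ c by omega)
          omega
        · rfl
        · have := h2 (by omega)
          have := (start_mono m).monotone (show c + 1 ≤ i by omega)
          omega
  · rcases Nat.eq_zero_or_pos c with rfl | h0
    · rw [start_zero] at h3
      subst h3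
      constructor
      · intro _
        exact Or.inl (by omega)
      · intro _
        exact Or.inl (by rw [start_zero]; omega)
    · obtain ⟨c, rfl⟩ : ∃ c', c = c' + 1 := ⟨c - 1, by omega⟩
      have h7 := h6 c
      rw [decide_even_succ, openFace_pendantDir hK hm (by omega) (show c ≤ K by omega)
        (show start m c ≤ r - 1 by omega) (fun _ => by omega)]
      constructor
      · rintro (h4 | ⟨-, rfl⟩)
        · exact Or.inl (by omega)
        · exact Or.inr ⟨c, by omega, rfl, by omega, fun h => by omega⟩
      · rintro (h4 | ⟨i, hi, rfl, h4, h5⟩)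
        · exact Or.inl (by omega)
        · refine Or.inr ⟨by omega, ?_⟩
          rcases lt_trichotomy i c with h8 | rfl | h8
          · have := h5 (by omega)
            have := (start_mono m).monotone (show i + 1 ≤ c by omega)
            omega
          · rfl
          · have := (start_mono m).monotone (show c + 1 ≤ i by omega)
            omega

/-- The Euler-genus polynomial of a cubic caterpillar-Halin graph as a rank polynomial. -/
theorem eulerPoly_eq (hK : 1 ≤ K) (hm : ∀ j, 1 ≤ j → j ≤ K + 1 → 1 ≤ m j) :
    eulerPoly (K + 1) m = 2 * fanSum K m (m (K + 1)) := by
  rw [eulerPoly_eq_ringHalin, eulerGenusPoly_ringHalin (twoSided hK hm), fanSum,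
    spineLength_add_two hK]
  congr 1
  refine rankSumNat_congr fun i hi j hj => ?_
  rw [← spineLength_add_two hK, Finset.mem_range] at hi hj
  rcases lt_trichotomy i j with h | rfl | h
  · obtain ⟨r, rfl⟩ : ∃ r, j = r + 1 := ⟨j - 1, by omega⟩
    exact faceGraph_adj_iff_strip hK hm (by omega) h
  · simp
  · obtain ⟨r, rfl⟩ : ∃ r, i = r + 1 := ⟨i - 1, by omega⟩
    rw [SimpleGraph.adj_comm, (strip K m).adj_comm]
    exact faceGraph_adj_iff_strip hK hm (by omega) h

end Identification

/-! ### Power series by layers -/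

/-- The exponents of the monomials of a generating function in `t_1, …, t_k`. -/
def IsExponent (k : ℕ) (n : ℕ → ℕ) : Prop :=
  (∀ j, n j ≠ 0 → 1 ≤ j ∧ j ≤ k) ∧ ∀ j, 1 ≤ j → j + 1 ≤ k → 1 ≤ n j

open Classical in
/-- The series in `t_1, …, t_k` whose coefficients are given as functions of the exponents of
`t_1, …, t_{k-1}` and the exponent of `t_k`. -/
def layer (k : ℕ) (g : (ℕ → ℕ) → ℕ → ℤ[X]) : Series := fun n =>
  if IsExponent k n then g (Function.update n k 0) (n k) else 0

section Layers

variable {k : ℕ} {g h : (ℕ → ℕ) → ℕ → ℤ[X]}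

lemma coeff_layer_pos {n : ℕ →₀ ℕ} (hn : IsExponent k n) :
    MvPowerSeries.coeff n (layer k g) = g (Function.update n k 0) (n k) := if_pos hn

lemma coeff_layer_neg {n : ℕ →₀ ℕ} (hn : ¬ IsExponent k n) :
    MvPowerSeries.coeff n (layer k g) = 0 := if_neg hn

/-- Only exponents that are positive in all earlier variables contribute, so the hypothesis m_j ≥ 1
is available when coefficients are compared. -/
lemma layer_congr (H : ∀ n r, (∀ j, 1 ≤ j → j + 1 ≤ k → 1 ≤ n j) → g n r = h n r) :
    layer k g = layer k h := by
  ext1 n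
  by_cases hn : IsExponent k n
  · rw [coeff_layer_pos hn, coeff_layer_pos hn]
    refine H _ _ fun j h1 h2 => ?_
    rw [Function.update_of_ne (by omega)]
    exact hn.2 j h1 h2
  · rw [coeff_layer_neg hn, coeff_layer_neg hn]

lemma layer_add : layer k g + layer k h = layer k fun n r => g n r + h n r := by
  ext1 n
  by_cases hn : IsExponent k n
  · rw [map_add, coeff_layer_pos hn, coeff_layer_pos hn, coeff_layer_pos hn]
  · rw [map_add, coeff_layer_neg hn, coeff_layer_neg hn, coeff_layer_neg hn, add_zero]

lemma C_mul_layer (a : ℤ[X]) :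
    MvPowerSeries.C a * layer k g = layer k fun n r => a * g n r := by
  ext1 n
  rw [MvPowerSeries.coeff_C_mul]
  by_cases hn : IsExponent k n
  · rw [coeff_layer_pos hn, coeff_layer_pos hn]
  · rw [coeff_layer_neg hn, coeff_layer_neg hn, mul_zero]

lemma coeff_X_mul_series (i : ℕ) (f : Series) (n : ℕ →₀ ℕ) :
    MvPowerSeries.coeff n (MvPowerSeries.X i * f)
      = if 1 ≤ n i then MvPowerSeries.coeff (n - Finsupp.single i 1) f else 0 := by
  rw [MvPowerSeries.X_def, MvPowerSeries.coeff_monomial_mul, one_mul]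
  simp only [Finsupp.single_le_iff]

lemma coe_sub_single (n : ℕ →₀ ℕ) (i : ℕ) :
    ((n - Finsupp.single i 1 : ℕ →₀ ℕ) : ℕ → ℕ) = Function.update n i (n i - 1) := by
  funext j
  by_cases h : j = i
  · subst h
    simp
  · rw [Function.update_of_ne h, Finsupp.tsub_apply, Finsupp.single_eq_of_ne h, Nat.sub_zero]

lemma X_mul_layer (hk : 1 ≤ k) : MvPowerSeries.X k * layer k g
    = layer k fun n r => if r = 0 then 0 else g n (r - 1) := by
  ext1 n
  rw [coeff_X_mul_series]
  have hiff : 1 ≤ n k → (IsExponent k ((n - Finsupp.single k 1 : ℕ →₀ ℕ) : ℕ → ℕ) ↔ IsExponent k n) := by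
    intro h1
    rw [coe_sub_single]
    refine and_congr ⟨fun h j hj => ?_, fun h j hj => ?_⟩ ⟨fun h j h2 h3 => ?_, fun h j h2 h3 => ?_⟩
    · by_cases h4 : j = k
      · omega
      · exact h j (by rwa [Function.update_of_ne h4])
    · by_cases h4 : j = k
      · omega
      · exact h j (by rwa [Function.update_of_ne h4] at hj)
    · have := h j h2 h3
      rwa [Function.update_of_ne (by omega)] at this
    · rw [Function.update_of_ne (by omega)]
      exact h j h2 h3
  by_cases hn : IsExponent k n
  · rw [coeff_layer_pos hn]
    by_cases h1 : 1 ≤ n k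
    · rw [if_pos h1, if_neg (by omega), coeff_layer_pos ((hiff h1).2 hn), coe_sub_single,
        Function.update_idem, Function.update_self]
    · rw [if_neg h1, if_pos (by omega)]
  · rw [coeff_layer_neg hn]
    split_ifs with h1
    · exact coeff_layer_neg fun h2 => hn ((hiff h1).1 h2)
    · rfl

/-- Multiplication by a new variable places a series in t_1, …, t_k into the linear part of the next
layer. That layer demands a positive exponent of t_k, hence `hg`. -/
lemma X_succ_mul_layer (hk : 1 ≤ k) (hg : ∀ n, g n 0 = 0) : MvPowerSeries.X (k + 1) * layer k g
    = layer (k + 1) fun n r => if r = 1 ∧ 1 ≤ n k then g (Function.update n k 0) (n k) else 0 := by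
  ext1 n
  rw [coeff_X_mul_series]
  have hupd : Function.update (⇑n) (k + 1) 0 k = n k := Function.update_of_ne (by omega) _ _
  by_cases h0 : 1 ≤ n k
  · have hiff : 1 ≤ n (k + 1) → (IsExponent k ((n - Finsupp.single (k + 1) 1 : ℕ →₀ ℕ) : ℕ → ℕ) ↔
        IsExponent (k + 1) n ∧ n (k + 1) = 1) := by
      intro h1
      rw [coe_sub_single]
      constructor
      · rintro ⟨h2, h3⟩
        refine ⟨⟨fun j hj => ?_, fun j h4 h5 => ?_⟩, ?_⟩
        · by_cases h4 : j = k + 1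
          · omega
          · have := h2 j (by rwa [Function.update_of_ne h4])
            omega
        · by_cases h6 : j = k
          · rw [h6]; exact h0
          · have := h3 j h4 (by omega)
            rwa [Function.update_of_ne (by omega)] at this
        · by_contra h4
          have := h2 (k + 1) (by rw [Function.update_self]; omega)
          omega
      · rintro ⟨⟨h2, h3⟩, h4⟩
        refine ⟨fun j hj => ?_, fun j h4 h5 => ?_⟩
        · by_cases h5 : j = k + 1
          · rw [h5, Function.update_self, h4] at hj
            exact absurd rfl hj
          · rw [Function.update_of_ne h5] at hj
            have := h2 j hj
            omega
        · rw [Function.update_of_ne (by omega)]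
          exact h3 j h4 (by omega)
    by_cases hn : IsExponent (k + 1) n ∧ n (k + 1) = 1
    · rw [coeff_layer_pos hn.1, if_pos hn.2.ge, coeff_layer_pos ((hiff hn.2.ge).2 hn), hupd,
        if_pos ⟨hn.2, h0⟩, coe_sub_single, hn.2, Function.update_of_ne (by omega)]
    · have h2 : MvPowerSeries.coeff n (layer (k + 1) fun n r =>
          if r = 1 ∧ 1 ≤ n k then g (Function.update n k 0) (n k) else 0) = 0 := by
        by_cases h3 : IsExponent (k + 1) n
        · rw [coeff_layer_pos h3, if_neg fun h4 => hn ⟨h3, h4.1⟩]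
        · exact coeff_layer_neg h3
      rw [h2]
      split_ifs with h1
      · exact coeff_layer_neg fun h4 => hn ((hiff h1).1 h4)
      · rfl
  · have h2 : MvPowerSeries.coeff n (layer (k + 1) fun n r =>
        if r = 1 ∧ 1 ≤ n k then g (Function.update n k 0) (n k) else 0) = 0 := by
      by_cases h3 : IsExponent (k + 1) n
      · rw [coeff_layer_pos h3, hupd, if_neg fun h4 => h0 h4.2]
      · exact coeff_layer_neg h3
    rw [h2]
    split_ifs with h1
    · by_cases h3 : IsExponent k ((n - Finsupp.single (k + 1) 1 : ℕ →₀ ℕ) : ℕ → ℕ)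
      · rw [coeff_layer_pos h3, coe_sub_single, Function.update_of_ne (by omega),
          show n k = 0 by omega, hg]
      · exact coeff_layer_neg h3
    · rfl

/-- Shifts the exponent of the last but one variable. Since that exponent is at least 1 beforehand,
it is at least 2 afterwards; this stands in for the division by t_k. -/
lemma X_mul_layer_succ (hk : 1 ≤ k) : MvPowerSeries.X k * layer (k + 1) g
    = layer (k + 1) fun n r => if 2 ≤ n k then g (Function.update n k (n k - 1)) r else 0 := by
  ext1 n
  rw [coeff_X_mul_series]
  have hupd : Function.update (⇑n) (k + 1) 0 k = n k := Function.update_of_ne (by omega) _ _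
  have hiff : 1 ≤ n k → (IsExponent (k + 1) ((n - Finsupp.single k 1 : ℕ →₀ ℕ) : ℕ → ℕ) ↔
      IsExponent (k + 1) n ∧ 2 ≤ n k) := by
    intro h1
    rw [coe_sub_single]
    constructor
    · rintro ⟨h2, h3⟩
      refine ⟨⟨fun j hj => ?_, fun j h4 h5 => ?_⟩, ?_⟩
      · by_cases h4 : j = k
        · omega
        · exact h2 j (by rwa [Function.update_of_ne h4])
      · by_cases h6 : j = k
        · rw [h6]; exact h1
        · have := h3 j h4 h5
          rwa [Function.update_of_ne h6] at this
      · have := h3 k hk le_rfl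
        rw [Function.update_self] at this
        omega
    · rintro ⟨⟨h2, h3⟩, h4⟩
      refine ⟨fun j hj => ?_, fun j h4 h5 => ?_⟩
      · by_cases h5 : j = k
        · omega
        · rw [Function.update_of_ne h5] at hj
          exact h2 j hj
      · by_cases h6 : j = k
        · rw [h6, Function.update_self]; omega
        · rw [Function.update_of_ne h6]
          exact h3 j h4 h5
  by_cases hn : IsExponent (k + 1) n ∧ 2 ≤ n k
  · rw [coeff_layer_pos hn.1, hupd, if_pos hn.2, if_pos (by omega),
      coeff_layer_pos ((hiff (by omega)).2 hn), coe_sub_single, Function.update_of_ne (by omega),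
      Function.update_comm (by omega)]
  · have h2 : MvPowerSeries.coeff n (layer (k + 1) fun n r =>
        if 2 ≤ n k then g (Function.update n k (n k - 1)) r else 0) = 0 := by
      by_cases h3 : IsExponent (k + 1) n
      · rw [coeff_layer_pos h3, hupd, if_neg fun h4 => hn ⟨h3, h4⟩]
      · exact coeff_layer_neg h3
    rw [h2]
    split_ifs with h1
    · exact coeff_layer_neg fun h4 => hn ((hiff h1).1 h4)
    · rfl

lemma genSeries_eq_layer (hk : 1 ≤ k) (i : ℕ) (f : (ℕ → ℕ) → ℤ[X]) : genSeries k i f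
    = layer k fun n r => if i ≤ r then f (Function.update n k r) else 0 := by
  classical
  ext1 n
  have hiff : (n.support ⊆ Finset.Icc 1 k ∧ (∀ j ∈ Finset.Icc 1 (k - 1), 1 ≤ n j) ∧ i ≤ n k) ↔
      IsExponent k n ∧ i ≤ n k := by
    rw [← and_assoc]
    refine and_congr_left fun _ => and_congr ?_ ?_
    · constructor
      · intro h j hj
        exact Finset.mem_Icc.1 (h (Finsupp.mem_support_iff.2 hj))
      · intro h j hj
        exact Finset.mem_Icc.2 (h j (Finsupp.mem_support_iff.1 hj))
    · constructor
      · intro h j h1 h2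
        exact h j (Finset.mem_Icc.2 ⟨h1, by omega⟩)
      · intro h j hj
        rw [Finset.mem_Icc] at hj
        exact h j hj.1 (by omega)
  by_cases hn : IsExponent k n ∧ i ≤ n k
  · refine (if_pos (hiff.2 hn)).trans ?_
    rw [coeff_layer_pos hn.1, if_pos hn.2, Function.update_idem,
      Function.update_eq_self]
  · refine (if_neg fun h => hn (hiff.1 h)).trans ?_
    by_cases h : IsExponent k n
    · rw [coeff_layer_pos h, if_neg fun h1 => hn ⟨h, h1⟩]
    · rw [coeff_layer_neg h]

lemma isExponent_one_iff (n : ℕ →₀ ℕ) : IsExponent 1 n ↔ n.support ⊆ {1} := by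
  rw [Finset.subset_singleton_iff']
  constructor
  · intro h j hj
    have := h.1 j (Finsupp.mem_support_iff.1 hj)
    omega
  · intro h
    refine ⟨fun j hj => ?_, fun j h1 h2 => by omega⟩
    have := h j (Finsupp.mem_support_iff.2 hj)
    omega

lemma genSeriesOne_eq_layer (i : ℕ) (f : ℕ → ℤ[X]) : genSeriesOne i f
    = layer 1 fun _ r => if i ≤ r then f r else 0 := by
  ext1 n
  have hiff := isExponent_one_iff n
  by_cases h : IsExponent 1 n
  · rw [coeff_layer_pos h]
    by_cases h1 : i ≤ n 1
    · rw [if_pos h1]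
      exact if_pos ⟨hiff.1 h, h1⟩
    · rw [if_neg h1]
      exact if_neg fun h2 => h1 h2.2
  · rw [coeff_layer_neg h]
    exact if_neg fun h1 => h (hiff.2 h1.1)

lemma C_mul_X_pow_eq_layer (a : ℤ[X]) (j : ℕ) :
    (MvPowerSeries.C a * MvPowerSeries.X 1 ^ j : Series)
      = layer 1 fun _ r => if r = j then a else 0 := by
  ext1 n
  rw [MvPowerSeries.coeff_C_mul, MvPowerSeries.coeff_X_pow]
  have hiff : n = Finsupp.single 1 j ↔ IsExponent 1 n ∧ n 1 = j := by
    rw [isExponent_one_iff, Finsupp.support_subset_singleton]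
    constructor
    · intro h
      have h1 : n 1 = j := by rw [h, Finsupp.single_eq_same]
      exact ⟨by rw [h1]; exact h, h1⟩
    · rintro ⟨h, rfl⟩
      exact h
  by_cases h : IsExponent 1 n
  · rw [coeff_layer_pos h]
    by_cases h1 : n 1 = j
    · rw [if_pos (hiff.2 ⟨h, h1⟩), if_pos h1, mul_one]
    · rw [if_neg fun h2 => h1 (hiff.1 h2).2, if_neg h1, mul_zero]
  · rw [coeff_layer_neg h, if_neg fun h2 => h (hiff.1 h2).1, mul_zero]

end Layers

/-! ### Functional equations -/

/-- The series `λ^i` in `t_1, …, t_k`. -/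
def lambdaSeries (k i : ℕ) : Series := genSeries k i fun m => 2 ^ m k * lambdaPoly k m

/-- The series `E^i` in `t_1, …, t_k`. -/
def eulerSeries (k i : ℕ) : Series := genSeries k i fun m => eulerPoly k m

/-- The part of `λ^1` that is linear in the last variable. -/
def lambdaLinear (K : ℕ) : Series :=
  layer (K + 2) fun n r => if r = 1 then 2 * cutSum (K + 1) n 1 else 0

/-- The part of `E^1` that is linear in the last variable. -/
def eulerLinear (K : ℕ) : Series :=
  layer (K + 2) fun n r => if r = 1 then 2 * fanSum K n (n (K + 1) + 2) else 0

/-- The inhomogeneous part of the recurrence of `λ^1`. -/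
def lambdaRest (K : ℕ) : Series :=
  layer (K + 2) fun n r => if r = 2 then fanSum K n (n (K + 1)) else 0

/-- The inhomogeneous part of the recurrence of `E^1`. -/
def eulerRest (K : ℕ) : Series :=
  layer (K + 2) fun n r => if r = 2 then 2 * fanSum K n (n (K + 1) + 1) else 0

section FunctionalEquations

variable {i : ℕ}

lemma lambdaSeries_eq_layer (K : ℕ) (hi : 1 ≤ i) : lambdaSeries (K + 1) i =
    layer (K + 1) fun n r => if i ≤ r then 2 ^ r * cutSum K n r else 0 := by
  rw [lambdaSeries, genSeries_eq_layer (by omega)]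
  refine layer_congr fun n r hn => ?_
  split_ifs with h
  · have h1 : ∀ j, j ≤ K → Function.update n (K + 1) r j = n j := fun j hj =>
      Function.update_of_ne (by omega) _ _
    rw [lambdaPoly_eq, Function.update_self, cutSum_congr fun j _ h2 => h1 j h2]
    intro j h2 h3
    rcases h3.lt_or_eq with h4 | rfl
    · rw [h1 j (by omega)]
      exact hn j h2 (by omega)
    · rw [Function.update_self]
      omega
  · rfl

lemma eulerSeries_eq_layer (K : ℕ) (hi : 1 ≤ i) : eulerSeries (K + 2) i =
    layer (K + 2) fun n r => if i ≤ r then 2 * fanSum (K + 1) n r else 0 := by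
  rw [eulerSeries, genSeries_eq_layer (by omega)]
  refine layer_congr fun n r hn => ?_
  split_ifs with h
  · have h1 : ∀ j, j ≤ K + 1 → Function.update n (K + 2) r j = n j := fun j hj =>
      Function.update_of_ne (by omega) _ _
    rw [eulerPoly_eq (by omega), Function.update_self, fanSum_congr fun j _ h2 => h1 j h2]
    intro j h2 h3
    rcases h3.lt_or_eq with h4 | rfl
    · rw [h1 j (by omega)]
      exact hn j h2 (by omega)
    · rw [Function.update_self]
      omega
  · rfl

lemma lambdaSeries_one (K : ℕ) :
    lambdaSeries (K + 2) 1 = lambdaSeries (K + 2) 2 + lambdaLinear K := by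
  rw [lambdaSeries_eq_layer _ le_rfl, lambdaSeries_eq_layer _ one_le_two, lambdaLinear, layer_add]
  refine layer_congr fun n r hn => ?_
  rcases r with _ | _ | r <;> simp

lemma eulerSeries_one (K : ℕ) :
    eulerSeries (K + 2) 1 = eulerSeries (K + 2) 2 + eulerLinear K := by
  rw [eulerSeries_eq_layer _ le_rfl, eulerSeries_eq_layer _ one_le_two, eulerLinear, layer_add]
  refine layer_congr fun n r hn => ?_
  rcases r with _ | _ | r <;> simp [fanSum_succ_one]

/-- The recurrence of `cutSum` with weight 2^r: one step back doubles the coefficient and two steps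
quadruple it. At r = 2 the term `cutSum` at 0, which λ^1 does not contain, equals a `fanSum` of the
preceding fan and becomes `lambdaRest`. -/
lemma lambdaSeries_recurrence (K : ℕ) : lambdaSeries (K + 2) 1
    = MvPowerSeries.C (2 + 4 * X) * (MvPowerSeries.X (K + 2) * lambdaSeries (K + 2) 1)
      + MvPowerSeries.C (16 * X ^ 2) * (MvPowerSeries.X (K + 2) *
        (MvPowerSeries.X (K + 2) * lambdaSeries (K + 2) 1))
      + lambdaLinear K + MvPowerSeries.C (16 * X ^ 2) * lambdaRest K := by
  rw [lambdaSeries_eq_layer _ le_rfl, lambdaLinear, lambdaRest, X_mul_layer (by omega),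
    X_mul_layer (by omega), C_mul_layer, C_mul_layer, C_mul_layer, layer_add, layer_add, layer_add]
  refine layer_congr fun n r hn => ?_
  have h1 := cutSum_add_two (K := K) (m := n) fun j h1 h2 => hn j h1 (by omega)
  rcases r with _ | _ | _ | r
  · simp
  · simp
  · have := h1 0
    rw [cutSum_succ_zero] at this
    simp [this]
    ring
  · have := h1 (r + 1)
    simp [this]
    ring

/-- The weight of λ is chosen for this step: 2X² · 2^(r + 4) is 16X² · 2^(r + 1), so the cut term is
a constant multiple of a shifted λ^1. The term at r = 0 is missing from E^1 and appears as
`eulerRest`. -/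
lemma eulerSeries_recurrence (K : ℕ) : eulerSeries (K + 2) 1
    = MvPowerSeries.C (1 + 4 * X) * (MvPowerSeries.X (K + 2) * eulerSeries (K + 2) 1)
      + MvPowerSeries.C (16 * X ^ 2) * (MvPowerSeries.X (K + 2) *
        (MvPowerSeries.X (K + 2) * eulerSeries (K + 2) 1))
      + MvPowerSeries.C (16 * X ^ 2) * (MvPowerSeries.X (K + 2) * lambdaSeries (K + 2) 1)
      + eulerLinear K + MvPowerSeries.C (16 * X ^ 2) * eulerRest K := by
  rw [lambdaSeries_eq_layer _ le_rfl, eulerSeries_eq_layer _ le_rfl, eulerLinear, eulerRest,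
    X_mul_layer (by omega), X_mul_layer (by omega), X_mul_layer (by omega), C_mul_layer,
    C_mul_layer, C_mul_layer, C_mul_layer, layer_add, layer_add, layer_add, layer_add]
  refine layer_congr fun n r hn => ?_
  have h1 := fanSum_add_two (K := K) (m := n) fun j h1 h2 => hn j h1 (by omega)
  rcases r with _ | _ | _ | r
  · simp
  · simp [fanSum_succ_one]
  · have := h1 0
    rw [fanSum_succ_zero] at this
    simp [this]
    ring
  · have := h1 (r + 1)
    simp [this]
    ring

/-! #### The transfer from `k - 1` to `k ≥ 3` -/

lemma X_mul_lambdaSeries (K : ℕ) (hi : 1 ≤ i) :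
    MvPowerSeries.X (K + 2) * lambdaSeries (K + 1) i = layer (K + 2) fun n r =>
      if r = 1 ∧ i ≤ n (K + 1) then 2 ^ n (K + 1) * cutSum K n (n (K + 1)) else 0 := by
  rw [lambdaSeries_eq_layer _ hi, X_succ_mul_layer (by omega) (fun n => if_neg (by omega))]
  refine layer_congr fun n r hn => ?_
  rw [cutSum_congr (m := Function.update n (K + 1) 0) (m' := n) fun j _ h2 =>
    Function.update_of_ne (by omega) _ _]
  split_ifs <;> first | rfl | omega

lemma X_mul_eulerSeries (K : ℕ) (hi : 1 ≤ i) :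
    MvPowerSeries.X (K + 3) * eulerSeries (K + 2) i = layer (K + 3) fun n r =>
      if r = 1 ∧ i ≤ n (K + 2) then 2 * fanSum (K + 1) n (n (K + 2)) else 0 := by
  rw [eulerSeries_eq_layer _ hi, X_succ_mul_layer (by omega) (fun n => if_neg (by omega))]
  refine layer_congr fun n r hn => ?_
  rw [fanSum_congr (m := Function.update n (K + 1 + 1) 0) (m' := n) fun j _ h2 =>
    Function.update_of_ne (by omega) _ _]
  split_ifs <;> first | rfl | omega

/-- With one rim vertex and no centre, the pendant elimination `cutSum_succ_one` expresses
everything by the previous fan; 2 · 2^(m + 3) = 16 · 2^m. -/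
lemma lambdaLinear_succ (K : ℕ) : lambdaLinear (K + 1)
    = MvPowerSeries.C (16 * X ^ 2) * (MvPowerSeries.X (K + 3) * lambdaSeries (K + 2) 1)
      + MvPowerSeries.C (1 + 2 * X) * (MvPowerSeries.X (K + 3) * eulerSeries (K + 2) 1) := by
  rw [X_mul_lambdaSeries _ le_rfl, X_mul_eulerSeries _ le_rfl, C_mul_layer, C_mul_layer, layer_add,
    lambdaLinear]
  refine layer_congr fun n r hn => ?_
  have h1 := hn (K + 2) (by omega) (by omega)
  by_cases hr : r = 1
  · rw [if_pos hr, if_pos ⟨hr, h1⟩, if_pos ⟨hr, h1⟩,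
      cutSum_succ_one (fun j h2 h3 => hn j h2 (by omega))]
    ring
  · simp [hr]

lemma lambdaRest_succ (K : ℕ) : MvPowerSeries.C (2 : ℤ[X]) * lambdaRest (K + 1)
    = MvPowerSeries.X (K + 3) * (MvPowerSeries.X (K + 3) * eulerSeries (K + 2) 1) := by
  rw [X_mul_eulerSeries _ le_rfl, X_mul_layer (by omega), lambdaRest, C_mul_layer]
  refine layer_congr fun n r hn => ?_
  have h1 := hn (K + 2) (by omega) (by omega)
  rcases r with _ | _ | _ | r <;> simp [h1]

/-- The linear coefficient is a previous fan prolonged by two, and one application of its recurrence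
brings this back. The prolonged fan is ahead of the exponent of t_(K+2), so the identity is
multiplied by that variable; terms with a rim of length 1 then drop out, and E^2 and λ^2 appear
instead of E^1 and λ^1. -/
lemma eulerLinear_succ (K : ℕ) : MvPowerSeries.X (K + 2) * eulerLinear (K + 1)
    = MvPowerSeries.C (1 + 4 * X) * (MvPowerSeries.X (K + 3) * eulerSeries (K + 2) 2)
      + MvPowerSeries.C (16 * X ^ 2) * (MvPowerSeries.X (K + 2) *
        (MvPowerSeries.X (K + 3) * eulerSeries (K + 2) 1))
      + MvPowerSeries.C (16 * X ^ 2) * (MvPowerSeries.X (K + 3) * lambdaSeries (K + 2) 2) := by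
  rw [X_mul_lambdaSeries _ one_le_two, X_mul_eulerSeries _ le_rfl, X_mul_eulerSeries _ one_le_two,
    X_mul_layer_succ (by omega), eulerLinear, X_mul_layer_succ (by omega), C_mul_layer, C_mul_layer,
    C_mul_layer, layer_add, layer_add]
  refine layer_congr fun n r hn => ?_
  by_cases hr : r = 1
  · by_cases h2 : 2 ≤ n (K + 2)
    · obtain ⟨u, hu⟩ : ∃ u, n (K + 2) = u + 2 := ⟨n (K + 2) - 2, by omega⟩
      have h3 : ∀ q, fanSum (K + 1) (Function.update n (K + 1 + 1) (u + 1)) q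
          = fanSum (K + 1) n q := fun q =>
        fanSum_congr (fun j _ h2 => Function.update_of_ne (by omega) _ _) q
      have h4 := fanSum_add_two (K := K) (m := n) (fun j h1 h2 => hn j h1 (by omega)) (u + 1)
      simp [hr, hu, h3, h4]
      ring
    · simp [hr, h2]
  · simp [hr]

lemma eulerRest_succ (K : ℕ) : MvPowerSeries.X (K + 2) * eulerRest (K + 1)
    = MvPowerSeries.X (K + 3) * (MvPowerSeries.X (K + 3) * eulerSeries (K + 2) 2) := by
  rw [X_mul_eulerSeries _ one_le_two, X_mul_layer (by omega), eulerRest,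
    X_mul_layer_succ (by omega)]
  refine layer_congr fun n r hn => ?_
  by_cases h2 : 2 ≤ n (K + 2)
  · obtain ⟨u, hu⟩ : ∃ u, n (K + 2) = u + 2 := ⟨n (K + 2) - 2, by omega⟩
    have h3 : ∀ q, fanSum (K + 1) (Function.update n (K + 1 + 1) (u + 1)) q
        = fanSum (K + 1) n q := fun q =>
      fanSum_congr (fun j _ h2 => Function.update_of_ne (by omega) _ _) q
    rcases r with _ | _ | _ | r <;> simp [hu, h3]
  · rcases r with _ | _ | _ | r <;> simp [h2]

/-! #### The case `k = 2` -/

/-- The series of the ladder polynomials. -/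
def ladderSeries : Series := genSeriesOne 2 ladderPoly

/-- The series of the tridiagonal polynomials. -/
def tridiagonalSeries : Series := genSeriesOne 1 fun m => 2 ^ m * tridiagonalPoly m

lemma X_two_mul_one {g : (ℕ → ℕ) → ℕ → ℤ[X]} (hg : ∀ n, g n 0 = 0) :
    MvPowerSeries.X 2 * layer 1 g
      = layer 2 fun n r => if r = 1 ∧ 1 ≤ n 1 then g (Function.update n 1 0) (n 1) else 0 :=
  X_succ_mul_layer le_rfl hg

lemma X_one_mul_two {g : (ℕ → ℕ) → ℕ → ℤ[X]} : MvPowerSeries.X 1 * layer 2 g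
    = layer 2 fun n r => if 2 ≤ n 1 then g (Function.update n 1 (n 1 - 1)) r else 0 :=
  X_mul_layer_succ le_rfl

/-- A fan with m rim vertices is φ_(m+1), so one factor t_1 aligns the exponent with the index. -/
lemma lambdaLinear_zero : MvPowerSeries.X 1 * lambdaLinear 0
    = MvPowerSeries.C (2 * (1 + 2 * X)) * (MvPowerSeries.X 2 * ladderSeries)
      + MvPowerSeries.C (4 * X ^ 2) * (MvPowerSeries.X 1 * (MvPowerSeries.X 2 * tridiagonalSeries)) := by
  rw [ladderSeries, tridiagonalSeries, genSeriesOne_eq_layer, genSeriesOne_eq_layer,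
    X_two_mul_one (by simp), X_two_mul_one (by simp), X_one_mul_two, lambdaLinear, X_one_mul_two,
    C_mul_layer, C_mul_layer, layer_add]
  refine layer_congr fun n r hn => ?_
  by_cases hr : r = 1
  · by_cases h2 : 2 ≤ n 1
    · obtain ⟨u, hu⟩ : ∃ u, n 1 = u + 2 := ⟨n 1 - 2, by omega⟩
      have h3 := cutSum_one_one (Function.update n 1 (u + 1))
      rw [Function.update_self] at h3
      have h4 := tridiagonalPoly_eq (Function.update n 1 (u + 1)) (u + 1)
      have h5 := ladderPoly_eq (Function.update n 1 (u + 1)) (u + 1)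
      simp [hr, hu, h3, h4, h5]
      ring
    · simp [hr, h2]
  · simp [hr]

lemma lambdaRest_zero : MvPowerSeries.X 1 * lambdaRest 0
    = MvPowerSeries.X 2 * (MvPowerSeries.X 2 * ladderSeries) := by
  rw [ladderSeries, genSeriesOne_eq_layer, X_two_mul_one (by simp), X_mul_layer (by omega),
    lambdaRest, X_one_mul_two]
  refine layer_congr fun n r hn => ?_
  by_cases h2 : 2 ≤ n 1
  · obtain ⟨u, hu⟩ : ∃ u, n 1 = u + 2 := ⟨n 1 - 2, by omega⟩
    have h5 := ladderPoly_eq (Function.update n 1 (u + 1)) (u + 1)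
    rcases r with _ | _ | _ | r <;> simp [hu, h5]
  · rcases r with _ | _ | _ | r <;> simp [h2]

lemma ladderPoly_two : ladderPoly 2 = 1 + 3 * X + 4 * X ^ 2 := by
  rw [ladderPoly_eq (fun _ => 0) 1, fanSum_zero_one]

lemma ladderPoly_three : ladderPoly 3 = 1 + 7 * X + 28 * X ^ 2 + 28 * X ^ 3 := by
  rw [ladderPoly_eq (fun _ => 0) 2, fanSum_zero_two, fanSum_zero_one, fanSum_zero_zero,
    cutSum_zero_one]
  ring

lemma ladderSeries_three : ladderSeries
    = MvPowerSeries.C (1 + 3 * X + 4 * X ^ 2) * MvPowerSeries.X 1 ^ 2 + genSeriesOne 3 ladderPoly := by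
  rw [ladderSeries, genSeriesOne_eq_layer, genSeriesOne_eq_layer, C_mul_X_pow_eq_layer, layer_add,
    ← ladderPoly_two]
  refine layer_congr fun n r hn => ?_
  rcases r with _ | _ | _ | r <;> simp

lemma ladderSeries_four : genSeriesOne 3 ladderPoly
    = MvPowerSeries.C (1 + 7 * X + 28 * X ^ 2 + 28 * X ^ 3) * MvPowerSeries.X 1 ^ 3 + genSeriesOne 4 ladderPoly := by
  rw [genSeriesOne_eq_layer, genSeriesOne_eq_layer, C_mul_X_pow_eq_layer, layer_add,
    ← ladderPoly_three]
  refine layer_congr fun n r hn => ?_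
  rcases r with _ | _ | _ | _ | r <;> simp

/-- The first fan has m_1 + 2 rim vertices, hence φ_(m_1+3). Three factors t_1 align the exponents,
and since m_1 ≥ 1 the series begins with φ_4. -/
lemma eulerLinear_zero : MvPowerSeries.X 1 * (MvPowerSeries.X 1 * (MvPowerSeries.X 1 * eulerLinear 0))
    = MvPowerSeries.C (2 : ℤ[X]) * (MvPowerSeries.X 2 * genSeriesOne 4 ladderPoly) := by
  rw [genSeriesOne_eq_layer, X_two_mul_one (by simp), eulerLinear, X_one_mul_two, X_one_mul_two,
    X_one_mul_two, C_mul_layer]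
  refine layer_congr fun n r hn => ?_
  by_cases hr : r = 1
  · by_cases h2 : 4 ≤ n 1
    · obtain ⟨u, hu⟩ : ∃ u, n 1 = u + 4 := ⟨n 1 - 4, by omega⟩
      have h5 := ladderPoly_eq (Function.update n 1 (u + 1)) (u + 3)
      simp [hr, hu, h5]
    · have h3 : n 1 = 0 ∨ n 1 = 1 ∨ n 1 = 2 ∨ n 1 = 3 := by omega
      rcases h3 with h3 | h3 | h3 | h3 <;> simp [hr, h3]
  · simp [hr]

/-- Here the index is m_1 + 2, so two factors t_1 suffice and the series begins with φ_3. -/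
lemma eulerRest_zero : MvPowerSeries.X 1 * (MvPowerSeries.X 1 * eulerRest 0)
    = MvPowerSeries.C (2 : ℤ[X]) * (MvPowerSeries.X 2 * (MvPowerSeries.X 2 * genSeriesOne 3 ladderPoly)) := by
  rw [genSeriesOne_eq_layer, X_two_mul_one (by simp), X_mul_layer (by omega), eulerRest,
    X_one_mul_two, X_one_mul_two, C_mul_layer]
  refine layer_congr fun n r hn => ?_
  by_cases h2 : 3 ≤ n 1
  · obtain ⟨u, hu⟩ : ∃ u, n 1 = u + 3 := ⟨n 1 - 3, by omega⟩
    have h5 := ladderPoly_eq (Function.update n 1 (u + 1)) (u + 2)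
    rcases r with _ | _ | _ | r <;> simp [hu, h5]
  · have h3 : n 1 = 0 ∨ n 1 = 1 ∨ n 1 = 2 := by omega
    rcases h3 with h3 | h3 | h3 <;> rcases r with _ | _ | _ | r <;> simp [h3]

/-! #### The case `k = 1` -/

/-- The uniform recurrence begins at index 3. The monomials are the weighted L_1 and the
contribution 4 · 2X² · L_0 to index 2, where the pendant vertex is attached to an isolated one. -/
lemma tridiagonalSeries_recurrence : tridiagonalSeries
    = MvPowerSeries.C (2 + 4 * X) * (MvPowerSeries.X 1 * tridiagonalSeries)
      + MvPowerSeries.C (16 * X ^ 2) * (MvPowerSeries.X 1 * (MvPowerSeries.X 1 * tridiagonalSeries))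
      + MvPowerSeries.C (2 + 2 * X) * MvPowerSeries.X 1 ^ 1 + MvPowerSeries.C (8 * X ^ 2) * MvPowerSeries.X 1 ^ 2 := by
  rw [tridiagonalSeries, genSeriesOne_eq_layer, X_mul_layer le_rfl, X_mul_layer le_rfl,
    C_mul_layer, C_mul_layer, C_mul_X_pow_eq_layer, C_mul_X_pow_eq_layer, layer_add, layer_add,
    layer_add]
  refine layer_congr fun n r hn => ?_
  have h1 := tridiagonalPoly_eq n
  rcases r with _ | _ | _ | r
  · simp
  · simp [h1, cutSum_zero_one]
    ring
  · simp [h1, cutSum_zero_one, cutSum_zero_two]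
    ring
  · have := cutSum_zero_add_three n r
    simp [h1, this]
    ring

/-- The monomials are φ_2 and the exceptional term 8X²φ_1 of index 3, since φ_1 = 1 + X does not
belong to the series. The cut term carries 2X² because L* has the weight 2^m. -/
lemma ladderSeries_recurrence : ladderSeries
    = MvPowerSeries.C (1 + 4 * X) * (MvPowerSeries.X 1 * ladderSeries)
      + MvPowerSeries.C (16 * X ^ 2) * (MvPowerSeries.X 1 * (MvPowerSeries.X 1 * ladderSeries))
      + MvPowerSeries.C (2 * X ^ 2) * (MvPowerSeries.X 1 * (MvPowerSeries.X 1 * tridiagonalSeries))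
      + MvPowerSeries.C (1 + 3 * X + 4 * X ^ 2) * MvPowerSeries.X 1 ^ 2
      + MvPowerSeries.C (8 * X ^ 2 + 8 * X ^ 3) * MvPowerSeries.X 1 ^ 3 := by
  rw [ladderSeries, tridiagonalSeries, genSeriesOne_eq_layer, genSeriesOne_eq_layer,
    X_mul_layer le_rfl, X_mul_layer le_rfl, X_mul_layer le_rfl, X_mul_layer le_rfl,
    C_mul_layer, C_mul_layer, C_mul_layer, C_mul_X_pow_eq_layer, C_mul_X_pow_eq_layer, layer_add,
    layer_add, layer_add, layer_add]
  refine layer_congr fun n r hn => ?_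
  have h1 := tridiagonalPoly_eq n
  have h2 := ladderPoly_eq n
  rcases r with _ | _ | _ | _ | r
  · simp
  · simp
  · simp [ladderPoly_two]
  · simp [ladderPoly_two, ladderPoly_three, h1, cutSum_zero_one]
    ring
  · have := fanSum_zero_add_three n r
    simp [h1, h2, this]
    ring

end FunctionalEquations

/-! ### The identities in the field of fractions -/

section Fractions

/-- The constant coefficient is 1; both denominators are of this form. -/
lemma algebraMap_one_sub_ne_zero (i : ℕ) (f : Series) :
    algebraMap Series Frac (1 - MvPowerSeries.X i * f) ≠ 0 := by
  rw [Ne, FaithfulSMul.algebraMap_eq_zero_iff]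
  intro h
  have := congrArg MvPowerSeries.constantCoeff h
  simp at this

lemma tVar_ne_zero (i : ℕ) : tVar i ≠ 0 := by
  rw [tVar, Ne, FaithfulSMul.algebraMap_eq_zero_iff]
  intro h
  have := congrArg (MvPowerSeries.coeff (Finsupp.single i 1)) h
  simp at this

lemma denominator_ne_zero (i : ℕ) :
    1 - 2 * tVar i - 4 * zVar * tVar i - 16 * zVar ^ 2 * tVar i ^ 2 ≠ 0 := by
  have h := algebraMap_one_sub_ne_zero i (2 + 4 * MvPowerSeries.C X +
    16 * MvPowerSeries.C X ^ 2 * MvPowerSeries.X i)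
  simp only [map_sub, map_one, map_mul, map_add, map_ofNat, map_pow] at h
  refine fun h1 => h (Eq.trans ?_ h1)
  rw [tVar, zVar]
  ring

lemma denominator'_ne_zero (i : ℕ) :
    1 - tVar i - 4 * zVar * tVar i - 16 * zVar ^ 2 * tVar i ^ 2 ≠ 0 := by
  have h := algebraMap_one_sub_ne_zero i (1 + 4 * MvPowerSeries.C X +
    16 * MvPowerSeries.C X ^ 2 * MvPowerSeries.X i)
  simp only [map_sub, map_one, map_mul, map_add, map_ofNat, map_pow] at h
  refine fun h1 => h (Eq.trans ?_ h1)
  rw [tVar, zVar]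
  ring

/-- Pure linear algebra: the recurrence for L₁ is solved with denominator D, then that for E₁ with
denominator D', into which L₁ enters. The halved `hc` is the origin of the coefficient 8z²t². The
rows of L₂ and E₂ arise by subtracting the linear parts a and b. -/
lemma eq_transferMatrix_mulVec {F : Type*} [Field F] {s t z l₁ l₂ e₁ e₂ L₁ L₂ E₁ E₂ a b c d : F}
    (hs : s ≠ 0) (hD : 1 - 2 * t - 4 * z * t - 16 * z ^ 2 * t ^ 2 ≠ 0)
    (hD' : 1 - t - 4 * z * t - 16 * z ^ 2 * t ^ 2 ≠ 0) (hL : L₁ = L₂ + a) (hE : E₁ = E₂ + b)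
    (hLr : L₁ = (2 + 4 * z) * (t * L₁) + 16 * z ^ 2 * (t * (t * L₁)) + a + 16 * z ^ 2 * c)
    (hEr : E₁ = (1 + 4 * z) * (t * E₁) + 16 * z ^ 2 * (t * (t * E₁)) + 16 * z ^ 2 * (t * L₁) + b
      + 16 * z ^ 2 * d)
    (ha : a = 16 * z ^ 2 * (t * l₁) + (1 + 2 * z) * (t * e₁)) (hc : 2 * c = t * (t * e₁))
    (hb : s * b = (1 + 4 * z) * (t * e₂) + 16 * z ^ 2 * (s * (t * e₁)) + 16 * z ^ 2 * (t * l₂))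
    (hd : s * d = t * (t * e₂)) :
    ![L₁, L₂, E₁, E₂] = transferMatrix s t z *ᵥ ![l₁, l₂, e₁, e₂] := by
  have hb' : b = s⁻¹ * ((1 + 4 * z) * (t * e₂) + 16 * z ^ 2 * (t * l₂)) + 16 * z ^ 2 * (t * e₁) := by
    field_simp
    linear_combination hb
  have hd' : d = s⁻¹ * (t * (t * e₂)) := by
    field_simp
    linear_combination hd
  have h1 : L₁ = (16 * z ^ 2 * t / (1 - 2 * t - 4 * z * t - 16 * z ^ 2 * t ^ 2)) * l₁ +
      ((t * (1 + 2 * z) + 8 * z ^ 2 * t ^ 2) / (1 - 2 * t - 4 * z * t - 16 * z ^ 2 * t ^ 2)) * e₁ := by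
    rw [div_mul_eq_mul_div, div_mul_eq_mul_div, ← add_div, eq_div_iff hD]
    linear_combination hLr + ha + 8 * z ^ 2 * hc
  have h3 : E₁ = (16 * z ^ 2 * t * L₁ + b + 16 * z ^ 2 * d) /
      (1 - t - 4 * z * t - 16 * z ^ 2 * t ^ 2) := by
    rw [eq_div_iff hD']
    linear_combination hEr
  have h3' : E₁ = 16 * z ^ 2 * t * (16 * z ^ 2 * t / (1 - 2 * t - 4 * z * t - 16 * z ^ 2 * t ^ 2)) /
        (1 - t - 4 * z * t - 16 * z ^ 2 * t ^ 2) * l₁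
      + 16 * z ^ 2 * s⁻¹ * t / (1 - t - 4 * z * t - 16 * z ^ 2 * t ^ 2) * l₂
      + (16 * z ^ 2 * t + 16 * z ^ 2 * t * ((t * (1 + 2 * z) + 8 * z ^ 2 * t ^ 2) /
        (1 - 2 * t - 4 * z * t - 16 * z ^ 2 * t ^ 2))) / (1 - t - 4 * z * t - 16 * z ^ 2 * t ^ 2) * e₁
      + ((1 + 4 * z) * s⁻¹ * t + 16 * z ^ 2 * s⁻¹ * t ^ 2) /
        (1 - t - 4 * z * t - 16 * z ^ 2 * t ^ 2) * e₂ := by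
    rw [h3, hb', hd', h1]
    generalize 1 - 2 * t - 4 * z * t - 16 * z ^ 2 * t ^ 2 = D at *
    generalize 1 - t - 4 * z * t - 16 * z ^ 2 * t ^ 2 = D' at *
    ring
  funext i
  fin_cases i
  · simp [transferMatrix, Matrix.mulVec, dotProduct, Fin.sum_univ_four]
    linear_combination h1
  · simp [transferMatrix, Matrix.mulVec, dotProduct, Fin.sum_univ_four]
    linear_combination h1 - hL - ha
  · simp [transferMatrix, Matrix.mulVec, dotProduct, Fin.sum_univ_four]
    linear_combination h3'
  · simp [transferMatrix, Matrix.mulVec, dotProduct, Fin.sum_univ_four]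
    linear_combination h3' - hE - hb'

theorem genVec_succ (K : ℕ) :
    genVec (K + 3) = transferMatrix (tVar (K + 2)) (tVar (K + 3)) zVar *ᵥ genVec (K + 2) := by
  have key : ∀ {f g : Series}, f = g → algebraMap Series Frac f = algebraMap Series Frac g :=
    fun h => congrArg _ h
  have hL := key (lambdaSeries_one (K + 1))
  have hE := key (eulerSeries_one (K + 1))
  have hLr := key (lambdaSeries_recurrence (K + 1))
  have hEr := key (eulerSeries_recurrence (K + 1))
  have ha := key (lambdaLinear_succ K)
  have hc := key (lambdaRest_succ K)
  have hb := key (eulerLinear_succ K)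
  have hd := key (eulerRest_succ K)
  simp only [map_add, map_mul, map_pow, map_one, map_ofNat] at hL hE hLr hEr ha hc hb hd
  exact eq_transferMatrix_mulVec (tVar_ne_zero _) (denominator_ne_zero _) (denominator'_ne_zero _)
    hL hE hLr hEr ha hc hb hd

theorem genVec_eq_transferProduct (K : ℕ) :
    genVec (K + 2) = transferProduct (K + 2) *ᵥ genVec 2 := by
  induction K with
  | zero => rw [transferProduct, Matrix.one_mulVec]
  | succ K ih =>
    rw [genVec_succ, ih, Matrix.mulVec_mulVec]
    rfl

theorem lambdaGF_two_eq :
    tVar 1 * lambdaGF 2 2 = tVar 1 * lambdaGF 2 1 - (2 * (1 + 2 * zVar) * (tVar 2 * ladderGF)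
      + 4 * zVar ^ 2 * (tVar 1 * (tVar 2 * tridiagonalGF))) ∧
    tVar 1 * ((1 - 2 * tVar 2 - 4 * zVar * tVar 2 - 16 * zVar ^ 2 * tVar 2 ^ 2) * lambdaGF 2 1)
      = 2 * (1 + 2 * zVar) * (tVar 2 * ladderGF)
      + 4 * zVar ^ 2 * (tVar 1 * (tVar 2 * tridiagonalGF))
      + 16 * zVar ^ 2 * (tVar 2 * (tVar 2 * ladderGF)) := by
  have key : ∀ {f g : Series}, f = g → algebraMap Series Frac f = algebraMap Series Frac g :=
    fun h => congrArg _ h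
  have hL := key (lambdaSeries_one 0)
  have hLr := key (lambdaSeries_recurrence 0)
  have ha := key lambdaLinear_zero
  have hc := key lambdaRest_zero
  simp only [map_add, map_mul, map_pow, map_one, map_ofNat, zero_add] at hL hLr ha hc
  change lambdaGF 2 1 = lambdaGF 2 2 + _ at hL
  change lambdaGF 2 1 = (2 + 4 * zVar) * (tVar 2 * lambdaGF 2 1)
    + 16 * zVar ^ 2 * (tVar 2 * (tVar 2 * lambdaGF 2 1)) + _ + 16 * zVar ^ 2 * _ at hLr
  change tVar 1 * _ = 2 * (1 + 2 * zVar) * (tVar 2 * ladderGF)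
      + 4 * zVar ^ 2 * (tVar 1 * (tVar 2 * tridiagonalGF)) at ha
  change tVar 1 * _ = tVar 2 * (tVar 2 * ladderGF) at hc
  constructor
  · linear_combination (-tVar 1) * hL - ha
  · linear_combination tVar 1 * hLr + ha + 16 * zVar ^ 2 * hc

theorem eulerGF_two_eq :
    tVar 1 ^ 3 * (eulerGF 2 1 - eulerGF 2 2) = 2 * tVar 2 * (ladderGF
      - (1 + 3 * zVar + 4 * zVar ^ 2) * tVar 1 ^ 2
      - (1 + 7 * zVar + 28 * zVar ^ 2 + 28 * zVar ^ 3) * tVar 1 ^ 3) ∧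
    tVar 1 ^ 3 * ((1 - tVar 2 - 4 * zVar * tVar 2 - 16 * zVar ^ 2 * tVar 2 ^ 2) * eulerGF 2 1)
      = 2 * tVar 2 * (ladderGF - (1 + 3 * zVar + 4 * zVar ^ 2) * tVar 1 ^ 2
      - (1 + 7 * zVar + 28 * zVar ^ 2 + 28 * zVar ^ 3) * tVar 1 ^ 3)
      + 16 * zVar ^ 2 * tVar 1 ^ 3 * tVar 2 * lambdaGF 2 1
      + 32 * zVar ^ 2 * tVar 1 * tVar 2 ^ 2 *
        (ladderGF - (1 + 3 * zVar + 4 * zVar ^ 2) * tVar 1 ^ 2) := by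
  have key : ∀ {f g : Series}, f = g → algebraMap Series Frac f = algebraMap Series Frac g :=
    fun h => congrArg _ h
  have hE := key (eulerSeries_one 0)
  have hEr := key (eulerSeries_recurrence 0)
  have hb := key eulerLinear_zero
  have hd := key eulerRest_zero
  have h3 := key ladderSeries_three
  have h4 := key ladderSeries_four
  simp only [map_add, map_mul, map_pow, map_one, map_ofNat, zero_add] at hE hEr hb hd h3 h4
  change eulerGF 2 1 = eulerGF 2 2 + _ at hE
  change eulerGF 2 1 = (1 + 4 * zVar) * (tVar 2 * eulerGF 2 1)
    + 16 * zVar ^ 2 * (tVar 2 * (tVar 2 * eulerGF 2 1)) + 16 * zVar ^ 2 * (tVar 2 * lambdaGF 2 1)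
    + _ + 16 * zVar ^ 2 * _ at hEr
  change tVar 1 * (tVar 1 * (tVar 1 * _)) = 2 * (tVar 2 * _) at hb
  change tVar 1 * (tVar 1 * _) = 2 * (tVar 2 * (tVar 2 * _)) at hd
  change ladderGF = (1 + 3 * zVar + 4 * zVar ^ 2) * tVar 1 ^ 2 + _ at h3
  change _ = (1 + 7 * zVar + 28 * zVar ^ 2 + 28 * zVar ^ 3) * tVar 1 ^ 3 + _ at h4
  constructor
  · linear_combination tVar 1 ^ 3 * hE + hb - 2 * tVar 2 * (h3 + h4)
  · linear_combination tVar 1 ^ 3 * hEr + hb - 2 * tVar 2 * (h3 + h4)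
      + 16 * zVar ^ 2 * tVar 1 * hd - 32 * zVar ^ 2 * tVar 1 * tVar 2 ^ 2 * h3

theorem tridiagonalGF_mul :
    (1 - 2 * tVar 1 - 4 * zVar * tVar 1 - 16 * zVar ^ 2 * tVar 1 ^ 2) * tridiagonalGF
      = 8 * zVar ^ 2 * tVar 1 ^ 2 + 2 * tVar 1 * (1 + zVar) := by
  have h := congrArg (algebraMap Series Frac) tridiagonalSeries_recurrence
  simp only [map_add, map_mul, map_pow, map_ofNat] at h
  change tridiagonalGF = (2 + 4 * zVar) * (tVar 1 * tridiagonalGF)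
    + 16 * zVar ^ 2 * (tVar 1 * (tVar 1 * tridiagonalGF)) + (2 + 2 * zVar) * tVar 1 ^ 1
    + 8 * zVar ^ 2 * tVar 1 ^ 2 at h
  linear_combination h

theorem ladderGF_mul :
    (1 - tVar 1 - 4 * zVar * tVar 1 - 16 * zVar ^ 2 * tVar 1 ^ 2) * ladderGF
      = 2 * zVar ^ 2 * tVar 1 ^ 2 * tridiagonalGF + (1 + 3 * zVar + 4 * zVar ^ 2) * tVar 1 ^ 2
        + (8 * zVar ^ 2 + 8 * zVar ^ 3) * tVar 1 ^ 3 := by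
  have h := congrArg (algebraMap Series Frac) ladderSeries_recurrence
  simp only [map_add, map_mul, map_pow, map_one, map_ofNat] at h
  change ladderGF = (1 + 4 * zVar) * (tVar 1 * ladderGF)
    + 16 * zVar ^ 2 * (tVar 1 * (tVar 1 * ladderGF))
    + 2 * zVar ^ 2 * (tVar 1 * (tVar 1 * tridiagonalGF))
    + (1 + 3 * zVar + 4 * zVar ^ 2) * tVar 1 ^ 2 + (8 * zVar ^ 2 + 8 * zVar ^ 3) * tVar 1 ^ 3 at h
  linear_combination h

end Fractions

end CaterpillarHalin

end

theorem mainTheorem2 :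
    (∀ k : ℕ, 3 ≤ k →
      genVec k = transferMatrix (tVar (k - 1)) (tVar k) zVar *ᵥ genVec (k - 1)) ∧
    (∀ k : ℕ, 2 ≤ k → genVec k = transferProduct k *ᵥ genVec 2) ∧
    (lambdaGF 2 1 =
      ((2 * tVar 2 + 4 * zVar * tVar 2 + 16 * zVar ^ 2 * tVar 2 ^ 2) * (tVar 1)⁻¹ * ladderGF
          + 4 * zVar ^ 2 * tVar 2 * tridiagonalGF)
        / (1 - 2 * tVar 2 - 4 * zVar * tVar 2 - 16 * zVar ^ 2 * tVar 2 ^ 2)) ∧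
    (lambdaGF 2 2 =
      lambdaGF 2 1 - 2 * tVar 2 * (tVar 1)⁻¹ * (2 * zVar + 1) * ladderGF
        - 4 * zVar ^ 2 * tVar 2 * tridiagonalGF) ∧
    (eulerGF 2 1 =
      ((32 * zVar ^ 2 * (tVar 1)⁻¹ ^ 2 * tVar 2 ^ 2 + 2 * (tVar 1)⁻¹ ^ 3 * tVar 2) * ladderGF
          + 16 * zVar ^ 2 * tVar 2 * lambdaGF 2 1)
        / (1 - tVar 2 - 4 * zVar * tVar 2 - 16 * zVar ^ 2 * tVar 2 ^ 2)
      - ((8 * zVar ^ 2 + 6 * zVar + 2) * (tVar 1)⁻¹ * tVar 2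
          + (56 * zVar ^ 3 + 56 * zVar ^ 2 + 14 * zVar + 2) * tVar 2
          + 32 * zVar ^ 2 * tVar 2 ^ 2 * (4 * zVar ^ 2 + 3 * zVar + 1))
        / (1 - tVar 2 - 4 * zVar * tVar 2 - 16 * zVar ^ 2 * tVar 2 ^ 2)) ∧
    (eulerGF 2 2 =
      eulerGF 2 1 - 2 * (tVar 1)⁻¹ ^ 3 * tVar 2 * ladderGF
        + (8 * zVar ^ 2 + 6 * zVar + 2) * (tVar 1)⁻¹ * tVar 2
        + (56 * zVar ^ 3 + 56 * zVar ^ 2 + 14 * zVar + 2) * tVar 2) ∧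
    (ladderGF =
      tVar 1 ^ 2 *
          (1 + 3 * zVar + 4 * zVar ^ 2
            - 2 * (1 + 5 * zVar + 4 * zVar ^ 2 + 2 * zVar ^ 3) * tVar 1
            - 16 * zVar ^ 2 * (2 + 6 * zVar + 5 * zVar ^ 2) * tVar 1 ^ 2
            - 128 * zVar ^ 4 * (1 + zVar) * tVar 1 ^ 3)
        / ((1 - 2 * tVar 1 - 4 * tVar 1 * zVar - 16 * zVar ^ 2 * tVar 1 ^ 2)
          * (1 - tVar 1 - 4 * tVar 1 * zVar - 16 * zVar ^ 2 * tVar 1 ^ 2))) ∧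
    (tridiagonalGF =
      (8 * zVar ^ 2 * tVar 1 ^ 2 + 2 * tVar 1 * (1 + zVar))
        / (1 - (4 * zVar + 2) * tVar 1 - 16 * zVar ^ 2 * tVar 1 ^ 2)) := by
  have hs := tVar_ne_zero 1
  have hD := denominator_ne_zero 2
  have hD' := denominator'_ne_zero 2
  have hE := denominator_ne_zero 1
  have hE' := denominator'_ne_zero 1
  obtain ⟨l2, l1⟩ := lambdaGF_two_eq
  obtain ⟨e2, e1⟩ := eulerGF_two_eq
  have h1 := tridiagonalGF_mul
  have h2 := ladderGF_mul
  refine ⟨fun k hk => ?_, fun k hk => ?_, ?_, ?_, ?_, ?_, ?_, ?_⟩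
  · obtain ⟨K, rfl⟩ : ∃ K, k = K + 3 := ⟨k - 3, by omega⟩
    exact genVec_succ K
  · obtain ⟨K, rfl⟩ : ∃ K, k = K + 2 := ⟨k - 2, by omega⟩
    exact genVec_eq_transferProduct K
  · rw [eq_div_iff hD]
    field_simp
    linear_combination l1
  · field_simp
    linear_combination l2
  · rw [← sub_div, eq_div_iff hD']
    field_simp
    linear_combination e1
  · field_simp
    linear_combination -e2
  · rw [eq_div_iff (mul_ne_zero (by convert hE using 3; ring) (by convert hE' using 3; ring))]
    -- L* is eliminated: multiply the equation for φ by the denominator of L* and insert the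
    -- equation for L*.
    linear_combination (1 - 2 * tVar 1 - 4 * tVar 1 * zVar - 16 * zVar ^ 2 * tVar 1 ^ 2) * h2
      + 2 * zVar ^ 2 * tVar 1 ^ 2 * h1
  · rw [eq_div_iff (by convert hE using 2; ring)]
    linear_combination h1
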